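/- Let $C>0$ and $R>1$. There is a constant $K>0$, depending only on $C$ and $R$, such that the following holds for every integer $n\ge 1$, every $\varepsilon\in(0,1/2]$ and every function $g:[0,1]\to\mathbb R$ that is periodic and analytic (that is, $g$ is the restriction of a $1$-periodic real-analytic function on $\mathbb R$) and satisfies $$\|g^{(M)}\|_\infty\le C\,\frac{M!}{R^M}\qquad\text{for all } M\in\mathbb N,\qquad\text{where } \|f\|_\infty=\max_{x\in[0,1]}|f(x)|.$$ Put $N=2^n$. Then the $n$-qubit diagonal operator $\hat D=\sum_{j=0}^{N-1}g(j/N)\,|j\rangle\langle j|$ has a $(\|g\|_\infty,n,\varepsilon)$-block-encoding, i.e. there is a unitary $\hat U$ on $n$ ancilla qubits and $n$ data qubits with $$\bigl\|\hat D-\|g\|_\infty\,(\langle 0|^{\otimes n}\otimes \hat I_n)\,\hat U\,(|0\rangle^{\otimes n}\otimes \hat I_n)\bigr\|\le\varepsilon$$ in spectral norm, which is implemented exactly by a quantum circuit of depth at most $K\log(1/\varepsilon)$ and size at most $K\,n\log(1/\varepsilon)$. Here a circuit is a sequence of layers, each consisting of arbitrary one- and two-qubit unitary gates acting on pairwise disjoint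 sets of qubits (any pair of qubits may interact); its depth is the number of layers and its size is the total number of gates. -/

import Mathlib

open scoped Nat

/-- The supremum norm `max_{x ∈ [0,1]} |f x|` on the unit interval. -/
noncomputable def supNorm01 (f : ℝ → ℝ) : ℝ :=
  sSup ((fun x => |f x|) '' Set.Icc (0 : ℝ) 1)

/-- Operators on a register of qubits labelled by `Q`, as matrices in the computational basis;
a basis state is a bit assignment `Q → Fin 2`. -/
abbrev QOp (Q : Type) : Type := Matrix (Q → Fin 2) (Q → Fin 2) ℂ

/-- The spectral norm (operator norm for the Euclidean norm) of an operator. -/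
noncomputable def specNorm {Q : Type} [Fintype Q] [DecidableEq Q] (A : QOp Q) : ℝ :=
  ‖Matrix.toEuclideanCLM (n := Q → Fin 2) (𝕜 := ℂ) A‖

/-- A primitive gate: an arbitrary one-qubit or two-qubit unitary together with the distinct
qubits on which it acts. -/
structure Gate (Q : Type) where
  arity : ℕ
  one_le_arity : 1 ≤ arity
  arity_le_two : arity ≤ 2
  wires : Fin arity ↪ Q
  mat : Matrix.unitaryGroup (Fin arity → Fin 2) ℂ

/-- The action of a gate on the whole register: the gate on its wires, tensored with the identity
on all the other qubits. -/
def Gate.toOp {Q : Type} [Fintype Q] [DecidableEq Q] (G : Gate Q) : QOp Q :=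
  Matrix.of fun x y =>
    if ∀ q, (∀ i, G.wires i ≠ q) → x q = y q then
      (G.mat : Matrix (Fin G.arity → Fin 2) (Fin G.arity → Fin 2) ℂ)
        (fun i => x (G.wires i)) (fun i => y (G.wires i))
    else 0

/-- A layer: finitely many gates acting on pairwise disjoint sets of qubits. -/
structure Layer (Q : Type) where
  gates : List (Gate Q)
  disjoint : gates.Pairwise fun G H => ∀ i j, G.wires i ≠ H.wires j

/-- The operator of a layer. The gates commute, so their order is irrelevant. -/
def Layer.toOp {Q : Type} [Fintype Q] [DecidableEq Q] (L : Layer Q) : QOp Q :=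
  (L.gates.map Gate.toOp).prod

/-- A quantum circuit: a sequence of layers, the head of the list being applied first. -/
structure QCircuit (Q : Type) where
  layers : List (Layer Q)

/-- The operator implemented by a circuit. -/
def QCircuit.toOp {Q : Type} [Fintype Q] [DecidableEq Q] (c : QCircuit Q) : QOp Q :=
  (c.layers.map Layer.toOp).reverse.prod

/-- The depth: the number of layers of primitive gates. -/
def QCircuit.depth {Q : Type} (c : QCircuit Q) : ℕ := c.layers.length

/-- The size: the total number of primitive gates. -/
def QCircuit.size {Q : Type} (c : QCircuit Q) : ℕ :=
  (c.layers.map fun L => L.gates.length).sum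

/-- The block `(⟨0|^{⊗a} ⊗ I_n) U (|0⟩^{⊗a} ⊗ I_n)` of an operator on `a` ancilla qubits
and `n` data qubits. -/
def ancillaBlock {a n : ℕ} (U : QOp (Fin a ⊕ Fin n)) : QOp (Fin n) :=
  U.submatrix (fun x => Sum.elim (fun _ => 0) x) (fun y => Sum.elim (fun _ => 0) y)

/-- `U` is an `(α, a, ε)`-block-encoding of the `n`-qubit operator `A`. -/
def IsBlockEncoding {n : ℕ} (α : ℝ) (a : ℕ) (ε : ℝ) (U : QOp (Fin a ⊕ Fin n))
    (A : QOp (Fin n)) : Prop :=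
  U ∈ Matrix.unitaryGroup ((Fin a ⊕ Fin n) → Fin 2) ℂ ∧
    specNorm (A - (α : ℂ) • ancillaBlock U) ≤ ε

/-- The diagonal operator `∑_{j < N} g(j/N) |j⟩⟨j|`, `N = 2^n`, where the basis state with
bits `x` is `|j⟩` with `j = ∑ i, x i * 2 ^ i`. -/
noncomputable def diagOp (n : ℕ) (g : ℝ → ℝ) : QOp (Fin n) :=
  Matrix.diagonal fun x => ((g (((finFunctionFinEquiv x : Fin (2 ^ n)) : ℕ) / 2 ^ n) : ℝ) : ℂ)

/-! The value g(j/N), divided by the sup norm, is realised up to the allowed error as the (0,0)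
entry of a product of rotations of one ancilla qubit whose angles depend on the data bits. A single
product for a global Fourier series would need about log(1/ε) signal rotations, each coupling the
ancilla to all data bits and hence each costing a depth that grows with n. Localisation removes this
extra factor.

Let m be of order log(1/ε). Only the top n' = min(n, m) bits are kept; the Lipschitz bound pays for
the rest. Let e be about log₁₆ n'. The top 2e bits select a node t, and the remaining ones give an
offset of at most 4^(-e), stretched to an angle x = 2π·2^e·offset of size O(2^(-e)). On so short an
arc a polynomial in exp(ix) of degree O(a), with a about m/e, reaches error O(2^(-ae)), which is
O(2^(-m)). So O(m/e) rotations of depth O(e) suffice, and the total depth is O(m).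

Analysis (`exists_trig_approx`, `exists_circle_polynomial`): the Fourier coefficients decay like
6^(-|k|), and in the variable x the frequencies k/2^e that remain are at most a. Truncating the
binomial series of (1+v)^μ at v = exp(ix) - 1 turns each exponential into a polynomial in exp(ix).
That polynomial may be exponentially large far from x = 0, while signal processing needs modulus at
most 1 on the whole circle; a factor given by a binomial tail probability cuts it down and is close
to 1 near x = 0.

Algebra (`fejer_riesz`, `exists_qspProd`): a polynomial of modulus below 1 on the circle is
completed to a unit vector of polynomials, and rotations are stripped off one degree at a time.

Circuits (`exists_blockEncoding_of_family`): the angles are arbitrary functions of the 2e node bits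
plus linear functions of the offset bits. All 4^e parities of the node bits are written once into
ancillas, so by Walsh expansion every angle becomes linear in signs of qubits. The rotated qubit is
fanned out to 16^e copies in depth 4e, and boundedly many layers of ZZ rotations apply the linear
phase. For n below a constant, `exists_exact_blockEncoding` is used instead. -/

/-! ### Conjugate reciprocals and the Fejér–Riesz theorem -/

open Polynomial ComplexConjugate in
/-- A complex polynomial is determined by its values on the unit circle. -/
theorem Polynomial.eq_of_eval_eq_on_circle {p q : ℂ[X]}
    (h : ∀ u : ℂ, ‖u‖ = 1 → p.eval u = q.eval u) : p = q := by
  refine Polynomial.eq_of_infinite_eval_eq p q (Set.Infinite.mono (s := Metric.sphere (0 : ℂ) 1) ?_ ?_)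
  · intro u hu
    exact h u (by simpa using hu)
  -- The points exp(in) are pairwise distinct, since a coincidence would make π rational.
  · have : (Set.range fun n : ℕ => (Circle.exp n : ℂ)).Infinite := by
      refine Set.infinite_range_of_injective ?_
      intro a b hab
      have h1 : Circle.exp (a : ℝ) = Circle.exp (b : ℝ) := Subtype.ext hab
      rw [Circle.exp_eq_exp] at h1
      obtain ⟨m, hm⟩ := h1
      by_contra hne
      have hm0 : m ≠ 0 := by
        rintro rfl
        apply hne
        simpa using hm
      have hirr : Irrational Real.pi := irrational_pi
      apply hirr
      refine ⟨((a : ℚ) - b) / (2 * m), ?_⟩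
      push_cast
      have : (m : ℝ) ≠ 0 := by exact_mod_cast hm0
      field_simp
      linarith
    refine this.mono ?_
    rintro _ ⟨n, rfl⟩
    simp only [mem_sphere_iff_norm, sub_zero, Circle.norm_coe]

open Polynomial ComplexConjugate in
/-- The conjugate reciprocal `u ^ N * conj (p (1 / conj u))` of a polynomial. -/
noncomputable def conjReflect (N : ℕ) (p : ℂ[X]) : ℂ[X] := reflect N (p.map (starRingEnd ℂ))

open Polynomial ComplexConjugate in
theorem conjReflect_eval {N : ℕ} {p : ℂ[X]} (hp : p.natDegree ≤ N) {u : ℂ} (hu : u ≠ 0) :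
    (conjReflect N p).eval u = u ^ N * conj (p.eval (conj u)⁻¹) := by
  let _ : Invertible u⁻¹ := invertibleOfNonzero (inv_ne_zero hu)
  have h := eval₂_reflect_mul_pow (RingHom.id ℂ) u⁻¹ N (p.map (starRingEnd ℂ))
    ((natDegree_map_le).trans hp)
  have h2 : ⅟(u⁻¹) = u := by simp
  rw [h2] at h
  have h3 : conj (p.eval (conj u)⁻¹) = eval u⁻¹ (p.map (starRingEnd ℂ)) := by
    rw [eval_map, ← eval₂_id, Polynomial.hom_eval₂]
    simp
  rw [h3, ← eval₂_id (x := u⁻¹), ← h, conjReflect, ← eval₂_id, mul_left_comm, ← mul_pow,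
    mul_inv_cancel₀ hu, one_pow, mul_one]

open Polynomial ComplexConjugate in
theorem conjReflect_eval_of_norm_eq_one {N : ℕ} {p : ℂ[X]} (hp : p.natDegree ≤ N) {u : ℂ}
    (hu : ‖u‖ = 1) : (conjReflect N p).eval u = u ^ N * conj (p.eval u) := by
  have h0 : u ≠ 0 := by rintro rfl; simp at hu
  rw [conjReflect_eval hp h0]
  congr 3
  have : u * conj u = 1 := by rw [Complex.mul_conj']; simp [hu]
  exact (eq_inv_of_mul_eq_one_left this).symm

open Polynomial ComplexConjugate in
theorem conjReflect_coeff (N : ℕ) (p : ℂ[X]) {i : ℕ} (hi : i ≤ N) :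
    (conjReflect N p).coeff i = conj (p.coeff (N - i)) := by
  simp [conjReflect, coeff_reflect, revAt_le hi]

open Polynomial ComplexConjugate in
theorem conjReflect_natDegree_le {N : ℕ} {p : ℂ[X]} (hp : p.natDegree ≤ N) :
    (conjReflect N p).natDegree ≤ N :=
  natDegree_reflect_le.trans (max_le le_rfl ((natDegree_map_le).trans hp))

open Polynomial ComplexConjugate in
/-- **Fejér–Riesz**: a trigonometric polynomial that is positive on the unit circle is the squared
modulus of a polynomial. -/
theorem fejer_riesz (r : ℕ) (F : ℂ[X]) (hdeg : F.natDegree ≤ 2 * r)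
    (hpos : ∀ u : ℂ, ‖u‖ = 1 → ∃ t : ℝ, 0 < t ∧ F.eval u = t * u ^ r) :
    ∃ q : ℂ[X], q.natDegree ≤ r ∧
      ∀ u : ℂ, ‖u‖ = 1 → F.eval u = ((‖q.eval u‖ ^ 2 : ℝ) : ℂ) * u ^ r := by
  induction r generalizing F with
  | zero =>
    obtain ⟨t, ht, h1⟩ := hpos 1 (by simp)
    have hF := eq_C_of_natDegree_le_zero (by simpa using hdeg)
    rw [hF] at h1
    refine ⟨C (Real.sqrt t : ℂ), by simp, fun u hu => ?_⟩
    rw [hF]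
    simp only [eval_C, pow_zero, mul_one] at h1 ⊢
    rw [h1, Complex.norm_real, Real.norm_eq_abs, sq_abs, Real.sq_sqrt ht.le]
  | succ r ih =>
    -- On the circle F is a real multiple of u^(r+1), which is exactly invariance under conjugate
    -- reciprocity in degree 2(r+1).
    have hself : conjReflect (2 * (r + 1)) F = F := by
      refine Polynomial.eq_of_eval_eq_on_circle fun u hu => ?_
      obtain ⟨t, ht, h1⟩ := hpos u hu
      have huc : u * conj u = 1 := by rw [Complex.mul_conj']; simp [hu]
      rw [conjReflect_eval_of_norm_eq_one hdeg hu, h1]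
      simp only [map_mul, Complex.conj_ofReal, map_pow]
      calc u ^ (2 * (r + 1)) * (t * conj u ^ (r + 1))
          = t * u ^ (r + 1) * (u * conj u) ^ (r + 1) := by ring
        _ = _ := by rw [huc]; ring
    have hcoeff : F.coeff 0 = conj (F.coeff (2 * (r + 1))) := by
      conv_lhs => rw [← hself]
      rw [conjReflect_coeff _ _ (Nat.zero_le _), Nat.sub_zero]
    by_cases htop : F.coeff (2 * (r + 1)) = 0
    -- Self-reciprocity makes the constant coefficient vanish with the top one, so a factor X splits
    -- off and the degree bound drops by two.
    · rw [htop, map_zero] at hcoeff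
      obtain ⟨F', rfl⟩ := X_dvd_iff.2 hcoeff
      have hd : F'.natDegree ≤ 2 * r := by
        rw [natDegree_le_iff_coeff_eq_zero] at hdeg ⊢
        intro N hN
        rcases eq_or_lt_of_le (Nat.succ_le_of_lt hN) with h | h
        · have := htop
          rwa [show 2 * (r + 1) = (2 * r).succ + 1 by omega, coeff_X_mul, ← Nat.succ_eq_add_one, h] at this
        · have := hdeg (N + 1) (by omega)
          rwa [coeff_X_mul] at this
      have key : ∀ u : ℂ, ‖u‖ = 1 → ∃ t : ℝ, 0 < t ∧ F'.eval u = t * u ^ r := by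
        intro u hu
        obtain ⟨t, ht, h1⟩ := hpos u hu
        have h0 : u ≠ 0 := by rintro rfl; simp at hu
        refine ⟨t, ht, mul_left_cancel₀ h0 ?_⟩
        rw [eval_mul, eval_X] at h1
        rw [h1]; ring
      obtain ⟨q, hq, h⟩ := ih F' hd key
      refine ⟨q, by omega, fun u hu => ?_⟩
      rw [eval_mul, eval_X, h u hu]; ring
    · have hnd : F.natDegree = 2 * (r + 1) :=
        le_antisymm hdeg (le_natDegree_of_ne_zero htop)
      obtain ⟨α, hα⟩ := IsAlgClosed.exists_root F (by
        intro h
        have := natDegree_eq_zero_iff_degree_le_zero.2 h.le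
        omega)
      have hα0 : α ≠ 0 := by
        rintro rfl
        rw [IsRoot, ← coeff_zero_eq_eval_zero, hcoeff] at hα
        exact htop (by simpa using hα)
      have hα1 : ‖α‖ ≠ 1 := by
        intro h
        obtain ⟨t, ht, h1⟩ := hpos α h
        rw [hα.eq_zero] at h1
        have : (t : ℂ) * α ^ (r + 1) ≠ 0 :=
          mul_ne_zero (by exact_mod_cast ht.ne') (pow_ne_zero _ hα0)
        exact this h1.symm
      have hca : conj α ≠ 0 := by simpa using hα0
      -- Roots come in pairs reflected in the circle. The two are distinct because positivity
      -- excludes roots on the circle.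
      have hβ : F.IsRoot (conj α)⁻¹ := by
        have h1 := conjReflect_eval hdeg hα0
        rw [hself, hα.eq_zero] at h1
        have := (mul_eq_zero.1 h1.symm).resolve_left (pow_ne_zero _ hα0)
        simpa using this
      obtain ⟨G, hG⟩ := dvd_iff_isRoot.2 hα
      have hne : (conj α)⁻¹ ≠ α := by
        intro h
        have h2 : α * conj α = 1 := by
          rw [← h, map_inv₀, Complex.conj_conj, h, mul_inv_cancel₀ hα0]
        rw [Complex.mul_conj'] at h2
        have h3 : ‖α‖ ^ 2 = 1 := by exact_mod_cast h2
        exact hα1 (by nlinarith [norm_nonneg α])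
      have hβG : G.IsRoot (conj α)⁻¹ := by
        have h1 := hβ.eq_zero
        rw [hG, eval_mul] at h1
        refine (mul_eq_zero.1 h1).resolve_left ?_
        simpa [sub_eq_zero] using hne
      obtain ⟨E, hE⟩ := dvd_iff_isRoot.2 hβG
      have hF0 : F ≠ 0 := by rintro rfl; simp at htop
      have hE0 : E ≠ 0 := by rintro rfl; simp [hE] at hG; exact hF0 hG
      have hdE : E.natDegree = 2 * r := by
        have h1 : F.natDegree = 1 + (1 + E.natDegree) := by
          rw [hG, hE, natDegree_mul (X_sub_C_ne_zero _) (mul_ne_zero (X_sub_C_ne_zero _) hE0),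
            natDegree_mul (X_sub_C_ne_zero _) hE0, natDegree_X_sub_C, natDegree_X_sub_C]
        omega
      -- On the circle (u - α)(u - 1/ᾱ) = -ᾱ⁻¹ u |u - α|², so removing the pair of roots leaves a
      -- function of the same kind with r in place of r + 1.
      have hfac : ∀ u : ℂ, ‖u‖ = 1 →
          F.eval u = u * ((‖u - α‖ ^ 2 : ℝ) : ℂ) * (C (-(conj α)⁻¹) * E).eval u := by
        intro u hu
        have huc : u * conj u = 1 := by rw [Complex.mul_conj']; simp [hu]
        have h2 : ((‖u - α‖ ^ 2 : ℝ) : ℂ) = (u - α) * (conj u - conj α) := by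
          rw [← map_sub, Complex.mul_conj']; push_cast; rfl
        rw [h2, hG, hE]
        simp only [eval_mul, eval_sub, eval_X, eval_C]
        field_simp
        linear_combination ((u - α) * eval u E) * huc
      have hua : ∀ u : ℂ, ‖u‖ = 1 → 0 < ‖u - α‖ ^ 2 := by
        intro u hu
        have : u - α ≠ 0 := by
          intro h
          rw [sub_eq_zero] at h
          exact hα1 (h ▸ hu)
        positivity
      obtain ⟨q, hq, h⟩ := ih (C (-(conj α)⁻¹) * E)
        ((natDegree_C_mul_le _ _).trans hdE.le) (by
          intro u hu
          obtain ⟨t, ht, h1⟩ := hpos u hu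
          have h0 : u ≠ 0 := by rintro rfl; simp at hu
          refine ⟨t / ‖u - α‖ ^ 2, div_pos ht (hua u hu), ?_⟩
          rw [hfac u hu] at h1
          have h3 : ((‖u - α‖ ^ 2 : ℝ) : ℂ) ≠ 0 := by exact_mod_cast (hua u hu).ne'
          apply mul_left_cancel₀ (mul_ne_zero h0 h3)
          rw [h1]
          rw [Complex.ofReal_div]
          field_simp
          ring)
      refine ⟨(X - C α) * q, ?_, fun u hu => ?_⟩
      · refine natDegree_mul_le.trans ?_
        rw [natDegree_X_sub_C]; omega
      · rw [hfac u hu, h u hu]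
        simp only [eval_mul, eval_sub, eval_X, eval_C, norm_mul, mul_pow]
        push_cast
        ring

open Polynomial ComplexConjugate in
/-- A polynomial of modulus less than one on the circle has a complementary polynomial. -/
theorem exists_complementary_polynomial {r : ℕ} {p : ℂ[X]} (hp : p.natDegree ≤ r)
    (hlt : ∀ u : ℂ, ‖u‖ = 1 → ‖p.eval u‖ < 1) :
    ∃ q : ℂ[X], q.natDegree ≤ r ∧
      ∀ u : ℂ, ‖u‖ = 1 → ‖p.eval u‖ ^ 2 + ‖q.eval u‖ ^ 2 = 1 := by
  -- 1 - |p|² multiplied by u^r is a polynomial of degree at most 2r, in the form that `fejer_riesz`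
  -- accepts.
  have hev : ∀ u : ℂ, ‖u‖ = 1 → (X ^ r - p * conjReflect r p).eval u =
      ((1 - ‖p.eval u‖ ^ 2 : ℝ) : ℂ) * u ^ r := by
    intro u hu
    rw [eval_sub, eval_mul, conjReflect_eval_of_norm_eq_one hp hu, eval_pow, eval_X]
    have := Complex.mul_conj' (p.eval u)
    push_cast
    linear_combination (-u ^ r) * this
  obtain ⟨q, hq, h⟩ := fejer_riesz r (X ^ r - p * conjReflect r p) (by
      refine (natDegree_sub_le _ _).trans (max_le ?_ ?_)
      · rw [natDegree_X_pow]; omega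
      · refine natDegree_mul_le.trans ?_
        have := conjReflect_natDegree_le hp
        omega) (fun u hu => ⟨_, by nlinarith [hlt u hu, norm_nonneg (p.eval u)], hev u hu⟩)
  refine ⟨q, hq, fun u hu => ?_⟩
  have h1 := h u hu
  rw [hev u hu] at h1
  have h0 : u ^ r ≠ 0 := pow_ne_zero _ (by rintro rfl; simp at hu)
  have h2 := mul_right_cancel₀ h0 h1
  have h3 : 1 - ‖p.eval u‖ ^ 2 = ‖q.eval u‖ ^ 2 := by exact_mod_cast h2
  linarith

/-! ### Single-qubit rotations and quantum signal processing -/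

/-- The rotation `exp (i θ Z)`. -/
noncomputable def zRot (θ : ℝ) : Matrix (Fin 2) (Fin 2) ℂ :=
  !![Complex.exp (θ * Complex.I), 0; 0, Complex.exp (-(θ * Complex.I))]

/-- The Hadamard matrix. -/
noncomputable def hadamard : Matrix (Fin 2) (Fin 2) ℂ :=
  !![((Real.sqrt 2)⁻¹ : ℝ), ((Real.sqrt 2)⁻¹ : ℝ); ((Real.sqrt 2)⁻¹ : ℝ), (-(Real.sqrt 2)⁻¹ : ℝ)]

theorem zRot_add (a b : ℝ) : zRot (a + b) = zRot a * zRot b := by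
  ext i j
  fin_cases i <;> fin_cases j <;>
    simp [zRot, Matrix.mul_apply, ← Complex.exp_add] <;> ring_nf

theorem hadamard_zRot_hadamard (b : ℝ) :
    hadamard * zRot b * hadamard =
      !![(Real.cos b : ℂ), Complex.I * Real.sin b; Complex.I * Real.sin b, (Real.cos b : ℂ)] := by
  have h2 : ((Real.sqrt 2 : ℝ) : ℂ) ^ 2 = 2 := by
    rw [← Complex.ofReal_pow, Real.sq_sqrt (by norm_num)]; norm_num
  have hI := Complex.exp_mul_I (b : ℂ)
  have hI' := Complex.exp_mul_I (-b : ℂ)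
  rw [Complex.cos_neg, Complex.sin_neg, neg_mul] at hI'
  have h0 : ((Real.sqrt 2 : ℝ) : ℂ) ≠ 0 := by
    intro h; rw [h] at h2; norm_num at h2
  ext i j
  fin_cases i <;> fin_cases j <;>
    simp [zRot, hadamard, Matrix.mul_apply, hI, hI'] <;> field_simp <;> rw [h2] <;> ring

/-- The rotation `exp (i α Z) exp (i β X)`. -/
noncomputable def zxRot (α β : ℝ) : Matrix (Fin 2) (Fin 2) ℂ :=
  zRot α * (hadamard * zRot β * hadamard)

theorem zxRot_eq (α β : ℝ) : zxRot α β =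
    !![Complex.exp (α * Complex.I) * Real.cos β, Complex.exp (α * Complex.I) * (Complex.I * Real.sin β);
      Complex.exp (-(α * Complex.I)) * (Complex.I * Real.sin β),
      Complex.exp (-(α * Complex.I)) * Real.cos β] := by
  rw [zxRot, hadamard_zRot_hadamard]
  ext i j
  fin_cases i <;> fin_cases j <;> simp [zRot, Matrix.mul_apply]

/-- Every vector of `ℂ²` is a multiple of a first column of a rotation. -/
theorem exists_zxRot_col (x y : ℂ) : ∃ α β δ : ℝ,
    x = Real.sqrt (‖x‖ ^ 2 + ‖y‖ ^ 2) * Complex.exp (δ * Complex.I) *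
      (Complex.exp (α * Complex.I) * Real.cos β) ∧
    y = Real.sqrt (‖x‖ ^ 2 + ‖y‖ ^ 2) * Complex.exp (δ * Complex.I) *
      (Complex.exp (-(α * Complex.I)) * (Complex.I * Real.sin β)) := by
  set ρ := Real.sqrt (‖x‖ ^ 2 + ‖y‖ ^ 2) with hρ
  set z : ℂ := ⟨‖x‖, ‖y‖⟩ with hz
  have hzn : ‖z‖ = ρ := by
    rw [hρ, Complex.norm_def, Complex.normSq_apply, hz]
    congr 1; ring
  have hc : ρ * Real.cos z.arg = ‖x‖ := by
    rw [← hzn]; exact Complex.norm_mul_cos_arg z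
  have hs : ρ * Real.sin z.arg = ‖y‖ := by
    rw [← hzn]; exact Complex.norm_mul_sin_arg z
  -- The moduli fix β through the point (|x|, |y|) of the plane. Half the sum and half the
  -- difference of the arguments fix δ and α, the shift π/2 absorbing the factor i of the lower
  -- entry.
  refine ⟨(x.arg - y.arg + Real.pi / 2) / 2, z.arg, (x.arg + y.arg - Real.pi / 2) / 2, ?_, ?_⟩
  · have h1 := Complex.norm_mul_exp_arg_mul_I x
    have h2 : Complex.exp (((x.arg + y.arg - Real.pi / 2) / 2 : ℝ) * Complex.I) *
        Complex.exp (((x.arg - y.arg + Real.pi / 2) / 2 : ℝ) * Complex.I) =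
        Complex.exp (x.arg * Complex.I) := by
      rw [← Complex.exp_add]; congr 1; push_cast; ring
    have hc' : (ρ : ℂ) * (Real.cos z.arg : ℝ) = ‖x‖ := by exact_mod_cast hc
    linear_combination (-1 : ℂ) * h1 - (ρ * (Real.cos z.arg : ℝ) : ℂ) * h2
      - Complex.exp (x.arg * Complex.I) * hc'
  · have h1 := Complex.norm_mul_exp_arg_mul_I y
    have h2 : Complex.exp (((x.arg + y.arg - Real.pi / 2) / 2 : ℝ) * Complex.I) *
        Complex.exp (-(((x.arg - y.arg + Real.pi / 2) / 2 : ℝ) * Complex.I)) * Complex.I =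
        Complex.exp (y.arg * Complex.I) := by
      nth_rw 3 [← Complex.exp_pi_div_two_mul_I]
      rw [← Complex.exp_add, ← Complex.exp_add]; congr 1; push_cast; ring
    have hs' : (ρ : ℂ) * (Real.sin z.arg : ℝ) = ‖y‖ := by exact_mod_cast hs
    linear_combination (-1 : ℂ) * h1 - (ρ * (Real.sin z.arg : ℝ) : ℂ) * h2
      - Complex.exp (y.arg * Complex.I) * hs'

/-- The quantum-signal-processing product with `r` signal rotations `exp (i θ Z)`. -/
noncomputable def qspProd (α β : ℕ → ℝ) (θ : ℝ) : ℕ → Matrix (Fin 2) (Fin 2) ℂ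
  | 0 => zxRot (α 0) (β 0)
  | r + 1 => zxRot (α (r + 1)) (β (r + 1)) * (zRot θ * qspProd α β θ r)

theorem qspProd_congr {α β α' β' : ℕ → ℝ} (θ : ℝ) {r : ℕ} (hα : ∀ i ≤ r, α i = α' i)
    (hβ : ∀ i ≤ r, β i = β' i) : qspProd α β θ r = qspProd α' β' θ r := by
  induction r with
  | zero => simp [qspProd, hα, hβ]
  | succ r ih =>
    rw [qspProd, qspProd, hα _ le_rfl, hβ _ le_rfl,
      ih (fun i hi => hα i (hi.trans r.le_succ)) (fun i hi => hβ i (hi.trans r.le_succ))]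

open Polynomial ComplexConjugate in
/-- **Quantum signal processing**: a pair of polynomials of degree at most `r` that is a unit
vector on the unit circle is the first column of a product with `r` signal rotations. -/
theorem exists_qspProd (r : ℕ) (p q : ℂ[X]) (hp : p.natDegree ≤ r) (hq : q.natDegree ≤ r)
    (hpq : ∀ u : ℂ, ‖u‖ = 1 → ‖p.eval u‖ ^ 2 + ‖q.eval u‖ ^ 2 = 1) :
    ∃ (α β : ℕ → ℝ) (δ : ℝ), ∀ t : ℝ,
      Complex.exp (δ * Complex.I) * qspProd α β (-t / 2) r 0 0 =
        Complex.exp (-(r * t / 2) * Complex.I) * p.eval (Complex.exp (t * Complex.I)) ∧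
      Complex.exp (δ * Complex.I) * qspProd α β (-t / 2) r 1 0 =
        Complex.exp (-(r * t / 2) * Complex.I) * q.eval (Complex.exp (t * Complex.I)) := by
  induction r generalizing p q with
  | zero =>
    rw [eq_C_of_natDegree_le_zero hp, eq_C_of_natDegree_le_zero hq] at hpq ⊢
    obtain ⟨α, β, δ, h1, h2⟩ := exists_zxRot_col (p.coeff 0) (q.coeff 0)
    have h3 := hpq 1 (by simp)
    simp only [eval_C] at h3
    rw [h3] at h1 h2
    refine ⟨fun _ => α, fun _ => β, δ, fun t => ?_⟩
    simp only [qspProd, zxRot_eq, eval_C]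
    constructor
    · simpa using h1.symm
    · simpa using h2.symm
  | succ r ih =>
    -- The unit-vector condition reads p p* + q q* = X^(r+1); its coefficient in degree 2(r+1) says
    -- that the vectors of top and of bottom coefficients are orthogonal.
    have horth : p.coeff (r + 1) * conj (p.coeff 0) + q.coeff (r + 1) * conj (q.coeff 0) = 0 := by
      have hpoly : p * conjReflect (r + 1) p + q * conjReflect (r + 1) q = X ^ (r + 1) := by
        refine Polynomial.eq_of_eval_eq_on_circle fun u hu => ?_
        simp only [eval_add, eval_mul, eval_pow, eval_X,
          conjReflect_eval_of_norm_eq_one hp hu, conjReflect_eval_of_norm_eq_one hq hu]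
        have h1 : (‖p.eval u‖ ^ 2 + ‖q.eval u‖ ^ 2 : ℂ) = 1 := by exact_mod_cast hpq u hu
        linear_combination u ^ (r + 1) * (Complex.mul_conj' (p.eval u)) +
          u ^ (r + 1) * (Complex.mul_conj' (q.eval u)) + u ^ (r + 1) * h1
      have h2 := congrArg (fun f => f.coeff ((r + 1) + (r + 1))) hpoly
      simp only [coeff_add, coeff_X_pow] at h2
      rw [coeff_mul_add_eq_of_natDegree_le hp (conjReflect_natDegree_le hp),
        coeff_mul_add_eq_of_natDegree_le hq (conjReflect_natDegree_le hq),
        conjReflect_coeff _ _ le_rfl, conjReflect_coeff _ _ le_rfl, Nat.sub_self] at h2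
      simpa using h2
    -- By orthogonality one rotation can be undone so that the first entry loses its top coefficient
    -- and the second its constant one.
    obtain ⟨α, β, h1, h2⟩ : ∃ α β : ℝ,
        Complex.exp (-(α * Complex.I)) * Real.cos β * p.coeff (r + 1) -
          Complex.exp (α * Complex.I) * (Complex.I * Real.sin β) * q.coeff (r + 1) = 0 ∧
        -(Complex.exp (-(α * Complex.I)) * (Complex.I * Real.sin β)) * p.coeff 0 +
          Complex.exp (α * Complex.I) * Real.cos β * q.coeff 0 = 0 := by
      have hcj : ∀ t : ℝ, conj (Complex.exp (t * Complex.I)) = Complex.exp (-(t * Complex.I)) := by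
        intro t; rw [← Complex.exp_conj]; simp
      have hcj' : ∀ t : ℝ, conj (Complex.exp (-(t * Complex.I))) = Complex.exp (t * Complex.I) := by
        intro t; rw [← Complex.exp_conj]; simp
      have hinv : ∀ t : ℝ, Complex.exp (t * Complex.I) * Complex.exp (-(t * Complex.I)) = 1 := by
        intro t; rw [← Complex.exp_add]; simp
      -- The rotation is normally aligned with the bottom vector. If that vanishes the second
      -- condition is void, and the rotation is aligned with the orthogonal complement of the top
      -- vector.
      by_cases hv : ‖p.coeff 0‖ ^ 2 + ‖q.coeff 0‖ ^ 2 = 0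
      · have hp0 : p.coeff 0 = 0 := by
          have : ‖p.coeff 0‖ = 0 := by nlinarith [sq_nonneg ‖p.coeff 0‖, sq_nonneg ‖q.coeff 0‖]
          simpa using this
        have hq0 : q.coeff 0 = 0 := by
          have : ‖q.coeff 0‖ = 0 := by nlinarith [sq_nonneg ‖p.coeff 0‖, sq_nonneg ‖q.coeff 0‖]
          simpa using this
        obtain ⟨α, β, δ, h1, h2⟩ :=
          exists_zxRot_col (-conj (q.coeff (r + 1))) (conj (p.coeff (r + 1)))
        refine ⟨α, β, ?_, by rw [hp0, hq0]; simp⟩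
        generalize Real.sqrt (‖-conj (q.coeff (r + 1))‖ ^ 2 + ‖conj (p.coeff (r + 1))‖ ^ 2) = ρ
          at h1 h2
        have h1' := congrArg conj h1
        have h2' := congrArg conj h2
        simp only [map_neg, map_mul, Complex.conj_conj, hcj, hcj', Complex.conj_ofReal,
          Complex.conj_I] at h1' h2'
        linear_combination (Complex.exp (-(α * Complex.I)) * Real.cos β) * h2' +
          (Complex.exp (α * Complex.I) * (Complex.I * Real.sin β)) * h1'
      · obtain ⟨α, β, δ, h1, h2⟩ := exists_zxRot_col (p.coeff 0) (q.coeff 0)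
        have hρ : ((Real.sqrt (‖p.coeff 0‖ ^ 2 + ‖q.coeff 0‖ ^ 2) : ℝ) : ℂ) ≠ 0 := by
          have : 0 < ‖p.coeff 0‖ ^ 2 + ‖q.coeff 0‖ ^ 2 := lt_of_le_of_ne (by positivity) (Ne.symm hv)
          exact_mod_cast (Real.sqrt_pos.2 this).ne'
        generalize Real.sqrt (‖p.coeff 0‖ ^ 2 + ‖q.coeff 0‖ ^ 2) = ρ at h1 h2 hρ
        refine ⟨α, β, ?_, ?_⟩
        · have h1' := congrArg conj h1
          have h2' := congrArg conj h2
          simp only [map_mul, hcj, hcj', Complex.conj_ofReal, Complex.conj_I] at h1' h2'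
          rw [h1', h2'] at horth
          have hne : (ρ : ℂ) * Complex.exp (-(δ * Complex.I)) ≠ 0 :=
            mul_ne_zero hρ (Complex.exp_ne_zero _)
          apply mul_left_cancel₀ hne
          rw [mul_zero]
          linear_combination horth
        · rw [h1, h2]; ring
    set p' : ℂ[X] := C (Complex.exp (-(α * Complex.I)) * Real.cos β) * p -
      C (Complex.exp (α * Complex.I) * (Complex.I * Real.sin β)) * q with hp'
    set q₁ : ℂ[X] := C (-(Complex.exp (-(α * Complex.I)) * (Complex.I * Real.sin β))) * p +
      C (Complex.exp (α * Complex.I) * Real.cos β) * q with hq₁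
    have hlow : ∀ f : ℂ[X], f.natDegree ≤ r + 1 → f.coeff (r + 1) = 0 → f.natDegree ≤ r := by
      intro f hf h0
      rw [natDegree_le_iff_coeff_eq_zero] at hf ⊢
      intro N hN
      rcases eq_or_lt_of_le (Nat.succ_le_of_lt hN) with h | h
      · rw [← h]; exact h0
      · exact hf N h
    have hp'd : p'.natDegree ≤ r := by
      refine hlow _ ((natDegree_sub_le _ _).trans (max_le ((natDegree_C_mul_le _ _).trans hp)
        ((natDegree_C_mul_le _ _).trans hq))) ?_
      rw [hp', coeff_sub, coeff_C_mul, coeff_C_mul]; exact h1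
    -- The factor X is the relative phase exp(it) between the two entries of the signal rotation
    -- `zRot (-t / 2)`.
    obtain ⟨q', hq'⟩ : X ∣ q₁ := by
      rw [X_dvd_iff, hq₁, coeff_add, coeff_C_mul, coeff_C_mul]; exact h2
    have hq'd : q'.natDegree ≤ r := by
      have hd : q₁.natDegree ≤ r + 1 := (natDegree_add_le _ _).trans
        (max_le ((natDegree_C_mul_le _ _).trans hp) ((natDegree_C_mul_le _ _).trans hq))
      rw [hq', natDegree_le_iff_coeff_eq_zero] at hd
      rw [natDegree_le_iff_coeff_eq_zero]
      intro N hN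
      have := hd (N + 1) (by omega)
      rwa [coeff_X_mul] at this
    have hinv : Complex.exp (α * Complex.I) * Complex.exp (-(α * Complex.I)) = 1 := by
      rw [← Complex.exp_add]; simp
    have hcs : (Real.cos β : ℂ) ^ 2 + (Real.sin β : ℂ) ^ 2 = 1 := by
      exact_mod_cast Real.cos_sq_add_sin_sq β
    have hI := Complex.I_sq
    have hp_eq : ∀ u, p.eval u = Complex.exp (α * Complex.I) * Real.cos β * p'.eval u +
        Complex.exp (α * Complex.I) * (Complex.I * Real.sin β) * (u * q'.eval u) := by
      intro u
      have : u * q'.eval u = q₁.eval u := by rw [hq', eval_mul, eval_X]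
      rw [this, hp', hq₁]
      simp only [eval_add, eval_sub, eval_mul, eval_C]
      linear_combination (-p.eval u * (Real.cos β ^ 2 + Real.sin β ^ 2)) * hinv - p.eval u * hcs
        + (p.eval u * Real.sin β ^ 2) * (Complex.exp (α * Complex.I) * Complex.exp (-(α * Complex.I))) * hI
    have hq_eq : ∀ u, q.eval u = Complex.exp (-(α * Complex.I)) * (Complex.I * Real.sin β) * p'.eval u +
        Complex.exp (-(α * Complex.I)) * Real.cos β * (u * q'.eval u) := by
      intro u
      have : u * q'.eval u = q₁.eval u := by rw [hq', eval_mul, eval_X]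
      rw [this, hp', hq₁]
      simp only [eval_add, eval_sub, eval_mul, eval_C]
      linear_combination (-q.eval u * (Real.cos β ^ 2 + Real.sin β ^ 2)) * hinv - q.eval u * hcs
        + (q.eval u * Real.sin β ^ 2) * (Complex.exp (α * Complex.I) * Complex.exp (-(α * Complex.I))) * hI
    have hnorm : ∀ u : ℂ, ‖u‖ = 1 → ‖p'.eval u‖ ^ 2 + ‖q'.eval u‖ ^ 2 = 1 := by
      intro u hu
      have huc : u * conj u = 1 := by rw [Complex.mul_conj']; simp [hu]
      have h3 : (‖p.eval u‖ ^ 2 + ‖q.eval u‖ ^ 2 : ℂ) = 1 := by exact_mod_cast hpq u hu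
      have hcj : conj (Complex.exp (α * Complex.I)) = Complex.exp (-(α * Complex.I)) := by
        rw [← Complex.exp_conj]; simp
      have hcj' : conj (Complex.exp (-(α * Complex.I))) = Complex.exp (α * Complex.I) := by
        rw [← Complex.exp_conj]; simp
      rw [← Complex.mul_conj', ← Complex.mul_conj', hp_eq u, hq_eq u] at h3
      simp only [map_add, map_mul, hcj, hcj', Complex.conj_ofReal, Complex.conj_I] at h3
      have h4 : (‖p'.eval u‖ ^ 2 + ‖q'.eval u‖ ^ 2 : ℂ) = 1 := by
        rw [← Complex.mul_conj', ← Complex.mul_conj']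
        generalize p'.eval u = a at *
        generalize q'.eval u = b at *
        generalize Complex.exp (α * Complex.I) = E at *
        generalize Complex.exp (-(α * Complex.I)) = E' at *
        generalize (Real.cos β : ℂ) = c at *
        generalize (Real.sin β : ℂ) = s at *
        generalize conj a = a' at *
        generalize conj b = b' at *
        generalize conj u = u' at *
        linear_combination h3 - (b * b') * huc
          - (a * a' + b * b' * u * u') * (c ^ 2 + s ^ 2) * hinv
          - (a * a' + b * b' * u * u') * hcs
          + (a * a' + b * b' * u * u') * (E * E' * s ^ 2) * hI
      exact_mod_cast h4
    obtain ⟨α', β', δ, h⟩ := ih p' q' hp'd hq'd hnorm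
    refine ⟨Function.update α' (r + 1) α, Function.update β' (r + 1) β, δ, fun t => ?_⟩
    obtain ⟨ha, hb⟩ := h t
    have hcg : qspProd (Function.update α' (r + 1) α) (Function.update β' (r + 1) β) (-t / 2) r =
        qspProd α' β' (-t / 2) r := by
      apply qspProd_congr <;> intro i hi <;> rw [Function.update_of_ne (by omega)]
    have hE1 : Complex.exp (((-t / 2 : ℝ) : ℂ) * Complex.I) * Complex.exp (-(r * t / 2) * Complex.I) =
        Complex.exp (-(((r + 1 : ℕ) : ℂ) * t / 2) * Complex.I) := by
      rw [← Complex.exp_add]; congr 1; push_cast; ring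
    have hE2 : Complex.exp (-(((-t / 2 : ℝ) : ℂ) * Complex.I)) * Complex.exp (-(r * t / 2) * Complex.I) =
        Complex.exp (-(((r + 1 : ℕ) : ℂ) * t / 2) * Complex.I) * Complex.exp (t * Complex.I) := by
      rw [← Complex.exp_add, ← Complex.exp_add]; congr 1; push_cast; ring
    rw [qspProd, hcg, Function.update_self, Function.update_self, zxRot_eq, hp_eq, hq_eq]
    generalize qspProd α' β' (-t / 2) r = M at *
    simp only [zRot, Matrix.mul_apply, Fin.sum_univ_two, Matrix.of_apply, Matrix.cons_val',
      Matrix.cons_val_zero, Matrix.cons_val_one, zero_mul, add_zero, zero_add, Matrix.cons_val_fin_one]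
    generalize Complex.exp (-(((-t / 2 : ℝ) : ℂ) * Complex.I)) = G at *
    generalize Complex.exp (((-t / 2 : ℝ) : ℂ) * Complex.I) = G' at *
    constructor
    · linear_combination (Complex.exp (α * Complex.I) * Real.cos β * G') * ha +
        (Complex.exp (α * Complex.I) * (Complex.I * Real.sin β) * G) * hb +
        (Complex.exp (α * Complex.I) * Real.cos β * eval (Complex.exp (t * Complex.I)) p') * hE1 +
        (Complex.exp (α * Complex.I) * (Complex.I * Real.sin β) *
          eval (Complex.exp (t * Complex.I)) q') * hE2
    · linear_combination
        (Complex.exp (-(α * Complex.I)) * (Complex.I * Real.sin β) * G') * ha +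
        (Complex.exp (-(α * Complex.I)) * Real.cos β * G) * hb +
        (Complex.exp (-(α * Complex.I)) * (Complex.I * Real.sin β) *
          eval (Complex.exp (t * Complex.I)) p') * hE1 +
        (Complex.exp (-(α * Complex.I)) * Real.cos β * eval (Complex.exp (t * Complex.I)) q') * hE2

/-! ### Exponentials as truncated binomial series -/

theorem choose_succ_mul_of_complex (μ : ℂ) (l : ℕ) :
    Ring.choose μ (l + 1) * ((l : ℂ) + 1) = Ring.choose μ l * (μ - l) := by
  have h1 := Ring.descPochhammer_eq_factorial_smul_choose μ l
  have h2 := Ring.descPochhammer_eq_factorial_smul_choose μ (l + 1)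
  rw [descPochhammer_succ_right, Polynomial.smeval_mul, h1, Nat.factorial_succ] at h2
  have h3 : ((l ! : ℕ) : ℂ) ≠ 0 := by exact_mod_cast (Nat.factorial_pos l).ne'
  simp [Polynomial.smeval_sub, Polynomial.smeval_natCast, nsmul_eq_mul] at h2
  apply mul_left_cancel₀ h3
  linear_combination -h2

/-- The recurrence multiplies the norm by at most (T + l)/(l + 1), which is no more than the growth
factor of the integer coefficients C(T + l, l). -/
theorem norm_choose_le (μ : ℂ) {T : ℕ} (hμ : ‖μ‖ ≤ T) (l : ℕ) :
    ‖Ring.choose μ l‖ ≤ 2 ^ (T + l) := by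
  have h : ‖Ring.choose μ l‖ ≤ (Nat.choose (T + l) l : ℕ) := by
    induction l with
    | zero => simp
    | succ l ih =>
      have h1 := congrArg norm (choose_succ_mul_of_complex μ l)
      rw [norm_mul, norm_mul] at h1
      have h2 : ‖((l : ℂ) + 1)‖ = (l : ℝ) + 1 := by
        rw [show ((l : ℂ) + 1) = ((l + 1 : ℕ) : ℂ) by push_cast; rfl, Complex.norm_natCast]
        push_cast; rfl
      have h3 : ‖μ - l‖ ≤ T + l := by
        refine (norm_sub_le _ _).trans ?_
        rw [Complex.norm_natCast]; linarith
      have h4 := Nat.add_one_mul_choose_eq (T + l) l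
      have h5 : ((T : ℝ) + l + 1) * (Nat.choose (T + l) l : ℕ) =
          (Nat.choose (T + l + 1) (l + 1) : ℕ) * ((l : ℝ) + 1) := by exact_mod_cast h4
      rw [h2] at h1
      have h6 : (0 : ℝ) < (l : ℝ) + 1 := by positivity
      refine le_of_mul_le_mul_right ?_ h6
      rw [h1, show T + (l + 1) = T + l + 1 by ring, ← h5]
      have : (0 : ℝ) ≤ (Nat.choose (T + l) l : ℕ) := by positivity
      calc ‖Ring.choose μ l‖ * ‖μ - l‖ ≤ (Nat.choose (T + l) l : ℕ) * (T + l) := by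
            gcongr
        _ ≤ _ := by nlinarith
  refine h.trans ?_
  exact_mod_cast Nat.choose_le_two_pow _ _

/-- The truncated binomial series approximates `exp (i μ x)` as a function of `exp (i x) - 1`. -/
theorem norm_exp_sub_binomial_le (μ : ℝ) {T : ℕ} (hμ : |μ| ≤ T) {x : ℝ} (hx : x ∈ Set.Ioc (-Real.pi) Real.pi)
    (hv : ‖Complex.exp (x * Complex.I) - 1‖ ≤ 1 / 4) :
    ‖Complex.exp (μ * x * Complex.I) -
      ∑ l ∈ Finset.range T, Ring.choose (μ : ℂ) l * (Complex.exp (x * Complex.I) - 1) ^ l‖ ≤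
      2 * 2 ^ T * (2 * ‖Complex.exp (x * Complex.I) - 1‖) ^ T := by
  set v := Complex.exp (x * Complex.I) - 1 with hvdef
  have hsum := (Complex.one_add_cpow_hasFPowerSeriesOnBall_zero (a := (μ : ℂ))).hasSum
    (y := v) (by
      rw [Metric.mem_eball, edist_zero_right, ← ofReal_norm, ← ENNReal.ofReal_one]
      exact (ENNReal.ofReal_lt_ofReal_iff (by norm_num)).2 (by linarith))
  have hterm : (fun n => (binomialSeries ℂ (μ : ℂ)) n fun _ => v) =
      fun n => Ring.choose (μ : ℂ) n * v ^ n := by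
    funext n
    rw [binomialSeries_apply]
    simp
  rw [hterm] at hsum
  -- The principal branch returns ix because x lies in (-π, π].
  have hval : (1 + (0 + v)) ^ (μ : ℂ) = Complex.exp (μ * x * Complex.I) := by
    have h1 : 1 + (0 + v) = Complex.exp (x * Complex.I) := by rw [hvdef]; ring
    rw [h1, Complex.cpow_def_of_ne_zero (Complex.exp_ne_zero _), Complex.log_exp]
    · congr 1; ring
    · simpa using hx.1
    · simpa using hx.2
  rw [hval] at hsum
  have hmul : ‖v‖ < 1 := by linarith
  have hq : 2 * ‖v‖ ≤ 1 / 2 := by linarith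
  have hbd : ∀ l, ‖Ring.choose (μ : ℂ) (l + T) * v ^ (l + T)‖ ≤
      2 ^ T * (2 * ‖v‖) ^ T * (1 / 2) ^ l := by
    intro l
    rw [norm_mul, norm_pow]
    have h1 := norm_choose_le (μ : ℂ) (T := T) (by rwa [Complex.norm_real]) (l + T)
    calc _ ≤ 2 ^ (T + (l + T)) * ‖v‖ ^ (l + T) := by gcongr
      _ = 2 ^ T * (2 * ‖v‖) ^ T * (2 * ‖v‖) ^ l := by ring
      _ ≤ _ := by gcongr
  have htail := (hasSum_nat_add_iff' T).2 hsum
  have hgeo : HasSum (fun l : ℕ => 2 ^ T * (2 * ‖v‖) ^ T * (1 / 2 : ℝ) ^ l)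
      (2 ^ T * (2 * ‖v‖) ^ T * 2) := hasSum_geometric_two.mul_left _
  have := tsum_of_norm_bounded hgeo hbd
  rw [htail.tsum_eq] at this
  calc _ ≤ _ := this
    _ = _ := by ring

/-! ### The binomial window and polynomials bounded on the circle -/

/-- The probability of fewer than `a` successes in `N` trials of success probability `t`. -/
noncomputable def binomialWindow (N a : ℕ) (t : ℝ) : ℝ :=
  ∑ i ∈ Finset.range a, (N.choose i : ℝ) * t ^ i * (1 - t) ^ (N - i)

theorem binomialWindow_nonneg (N a : ℕ) {t : ℝ} (h0 : 0 ≤ t) (h1 : t ≤ 1) :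
    0 ≤ binomialWindow N a t := by
  have : 0 ≤ 1 - t := by linarith
  exact Finset.sum_nonneg fun i _ => by positivity

theorem one_sub_binomialWindow {N a : ℕ} (ha : a ≤ N) (t : ℝ) :
    1 - binomialWindow N a t = ∑ j ∈ Finset.range (N - a + 1),
      (N.choose (a + j) : ℝ) * t ^ (a + j) * (1 - t) ^ (N - (a + j)) := by
  have h := add_pow t (1 - t) N
  rw [show N + 1 = a + (N - a + 1) by omega, Finset.sum_range_add] at h
  have h2 : t + (1 - t) = 1 := by ring
  rw [h2, one_pow] at h
  rw [binomialWindow, sub_eq_iff_eq_add]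
  refine h.trans ?_
  rw [add_comm]
  congr 1 <;> exact Finset.sum_congr rfl fun i _ => by ring

/-- If the first a trials succeed there are at least a successes; in coefficients, C(N - a, j) ≤
C(N, a + j). This quantitative gap below 1 leaves room for the approximation error of the factor
that the window multiplies. -/
theorem pow_le_one_sub_binomialWindow {N a : ℕ} (ha : a ≤ N) {t : ℝ} (h0 : 0 ≤ t) (h1 : t ≤ 1) :
    t ^ a ≤ 1 - binomialWindow N a t := by
  rw [one_sub_binomialWindow ha]
  have h := add_pow t (1 - t) (N - a)
  have h2 : t + (1 - t) = 1 := by ring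
  rw [h2, one_pow] at h
  calc t ^ a = t ^ a * 1 := (mul_one _).symm
    _ = _ := by rw [h, Finset.mul_sum]
    _ ≤ _ := by
      refine Finset.sum_le_sum fun j hj => ?_
      have hj' : j ≤ N - a := by simpa [Nat.lt_succ_iff] using hj
      have hc : ((N - a).choose j : ℝ) ≤ (N.choose (a + j) : ℝ) := by
        have h3 : (N - a).choose j = (N - a).choose (N - a - j) := (Nat.choose_symm hj').symm
        have h4 : N.choose (a + j) = N.choose (N - a - j) := by
          rw [← Nat.choose_symm (by omega : a + j ≤ N)]; congr 1; omega
        rw [h3, h4]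
        exact_mod_cast Nat.choose_le_choose _ (Nat.sub_le _ _)
      have : 0 ≤ 1 - t := by linarith
      calc t ^ a * (t ^ j * (1 - t) ^ (N - a - j) * ((N - a).choose j : ℝ))
          = ((N - a).choose j : ℝ) * (t ^ (a + j) * (1 - t) ^ (N - (a + j))) := by
            rw [show N - (a + j) = N - a - j by omega]; ring
        _ ≤ (N.choose (a + j) : ℝ) * (t ^ (a + j) * (1 - t) ^ (N - (a + j))) := by gcongr
        _ = _ := by ring

theorem one_sub_binomialWindow_le {N a : ℕ} (ha : a ≤ N) {t : ℝ} (h0 : 0 ≤ t) (h1 : t ≤ 1) :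
    1 - binomialWindow N a t ≤ 2 ^ N * t ^ a := by
  rw [one_sub_binomialWindow ha]
  have hs : (∑ j ∈ Finset.range (N - a + 1), (N.choose (a + j) : ℝ)) ≤ 2 ^ N := by
    have h := Nat.sum_range_choose N
    rw [show N + 1 = a + (N - a + 1) by omega, Finset.sum_range_add] at h
    have : (∑ j ∈ Finset.range (N - a + 1), N.choose (a + j)) ≤ 2 ^ N := by omega
    exact_mod_cast this
  calc _ ≤ ∑ j ∈ Finset.range (N - a + 1), (N.choose (a + j) : ℝ) * t ^ a := by
        refine Finset.sum_le_sum fun j _ => ?_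
        have h2 : t ^ (a + j) ≤ t ^ a := pow_le_pow_of_le_one h0 h1 (Nat.le_add_right _ _)
        have h3 : (1 - t) ^ (N - (a + j)) ≤ 1 := pow_le_one₀ (by linarith) (by linarith)
        have h4 : (0 : ℝ) ≤ (1 - t) ^ (N - (a + j)) := pow_nonneg (by linarith) _
        rw [mul_assoc]
        refine mul_le_mul_of_nonneg_left ?_ (by positivity)
        calc _ ≤ t ^ a * 1 := by gcongr
          _ = _ := mul_one _
    _ = (∑ j ∈ Finset.range (N - a + 1), (N.choose (a + j) : ℝ)) * t ^ a := by
        rw [Finset.sum_mul]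
    _ ≤ _ := by gcongr

/-- Exponential Markov inequality: the number of successes S satisfies E[2^(-S)] = (1 - t/2)^N, and
2^(a - S) ≥ 1 when S < a. -/
theorem binomialWindow_le {N a : ℕ} (ha : a ≤ N) {t : ℝ} (h0 : 0 ≤ t) (h1 : t ≤ 1) :
    binomialWindow N a t ≤ 2 ^ a * (1 - t / 2) ^ N := by
  have h := add_pow (t / 2) (1 - t) N
  rw [show t / 2 + (1 - t) = 1 - t / 2 by ring] at h
  have h2 : 0 ≤ 1 - t := by linarith
  rw [h, binomialWindow, Finset.mul_sum]
  calc _ ≤ ∑ i ∈ Finset.range a, (2 : ℝ) ^ a * ((t / 2) ^ i * (1 - t) ^ (N - i) * (N.choose i : ℝ)) := by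
        refine Finset.sum_le_sum fun i hi => ?_
        have hi' : i ≤ a := (Finset.mem_range.1 hi).le
        have h3 : (2 : ℝ) ^ i ≤ 2 ^ a := pow_le_pow_right₀ (by norm_num) hi'
        calc _ = (2 : ℝ) ^ i * ((t / 2) ^ i * (1 - t) ^ (N - i) * (N.choose i : ℝ)) := by
              rw [div_pow]; field_simp
          _ ≤ _ := by gcongr
    _ ≤ _ := by
        refine Finset.sum_le_sum_of_subset_of_nonneg ?_ fun i _ _ => by positivity
        intro i hi
        simp only [Finset.mem_range] at hi ⊢
        omega

open Polynomial in
/-- The window as a polynomial on the circle, up to the factor `u ^ N`. -/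
noncomputable def windowPoly (N a : ℕ) : ℂ[X] :=
  ∑ i ∈ Finset.range a, C (N.choose i : ℂ) * (C (-(1 / 4)) * (X - C 1) ^ 2) ^ i *
    (C (1 / 4) * (X + C 1) ^ 2) ^ (N - i)

open Polynomial in
theorem windowPoly_natDegree_le {N a : ℕ} (ha : a ≤ N) : (windowPoly N a).natDegree ≤ 2 * N := by
  refine natDegree_sum_le_of_forall_le _ _ fun i hi => ?_
  have hi' : i ≤ N := (Finset.mem_range.1 hi).le.trans ha
  have h1 : (C (-(1 / 4) : ℂ) * (X - C 1) ^ 2).natDegree ≤ 2 := by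
    refine (natDegree_C_mul_le _ _).trans (natDegree_pow_le.trans ?_)
    rw [natDegree_X_sub_C]
  have h2 : (C (1 / 4 : ℂ) * (X + C 1) ^ 2).natDegree ≤ 2 := by
    refine (natDegree_C_mul_le _ _).trans (natDegree_pow_le.trans ?_)
    rw [natDegree_X_add_C]
  refine natDegree_mul_le.trans ?_
  have h3 := natDegree_pow_le_of_le i h1
  have h4 := natDegree_pow_le_of_le (N - i) h2
  have h5 := (natDegree_C_mul_le (N.choose i : ℂ) ((C (-(1 / 4)) * (X - C 1) ^ 2) ^ i)).trans h3
  omega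

-- With t = |u - 1|²/4 on the circle, ut = -(u - 1)²/4 and u(1 - t) = (u + 1)²/4, so each binomial
-- term becomes polynomial after multiplication by u^N.
open Polynomial ComplexConjugate in
theorem windowPoly_eval {N a : ℕ} (ha : a ≤ N) {u : ℂ} (hu : ‖u‖ = 1) :
    (windowPoly N a).eval u = u ^ N * (binomialWindow N a (‖u - 1‖ ^ 2 / 4) : ℝ) := by
  have huc : u * conj u = 1 := by rw [Complex.mul_conj']; simp [hu]
  have ht : ((‖u - 1‖ ^ 2 / 4 : ℝ) : ℂ) = (u - 1) * (conj u - 1) / 4 := by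
    have := Complex.mul_conj' (u - 1)
    rw [map_sub, map_one] at this
    rw [this]; push_cast; rfl
  have h1 : -(1 / 4) * (u - 1) ^ 2 = u * ((‖u - 1‖ ^ 2 / 4 : ℝ) : ℂ) := by
    rw [ht]; linear_combination (-(u - 1) / 4) * huc
  have h2 : (1 / 4) * (u + 1) ^ 2 = u * (1 - ((‖u - 1‖ ^ 2 / 4 : ℝ) : ℂ)) := by
    rw [ht]; linear_combination ((u - 1) / 4) * huc
  rw [windowPoly, eval_finsetSum, binomialWindow]
  push_cast [Finset.mul_sum]
  refine Finset.sum_congr rfl fun i hi => ?_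
  have hi' : i ≤ N := (Finset.mem_range.1 hi).le.trans ha
  simp only [eval_mul, eval_pow, eval_C, eval_sub, eval_add, eval_X]
  rw [h1, h2, mul_pow, mul_pow]
  conv_rhs => rw [← Nat.add_sub_cancel' hi', pow_add]
  push_cast
  rw [Nat.add_sub_cancel' hi']
  ring

theorem norm_exp_mul_I_sub_one_le (x : ℝ) : ‖Complex.exp (x * Complex.I) - 1‖ ≤ |x| := by
  have := Real.norm_exp_I_mul_ofReal_sub_one_le (x := x)
  rwa [mul_comm, Real.norm_eq_abs] at this

open Polynomial in
/-- A bounded sum of exponentials of low frequency is approximated near `0` by a polynomial in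
`exp (i x)` that is bounded by one on the whole circle. -/
theorem exists_circle_polynomial {ι : Type*} (s : Finset ι) (c : ι → ℂ) (μ : ι → ℝ) {a N : ℕ}
    (hc : ∀ k ∈ s, ‖c k‖ ≤ 1) (hμ : ∀ k ∈ s, |μ k| ≤ (4 * a : ℕ))
    (hcard : 2 * (s.card : ℝ) ≤ 2 ^ (4 * a)) (haN : a ≤ N)
    (hN : (2 : ℝ) ^ (17 * a) * (1 - 1 / 2 ^ 17) ^ N ≤ 1)
    (hF : ∀ x : ℝ, ‖∑ k ∈ s, c k * Complex.exp (μ k * x * Complex.I)‖ ≤ 1) :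
    ∃ p : ℂ[X], p.natDegree ≤ 2 * N + 4 * a ∧ (∀ u : ℂ, ‖u‖ = 1 → ‖p.eval u‖ ≤ 1) ∧
      ∀ x : ℝ, |x| ≤ 1 / 4 → ‖p.eval (Complex.exp (x * Complex.I)) -
        Complex.exp (N * x * Complex.I) * ∑ k ∈ s, c k * Complex.exp (μ k * x * Complex.I)‖ ≤
        (8 * |x|) ^ (4 * a) + 2 ^ N * |x| ^ (2 * a) := by
  set T := 4 * a with hT
  set P : ℂ[X] := ∑ k ∈ s, C (c k) * ∑ l ∈ Finset.range T, C (Ring.choose (μ k : ℂ) l) *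
    (X - C 1) ^ l with hP
  have hPev : ∀ u, P.eval u = ∑ k ∈ s, c k * ∑ l ∈ Finset.range T,
      Ring.choose (μ k : ℂ) l * (u - 1) ^ l := by
    intro u
    simp [hP, eval_finsetSum]
  have hPdeg : P.natDegree ≤ T := by
    refine natDegree_sum_le_of_forall_le _ _ fun k _ => ?_
    refine (natDegree_C_mul_le _ _).trans ?_
    refine natDegree_sum_le_of_forall_le _ _ fun l hl => ?_
    refine (natDegree_C_mul_le _ _).trans (natDegree_pow_le.trans ?_)
    rw [natDegree_X_sub_C]
    have := Finset.mem_range.1 hl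
    omega
  have hPF : ∀ x ∈ Set.Ioc (-Real.pi) Real.pi, ‖Complex.exp (x * Complex.I) - 1‖ ≤ 1 / 4 →
      ‖P.eval (Complex.exp (x * Complex.I)) - ∑ k ∈ s, c k * Complex.exp (μ k * x * Complex.I)‖ ≤
        (8 * ‖Complex.exp (x * Complex.I) - 1‖) ^ T := by
    intro x hx hv
    rw [hPev, ← Finset.sum_sub_distrib]
    have hterm : ∀ k ∈ s, ‖c k * (∑ l ∈ Finset.range T, Ring.choose (μ k : ℂ) l *
          (Complex.exp (x * Complex.I) - 1) ^ l) - c k * Complex.exp (μ k * x * Complex.I)‖ ≤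
        2 * 2 ^ T * (2 * ‖Complex.exp (x * Complex.I) - 1‖) ^ T := by
      intro k hk
      rw [← mul_sub, norm_mul, norm_sub_rev]
      calc _ ≤ 1 * _ := mul_le_mul (hc k hk) (norm_exp_sub_binomial_le (μ k) (hμ k hk) hx hv)
            (norm_nonneg _) zero_le_one
        _ = _ := one_mul _
    refine (norm_sum_le_of_le _ hterm).trans ?_
    rw [Finset.sum_const, nsmul_eq_mul]
    calc _ = (2 * (s.card : ℝ)) * (2 ^ T * (2 * ‖Complex.exp (x * Complex.I) - 1‖) ^ T) := by ring
      _ ≤ 2 ^ T * (2 ^ T * (2 * ‖Complex.exp (x * Complex.I) - 1‖) ^ T) := by gcongr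
      -- One factor 2^T comes from the number of exponentials and two from the binomial tail, hence
      -- the base 8.
      _ = _ := by rw [← mul_pow, ← mul_pow]; ring_nf
  have hv2 : ∀ u : ℂ, ‖u‖ = 1 → ‖u - 1‖ ≤ 2 := by
    intro u hu
    refine (norm_sub_le _ _).trans ?_
    rw [hu, norm_one]; norm_num
  have hPbd : ∀ u : ℂ, ‖u‖ = 1 → ‖P.eval u‖ ≤ 2 ^ (16 * a) := by
    intro u hu
    rw [hPev]
    have hterm : ∀ k ∈ s, ‖c k * (∑ l ∈ Finset.range T, Ring.choose (μ k : ℂ) l *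
          (u - 1) ^ l)‖ ≤ 2 ^ T * 4 ^ T := by
      intro k hk
      rw [norm_mul]
      have h1 : ‖∑ l ∈ Finset.range T, Ring.choose (μ k : ℂ) l * (u - 1) ^ l‖ ≤ 2 ^ T * 4 ^ T := by
        have h2 : ∀ l ∈ Finset.range T, ‖Ring.choose (μ k : ℂ) l * (u - 1) ^ l‖ ≤ 2 ^ T * 4 ^ l := by
          intro l _
          rw [norm_mul, norm_pow]
          have h3 := norm_choose_le (μ k : ℂ) (T := T) (by rw [Complex.norm_real]; exact hμ k hk) l
          calc _ ≤ (2 : ℝ) ^ (T + l) * 2 ^ l := by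
                gcongr
                exact hv2 u hu
            _ = 2 ^ T * (2 * 2) ^ l := by rw [mul_pow, pow_add]; ring
            _ = _ := by norm_num
        refine (norm_sum_le_of_le _ h2).trans ?_
        rw [← Finset.mul_sum]
        gcongr
        have := Nat.geomSum_lt (m := 4) (n := T) (s := Finset.range T) (by norm_num)
          (fun k hk => Finset.mem_range.1 hk)
        exact_mod_cast this.le
      calc _ ≤ 1 * (2 ^ T * 4 ^ T) := mul_le_mul (hc k hk) h1 (norm_nonneg _) zero_le_one
        _ = _ := one_mul _
    refine (norm_sum_le_of_le _ hterm).trans ?_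
    rw [Finset.sum_const, nsmul_eq_mul]
    have h1 : (s.card : ℝ) ≤ 2 ^ T := by
      have : (0 : ℝ) ≤ s.card := by positivity
      linarith
    calc _ ≤ (2 : ℝ) ^ T * (2 ^ T * 4 ^ T) := by gcongr
      _ = (2 * (2 * 4)) ^ T := by rw [mul_pow, mul_pow]
      -- This crude bound on the whole circle is what the window has to beat away from 1.
      _ = 2 ^ (16 * a) := by rw [hT]; norm_num [pow_mul]
  have ht01 : ∀ u : ℂ, ‖u‖ = 1 → 0 ≤ ‖u - 1‖ ^ 2 / 4 ∧ ‖u - 1‖ ^ 2 / 4 ≤ 1 := by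
    intro u hu
    have := hv2 u hu
    have h0 := norm_nonneg (u - 1)
    exact ⟨by positivity, by nlinarith⟩
  have hpow : ∀ v : ℝ, (v ^ 2 / 4) ^ a = (v / 2) ^ (2 * a) := by
    intro v; rw [pow_mul]; congr 1; ring
  refine ⟨windowPoly N a * P, natDegree_mul_le.trans (add_le_add (windowPoly_natDegree_le haN) hPdeg),
    fun u hu => ?_, fun x hx => ?_⟩
  · rw [eval_mul, windowPoly_eval haN hu, norm_mul, norm_mul, norm_pow, hu, one_pow, one_mul,
      Complex.norm_real, Real.norm_eq_abs]
    obtain ⟨h0, h1⟩ := ht01 u hu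
    rw [abs_of_nonneg (binomialWindow_nonneg N a h0 h1)]
    -- Up to distance 2^(-7) the fourth power (8|v|)^4 is at most v²/4 = t, so |P| ≤ 1 + t^a, while
    -- the window is at most 1 - t^a and the product stays below 1. Beyond it t ≥ 2^(-16), and the
    -- exponential decay of the window wins through `hN`.
    rcases le_or_gt ‖u - 1‖ (1 / 2 ^ 7) with hsmall | hlarge
    · have hu' : Complex.exp (u.arg * Complex.I) = u := by
        have := Complex.norm_mul_exp_arg_mul_I u
        rwa [hu, Complex.ofReal_one, one_mul] at this
      have h2 := hPF u.arg (Complex.arg_mem_Ioc u) (by rw [hu']; linarith)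
      rw [hu'] at h2
      have h3 : ‖P.eval u‖ ≤ 1 + (‖u - 1‖ ^ 2 / 4) ^ a := by
        have h4 : (8 * ‖u - 1‖) ^ T ≤ (‖u - 1‖ ^ 2 / 4) ^ a := by
          rw [hT, pow_mul]
          apply pow_le_pow_left₀ (by positivity)
          have h5 : ‖u - 1‖ ^ 2 ≤ (1 / 2 ^ 7) ^ 2 := by gcongr
          nlinarith [sq_nonneg ‖u - 1‖]
        have h6 := hF u.arg
        have h7 := norm_le_norm_add_norm_sub' (P.eval u)
          (∑ k ∈ s, c k * Complex.exp (μ k * u.arg * Complex.I))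
        linarith
      have h4 := pow_le_one_sub_binomialWindow haN h0 h1
      have h5 := binomialWindow_nonneg N a h0 h1
      have h6 : 0 ≤ (‖u - 1‖ ^ 2 / 4) ^ a := by positivity
      nlinarith [norm_nonneg (P.eval u)]
    · have h2 : (1 : ℝ) / 2 ^ 16 ≤ ‖u - 1‖ ^ 2 / 4 := by
        have : (1 / 2 ^ 7) ^ 2 ≤ ‖u - 1‖ ^ 2 := by gcongr
        norm_num at this ⊢
        linarith
      have h3 : (1 - ‖u - 1‖ ^ 2 / 4 / 2) ^ N ≤ (1 - 1 / 2 ^ 17) ^ N := by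
        apply pow_le_pow_left₀
        · linarith
        · norm_num at h2 ⊢; linarith
      calc _ ≤ (2 ^ a * (1 - ‖u - 1‖ ^ 2 / 4 / 2) ^ N) * 2 ^ (16 * a) :=
            mul_le_mul (binomialWindow_le haN h0 h1) (hPbd u hu) (norm_nonneg _)
              (mul_nonneg (by positivity) (pow_nonneg (by linarith) _))
        _ ≤ (2 ^ a * (1 - 1 / 2 ^ 17) ^ N) * 2 ^ (16 * a) := by gcongr
        _ = 2 ^ (17 * a) * (1 - 1 / 2 ^ 17) ^ N := by
            rw [show 17 * a = a + 16 * a by ring, pow_add]; ring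
        _ ≤ 1 := hN
  · set u := Complex.exp (x * Complex.I) with hu
    have hu1 : ‖u‖ = 1 := by rw [hu, Complex.norm_exp_ofReal_mul_I]
    have hvx : ‖u - 1‖ ≤ |x| := norm_exp_mul_I_sub_one_le x
    have hpi := Real.pi_gt_three
    obtain ⟨hx1, hx2⟩ := abs_le.1 hx
    have h2 := hPF x ⟨by linarith, by linarith⟩ (hvx.trans hx)
    rw [← hu] at h2
    obtain ⟨h0, h1⟩ := ht01 u hu1
    have h3 := one_sub_binomialWindow_le haN h0 h1
    have h4 := binomialWindow_nonneg N a h0 h1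
    have h5 := pow_le_one_sub_binomialWindow haN h0 h1
    have h5' : 0 ≤ (‖u - 1‖ ^ 2 / 4) ^ a := by positivity
    have hun : u ^ N = Complex.exp (N * x * Complex.I) := by
      rw [hu, ← Complex.exp_nat_mul]; congr 1; ring
    have hF' := hF x
    rw [eval_mul, windowPoly_eval haN hu1, ← hun]
    set W := binomialWindow N a (‖u - 1‖ ^ 2 / 4)
    set F := ∑ k ∈ s, c k * Complex.exp (μ k * x * Complex.I)
    -- The error splits into the approximation error damped by the window and the defect 1 - W of
    -- the window.
    have h6 : u ^ N * (W : ℂ) * P.eval u - u ^ N * F =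
        u ^ N * ((W : ℂ) * (P.eval u - F) - ((1 - W : ℝ) : ℂ) * F) := by push_cast; ring
    rw [h6, norm_mul, norm_pow, hu1, one_pow, one_mul]
    refine (norm_sub_le _ _).trans ?_
    rw [norm_mul, norm_mul, Complex.norm_real, Complex.norm_real, Real.norm_eq_abs,
      Real.norm_eq_abs, abs_of_nonneg h4, abs_of_nonneg (by linarith)]
    refine add_le_add ?_ ?_
    · calc W * ‖P.eval u - F‖ ≤ 1 * ‖P.eval u - F‖ := by gcongr; linarith
        _ ≤ (8 * ‖u - 1‖) ^ T := by rw [one_mul]; exact h2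
        _ ≤ _ := by gcongr
    · calc (1 - W) * ‖F‖ ≤ (1 - W) * 1 := by gcongr; linarith
        _ ≤ 2 ^ N * (‖u - 1‖ ^ 2 / 4) ^ a := by rw [mul_one]; exact h3
        _ ≤ _ := by
          rw [hpow]
          gcongr
          linarith [norm_nonneg (u - 1)]

/-! ### Fourier coefficients and truncated Fourier series -/

theorem le_supNorm01 {f : ℝ → ℝ} (hf : Continuous f) {x : ℝ} (hx : x ∈ Set.Icc (0 : ℝ) 1) :
    |f x| ≤ supNorm01 f :=
  le_csSup ((isCompact_Icc.image hf.abs).bddAbove) ⟨x, hx, rfl⟩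

theorem supNorm01_nonneg (f : ℝ → ℝ) : 0 ≤ supNorm01 f :=
  Real.sSup_nonneg (by rintro _ ⟨x, _, rfl⟩; exact abs_nonneg _)

theorem le_supNorm01_of_periodic {f : ℝ → ℝ} (hf : Continuous f) (hp : Function.Periodic f 1)
    (x : ℝ) : |f x| ≤ supNorm01 f := by
  have h := hp.sub_int_mul_eq (x := x) ⌊x⌋
  rw [mul_one] at h
  rw [← h]
  exact le_supNorm01 hf ⟨by linarith [Int.floor_le x], by linarith [Int.lt_floor_add_one x]⟩

theorem Function.Periodic.iteratedDeriv_real {f : ℝ → ℝ} {c : ℝ} (h : Function.Periodic f c) (M : ℕ) :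
    Function.Periodic (iteratedDeriv M f) c := by
  induction M with
  | zero => simpa using h
  | succ M ih =>
    intro x
    rw [iteratedDeriv_succ, ← deriv_comp_add_const]
    congr 1
    funext y
    exact ih y

/-- The Fourier coefficients of a function of period one. -/
noncomputable def unitFourierCoeff (f : ℝ → ℝ) (k : ℤ) : ℂ :=
  ∫ x in (0 : ℝ)..1, Complex.exp (-(2 * Real.pi * k * x) * Complex.I) * f x

theorem norm_unitFourierCoeff_le {f : ℝ → ℝ} (hf : Continuous f) (k : ℤ) :
    ‖unitFourierCoeff f k‖ ≤ supNorm01 f := by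
  have h := intervalIntegral.norm_integral_le_of_norm_le_const (a := (0 : ℝ)) (b := 1)
    (f := fun x : ℝ => Complex.exp (-(2 * Real.pi * k * x) * Complex.I) * f x) (C := supNorm01 f) (by
      intro x hx
      rw [Set.uIoc_of_le zero_le_one] at hx
      have : (-(2 * Real.pi * k * x) * Complex.I : ℂ) = ((-(2 * Real.pi * k * x) : ℝ) : ℂ) * Complex.I := by
        push_cast; rfl
      rw [norm_mul, this, Complex.norm_exp_ofReal_mul_I, one_mul, Complex.norm_real]
      exact le_supNorm01 hf ⟨hx.1.le, hx.2⟩)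
  simpa [unitFourierCoeff] using h

/-- Integration by parts; the boundary terms cancel because f and the exponential take equal values
at 0 and 1. -/
theorem unitFourierCoeff_deriv {f f' : ℝ → ℝ} (hf : ∀ x, HasDerivAt f (f' x) x)
    (hf' : Continuous f') (h01 : f 1 = f 0) (k : ℤ) :
    2 * Real.pi * k * Complex.I * unitFourierCoeff f k = unitFourierCoeff f' k := by
  have hv : ∀ x : ℝ, HasDerivAt (fun x : ℝ => Complex.exp (-(2 * Real.pi * k * x) * Complex.I))
      (-(2 * Real.pi * k) * Complex.I * Complex.exp (-(2 * Real.pi * k * x) * Complex.I)) x := by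
    intro x
    have h1 : HasDerivAt (fun x : ℝ => -(2 * Real.pi * k * x : ℂ) * Complex.I)
        (-(2 * Real.pi * k * 1 : ℂ) * Complex.I) x :=
      ((((Complex.ofRealCLM.hasDerivAt (x := x)).const_mul (2 * Real.pi * k : ℂ)).neg).mul_const Complex.I)
    have h2 := h1.cexp
    convert h2 using 1
    ring
  have hu : ∀ x : ℝ, HasDerivAt (fun x : ℝ => (f x : ℂ)) (f' x : ℂ) x := fun x => (hf x).ofReal_comp
  have hcv : Continuous (fun x : ℝ => Complex.exp (-(2 * Real.pi * k * x) * Complex.I)) := by fun_prop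
  have h := intervalIntegral.integral_mul_deriv_eq_deriv_mul (a := (0 : ℝ)) (b := 1)
    (fun x _ => hu x) (fun x _ => hv x)
    (by exact (Complex.continuous_ofReal.comp hf').intervalIntegrable _ _)
    (by exact (continuous_const.mul hcv).intervalIntegrable _ _)
  have he : Complex.exp (-(2 * Real.pi * k * (1 : ℝ)) * Complex.I) = 1 := by
    rw [Complex.exp_eq_one_iff]; exact ⟨-k, by push_cast; ring⟩
  have he0 : Complex.exp (-(2 * Real.pi * k * (0 : ℝ)) * Complex.I) = 1 := by simp
  rw [he, he0, h01, sub_self, zero_sub] at h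
  have h3 : (∫ x in (0 : ℝ)..1, (f x : ℂ) * (-(2 * Real.pi * k) * Complex.I *
      Complex.exp (-(2 * Real.pi * k * x) * Complex.I))) =
      -(2 * Real.pi * k) * Complex.I * unitFourierCoeff f k := by
    rw [unitFourierCoeff, ← intervalIntegral.integral_const_mul]
    congr 1; funext x; ring
  have h4 : (∫ x in (0 : ℝ)..1, (f' x : ℂ) * Complex.exp (-(2 * Real.pi * k * x) * Complex.I)) =
      unitFourierCoeff f' k := by
    rw [unitFourierCoeff]
    congr 1; funext x; ring
  rw [h3, h4] at h
  linear_combination -h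

theorem unitFourierCoeff_iteratedDeriv {g : ℝ → ℝ} (hg : ContDiff ℝ ⊤ g)
    (hp : Function.Periodic g 1) (k : ℤ) (M : ℕ) :
    (2 * Real.pi * k * Complex.I) ^ M * unitFourierCoeff g k =
      unitFourierCoeff (iteratedDeriv M g) k := by
  induction M with
  | zero => simp
  | succ M ih =>
    rw [pow_succ', mul_assoc, ih]
    refine unitFourierCoeff_deriv (fun x => ?_) (hg.continuous_iteratedDeriv _ (by exact_mod_cast le_top)) ?_ k
    · rw [iteratedDeriv_succ]
      exact ((hg.differentiable_iteratedDeriv M (by exact_mod_cast WithTop.coe_lt_top _)) x).hasDerivAt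
    · have := hp.iteratedDeriv_real M 0
      rwa [zero_add] at this

theorem hasSum_unitFourier {g : ℝ → ℝ} (hg : Continuous g) (hp : Function.Periodic g 1)
    (hs : Summable (unitFourierCoeff g)) (x : ℝ) :
    HasSum (fun k : ℤ => unitFourierCoeff g k * Complex.exp (2 * Real.pi * k * x * Complex.I)) (g x) := by
  have hpc : Function.Periodic (fun x => (g x : ℂ)) 1 := fun x => by simp [hp x]
  have hcont : Continuous (hpc.lift : AddCircle (1 : ℝ) → ℂ) :=
    continuous_coinduced_dom.2 (Complex.continuous_ofReal.comp hg)
  let f : C(AddCircle (1 : ℝ), ℂ) := ⟨hpc.lift, hcont⟩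
  have hfx : ∀ x : ℝ, f (x : AddCircle (1 : ℝ)) = g x := fun x => hpc.lift_coe x
  have hcoef : fourierCoeff f = unitFourierCoeff g := by
    funext k
    rw [fourierCoeff_eq_intervalIntegral f k 0, unitFourierCoeff]
    simp only [hfx, fourier_coe_apply, smul_eq_mul, zero_add, div_one, one_smul]
    congr 1
    funext y
    congr 2
    push_cast
    ring
  have h := has_pointwise_sum_fourier_series_of_summable (f := f) (by rw [hcoef]; exact hs)
    (x : AddCircle (1 : ℝ))
  rw [hfx, hcoef] at h
  convert h using 2 with k
  rw [fourier_coe_apply, smul_eq_mul]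
  congr 2
  push_cast
  ring

theorem hasSum_third_pow_natAbs : HasSum (fun k : ℤ => (1 / 3 : ℝ) ^ k.natAbs) 2 := by
  have h := hasSum_geometric_of_lt_one (r := (1 / 3 : ℝ)) (by norm_num) (by norm_num)
  have h2 := h.mul_right (1 / 3)
  have := HasSum.of_nat_of_neg_add_one (f := fun k : ℤ => (1 / 3 : ℝ) ^ k.natAbs)
    (by simpa using h) (m' := (1 - 1 / 3)⁻¹ * (1 / 3)) (by
      refine h2.congr_fun ?_
      intro n
      rw [← pow_succ, show (-((n : ℤ) + 1)).natAbs = n + 1 by omega])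
  norm_num at this ⊢
  exact this

/-- Truncated Fourier series of a periodic function with factorially bounded derivatives. -/
theorem exists_trig_approx {C R : ℝ} (hC : 0 < C) (hR : 1 < R) {g : ℝ → ℝ}
    (hp : Function.Periodic g 1) (hg : ContDiff ℝ ⊤ g)
    (hb : ∀ M : ℕ, supNorm01 (iteratedDeriv M g) ≤ C * (M ! : ℝ) / R ^ M) (d : ℕ) :
    ∃ c : ℤ → ℂ, (∀ k, ‖c k‖ ≤ supNorm01 g) ∧ ∀ x : ℝ,
      ‖(g x : ℂ) - ∑ k ∈ Finset.Icc (-(d : ℤ)) d,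
        c k * Complex.exp (2 * Real.pi * k * x * Complex.I)‖ ≤ C / 2 ^ d := by
  have hbound : ∀ k : ℤ, ‖unitFourierCoeff g k‖ ≤ C * (1 / 6) ^ k.natAbs := by
    intro k
    have h1 := congrArg norm (unitFourierCoeff_iteratedDeriv hg hp k k.natAbs)
    have h2 := (norm_unitFourierCoeff_le
      (hg.continuous_iteratedDeriv k.natAbs (by exact_mod_cast le_top)) k).trans (hb k.natAbs)
    rw [← h1, norm_mul, norm_pow] at h2
    rcases Nat.eq_zero_or_pos k.natAbs with h0 | hpos
    · rw [h0] at h2 ⊢; simpa using h2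
    set M := k.natAbs with hM
    have h3 : ‖(2 * Real.pi * k * Complex.I : ℂ)‖ = 2 * Real.pi * M := by
      rw [norm_mul, norm_mul, norm_mul, Complex.norm_I, Complex.norm_real, Complex.norm_intCast,
        Real.norm_eq_abs, abs_of_pos Real.pi_pos, Complex.norm_ofNat, hM, mul_one, Nat.cast_natAbs]
      push_cast; rfl
    rw [h3] at h2
    have hMp : (0 : ℝ) < M := by exact_mod_cast hpos
    have h4 : (6 * (M : ℝ)) ^ M ≤ (2 * Real.pi * M) ^ M := by
      gcongr; linarith [Real.pi_gt_three]
    have h5 : C * (M ! : ℝ) / R ^ M ≤ C * (M : ℝ) ^ M := by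
      have h6 : (M ! : ℝ) ≤ (M : ℝ) ^ M := by exact_mod_cast Nat.factorial_le_pow M
      rw [div_le_iff₀ (by positivity)]
      calc C * (M ! : ℝ) ≤ C * (M : ℝ) ^ M * 1 := by rw [mul_one]; gcongr
        _ ≤ _ := by gcongr; exact one_le_pow₀ hR.le
    -- The derivative of order exactly M = |k| is used: M! ≤ M^M cancels against (2πM)^M, leaving
    -- (2π)^(-M) ≤ 6^(-M).
    have h7 : (6 * (M : ℝ)) ^ M * ‖unitFourierCoeff g k‖ ≤ C * (M : ℝ) ^ M :=
      (mul_le_mul_of_nonneg_right h4 (norm_nonneg _)).trans (h2.trans h5)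
    rw [mul_pow] at h7
    have h8 : (0 : ℝ) < (M : ℝ) ^ M := by positivity
    rw [one_div, inv_pow, ← div_eq_mul_inv, le_div_iff₀ (by positivity)]
    refine le_of_mul_le_mul_right ?_ h8
    linarith
  have hsum : Summable (unitFourierCoeff g) := by
    refine Summable.of_norm_bounded (hasSum_third_pow_natAbs.summable.mul_left C) fun k => ?_
    refine (hbound k).trans ?_
    gcongr; norm_num
  refine ⟨unitFourierCoeff g, norm_unitFourierCoeff_le hg.continuous, fun x => ?_⟩
  have h1 := hasSum_unitFourier hg.continuous hp hsum x
  set s := Finset.Icc (-(d : ℤ)) d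
  set f : ℤ → ℂ := fun k => unitFourierCoeff g k * Complex.exp (2 * Real.pi * k * x * Complex.I)
  have h2 : HasSum (fun k => if k ∈ s then f k else 0) (∑ k ∈ s, f k) := by
    have h0 : ∑ k ∈ s, f k = ∑ k ∈ s, if k ∈ s then f k else 0 :=
      Finset.sum_congr rfl fun k hk => (if_pos hk).symm
    rw [h0]
    exact hasSum_sum_of_ne_finset_zero fun b hb => if_neg hb
  have h3 := h1.sub h2
  rw [← h3.tsum_eq]
  -- The decay 6^(-|k|) is split as 2^(-|k|)·3^(-|k|): the first factor gives the precision for |k|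
  -- ≥ d + 1, the second sums to 2.
  have h4 := (hasSum_third_pow_natAbs.mul_left (C / 2 ^ (d + 1)))
  have h5 : C / 2 ^ (d + 1) * 2 = C / 2 ^ d := by rw [pow_succ]; field_simp
  rw [← h5]
  refine tsum_of_norm_bounded h4 fun k => ?_
  split_ifs with hk
  · rw [sub_self, norm_zero]; positivity
  · rw [sub_zero, norm_mul]
    have h6 : (2 * Real.pi * k * x * Complex.I : ℂ) = ((2 * Real.pi * k * x : ℝ) : ℂ) * Complex.I := by
      push_cast; rfl
    rw [h6, Complex.norm_exp_ofReal_mul_I, mul_one]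
    refine (hbound k).trans ?_
    have hk' : d + 1 ≤ k.natAbs := by
      simp only [s, Finset.mem_Icc, not_and_or, not_le] at hk
      omega
    calc C * (1 / 6) ^ k.natAbs = C * (1 / 2) ^ k.natAbs * (1 / 3) ^ k.natAbs := by
          rw [mul_assoc, ← mul_pow]; norm_num
      _ ≤ C * (1 / 2) ^ (d + 1) * (1 / 3) ^ k.natAbs := by
          gcongr ?_ * ?_ * ?_
          exact pow_le_pow_of_le_one (by norm_num) (by norm_num) hk'
      _ = _ := by rw [one_div_pow]; ring

theorem abs_sub_le_of_deriv_bound {C R : ℝ} (hC : 0 < C) (hR : 1 < R) {g : ℝ → ℝ}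
    (hp : Function.Periodic g 1) (hg : ContDiff ℝ ⊤ g)
    (hb : ∀ M : ℕ, supNorm01 (iteratedDeriv M g) ≤ C * (M ! : ℝ) / R ^ M) (x y : ℝ) :
    |g x - g y| ≤ C * |x - y| := by
  have h1 := hb 1
  have h2 : C * ((1 ! : ℕ) : ℝ) / R ^ 1 ≤ C := by
    rw [Nat.factorial_one, Nat.cast_one, mul_one, pow_one]
    exact div_le_self hC.le hR.le
  refine Convex.norm_image_sub_le_of_norm_deriv_le (s := Set.univ) (f := g) (C := C)
    (fun z _ => (hg.differentiable (by simp)) z) (fun z _ => ?_) convex_univ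
    (Set.mem_univ y) (Set.mem_univ x)
  have h3 := le_supNorm01_of_periodic (hg.continuous_iteratedDeriv 1 (by exact_mod_cast le_top))
    (hp.iteratedDeriv_real 1) z
  rw [iteratedDeriv_one] at h3 h1
  rw [Real.norm_eq_abs]
  linarith

/-! ### Unitarity and action of the elementary gates -/

section Gates

variable {Q : Type} [Fintype Q] [DecidableEq Q]

/-- An assignment that agrees with x off the wires is determined by its values on them. This reduces
products of lifted gates to products of small matrices. -/
theorem sum_ite_agree (x : Q → Fin 2) {k : ℕ} (wires : Fin k ↪ Q) (F : (Fin k → Fin 2) → ℂ) :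
    (∑ z : Q → Fin 2, if ∀ q, (∀ i, wires i ≠ q) → x q = z q then F (fun i => z (wires i)) else 0) =
      ∑ v, F v := by
  classical
  rw [← Finset.sum_filter]
  refine Finset.sum_nbij' (fun z i => z (wires i)) (fun v => Function.extend wires v x) ?_ ?_ ?_ ?_ ?_
  · simp
  · intro v _
    simp only [Finset.mem_filter, Finset.mem_univ, true_and]
    intro q hq
    rw [Function.extend_apply' _ _ _ (by rintro ⟨i, hi⟩; exact hq i hi)]
  · intro z hz
    simp only [Finset.mem_filter, Finset.mem_univ, true_and] at hz
    funext q
    by_cases h : ∃ i, wires i = q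
    · obtain ⟨i, rfl⟩ := h
      rw [wires.injective.extend_apply]
    · rw [Function.extend_apply' _ _ _ h]
      exact hz q fun i hi => h ⟨i, hi⟩
  · intro v _
    funext i
    exact wires.injective.extend_apply _ _ _
  · intro z _
    rfl

/-- The gate with the given wires and matrix. -/
def mkGate {k : ℕ} (h1 : 1 ≤ k) (h2 : k ≤ 2) (wires : Fin k ↪ Q)
    (U : Matrix.unitaryGroup (Fin k → Fin 2) ℂ) : Gate Q := ⟨k, h1, h2, wires, U⟩

theorem mkGate_toOp_of_agree {k : ℕ} (h1 : 1 ≤ k) (h2 : k ≤ 2) (wires : Fin k ↪ Q)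
    (U : Matrix.unitaryGroup (Fin k → Fin 2) ℂ) {x y : Q → Fin 2}
    (h : ∀ q, (∀ i, wires i ≠ q) → x q = y q) :
    (mkGate h1 h2 wires U).toOp x y =
      (U : Matrix _ _ ℂ) (fun i => x (wires i)) (fun i => y (wires i)) :=
  if_pos h

theorem mkGate_toOp_of_not_agree {k : ℕ} (h1 : 1 ≤ k) (h2 : k ≤ 2) (wires : Fin k ↪ Q)
    (U : Matrix.unitaryGroup (Fin k → Fin 2) ℂ) {x y : Q → Fin 2}
    (h : ¬ ∀ q, (∀ i, wires i ≠ q) → x q = y q) :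
    (mkGate h1 h2 wires U).toOp x y = 0 :=
  if_neg h

theorem Gate.toOp_mem_unitaryGroup (G : Gate Q) :
    G.toOp ∈ Matrix.unitaryGroup (Q → Fin 2) ℂ := by
  rw [Matrix.mem_unitaryGroup_iff]
  ext x y
  rw [Matrix.mul_apply]
  have hM := Matrix.mem_unitaryGroup_iff.1 G.mat.2
  by_cases hxy : ∀ q, (∀ i, G.wires i ≠ q) → x q = y q
  · have h1 : ∀ z, G.toOp x z * (star G.toOp) z y =
        if ∀ q, (∀ i, G.wires i ≠ q) → x q = z q then
          (fun v => (G.mat : Matrix _ _ ℂ) (fun i => x (G.wires i)) v *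
            star ((G.mat : Matrix _ _ ℂ) (fun i => y (G.wires i)) v)) (fun i => z (G.wires i))
        else 0 := by
      intro z
      rw [Matrix.star_apply]
      simp only [Gate.toOp, Matrix.of_apply]
      by_cases hz : ∀ q, (∀ i, G.wires i ≠ q) → x q = z q
      · rw [if_pos hz, if_pos hz, if_pos (fun q hq => (hxy q hq).symm.trans (hz q hq))]
      · rw [if_neg hz, if_neg hz, zero_mul]
    rw [Finset.sum_congr rfl fun z _ => h1 z]
    refine (sum_ite_agree x G.wires (fun v => (G.mat : Matrix _ _ ℂ) (fun i => x (G.wires i)) v *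
      star ((G.mat : Matrix _ _ ℂ) (fun i => y (G.wires i)) v))).trans ?_
    have h2 := congrFun (congrFun hM (fun i => x (G.wires i))) (fun i => y (G.wires i))
    rw [Matrix.mul_apply] at h2
    simp only [Matrix.star_apply] at h2
    rw [h2, Matrix.one_apply, Matrix.one_apply]
    refine if_congr ⟨fun h => ?_, fun h => by rw [h]⟩ rfl rfl
    funext q
    by_cases hq : ∃ i, G.wires i = q
    · obtain ⟨i, rfl⟩ := hq
      exact congrFun h i
    · exact hxy q fun i hi => hq ⟨i, hi⟩
  · rw [Matrix.one_apply_ne (by rintro rfl; exact hxy fun _ _ => rfl)]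
    refine Finset.sum_eq_zero fun z _ => ?_
    rw [Matrix.star_apply]
    simp only [Gate.toOp, Matrix.of_apply]
    by_cases hz : ∀ q, (∀ i, G.wires i ≠ q) → x q = z q
    · rw [if_neg (c := ∀ q, (∀ i, G.wires i ≠ q) → y q = z q)
        (fun h => hxy fun q hq => (hz q hq).trans (h q hq).symm), star_zero, mul_zero]
    · rw [if_neg hz, zero_mul]

theorem QCircuit.toOp_mem_unitaryGroup (c : QCircuit Q) :
    c.toOp ∈ Matrix.unitaryGroup (Q → Fin 2) ℂ := by
  refine Submonoid.list_prod_mem _ fun U hU => ?_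
  rw [List.mem_reverse, List.mem_map] at hU
  obtain ⟨L, -, rfl⟩ := hU
  refine Submonoid.list_prod_mem _ fun V hV => ?_
  rw [List.mem_map] at hV
  obtain ⟨G, -, rfl⟩ := hV
  exact G.toOp_mem_unitaryGroup

/-- Computational basis vectors. -/
def ket (w : Q → Fin 2) : (Q → Fin 2) → ℂ := Pi.single w 1

theorem mulVec_ket (U : QOp Q) (w : Q → Fin 2) : U.mulVec (ket w) = fun x => U x w := by
  rw [ket, Matrix.mulVec_single_one]; rfl

omit [DecidableEq Q] in
theorem ket_apply (w x : Q → Fin 2) : ket w x = if x = w then 1 else 0 := by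
  rw [ket, Pi.single_apply]

/-- The sign `(-1) ^ b` of a bit. -/
def sgn (b : Fin 2) : ℝ := (-1) ^ (b : ℕ)

@[simp] theorem sgn_zero : sgn 0 = 1 := by simp [sgn]

@[simp] theorem sgn_one : sgn 1 = -1 := by simp [sgn]

theorem sgn_add (a b : Fin 2) : sgn (a + b) = sgn a * sgn b := by
  fin_cases a <;> fin_cases b <;> simp [sgn]

theorem sgn_mul_self (a : Fin 2) : sgn a * sgn a = 1 := by
  fin_cases a <;> simp

theorem sgn_sum {ι : Type*} (s : Finset ι) (f : ι → Fin 2) :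
    sgn (∑ i ∈ s, f i) = ∏ i ∈ s, sgn (f i) := by
  classical
  induction s using Finset.induction_on with
  | empty => simp
  | insert a s ha ih => rw [Finset.sum_insert ha, Finset.prod_insert ha, sgn_add, ih]

theorem add_self_bit (a : Fin 2) : a + a = 0 := by
  fin_cases a <;> rfl

theorem diagonal_exp_mem_unitaryGroup {ι : Type*} [Fintype ι] [DecidableEq ι] (f : ι → ℝ) :
    Matrix.diagonal (fun v => Complex.exp (f v * Complex.I)) ∈ Matrix.unitaryGroup ι ℂ := by
  rw [Matrix.mem_unitaryGroup_iff, Matrix.star_eq_conjTranspose, Matrix.diagonal_conjTranspose,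
    Matrix.diagonal_mul_diagonal, ← Matrix.diagonal_one]
  congr 1
  funext v
  rw [Pi.star_apply, ← starRingEnd_apply, ← Complex.exp_conj, ← Complex.exp_add]
  simp

/-- A diagonal gate with the phases `f`. -/
noncomputable def diagGate {k : ℕ} (h1 : 1 ≤ k) (h2 : k ≤ 2) (wires : Fin k ↪ Q)
    (f : (Fin k → Fin 2) → ℝ) : Gate Q :=
  mkGate h1 h2 wires ⟨_, diagonal_exp_mem_unitaryGroup f⟩

theorem diagGate_mulVec {k : ℕ} (h1 : 1 ≤ k) (h2 : k ≤ 2) (wires : Fin k ↪ Q)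
    (f : (Fin k → Fin 2) → ℝ) (w : Q → Fin 2) :
    (diagGate h1 h2 wires f).toOp.mulVec (ket w) =
      Complex.exp (f (fun i => w (wires i)) * Complex.I) • ket w := by
  rw [mulVec_ket]
  funext x
  rw [Pi.smul_apply, ket_apply, diagGate]
  by_cases hx : x = w
  · subst hx
    rw [mkGate_toOp_of_agree _ _ _ _ fun _ _ => rfl]
    simp
  · rw [if_neg hx, smul_zero]
    by_cases h : ∀ q, (∀ i, wires i ≠ q) → x q = w q
    · rw [mkGate_toOp_of_agree _ _ _ _ h]
      refine Matrix.diagonal_apply_ne _ fun h' => hx ?_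
      funext q
      by_cases hq : ∃ i, wires i = q
      · obtain ⟨i, rfl⟩ := hq
        exact congrFun h' i
      · exact h q fun i hi => hq ⟨i, hi⟩
    · exact mkGate_toOp_of_not_agree _ _ _ _ h

/-- The one-wire embedding. -/
def wire1 (a : Q) : Fin 1 ↪ Q := ⟨fun _ => a, fun _ _ _ => Subsingleton.elim _ _⟩

/-- The two-wire embedding. -/
def wire2 {a b : Q} (h : a ≠ b) : Fin 2 ↪ Q := ⟨![a, b], by
  intro i j hij
  fin_cases i <;> fin_cases j <;> simp_all [eq_comm]⟩

omit [Fintype Q] [DecidableEq Q] in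
theorem wire2_zero {a b : Q} (h : a ≠ b) : wire2 h 0 = a := rfl

omit [Fintype Q] [DecidableEq Q] in
theorem wire2_one {a b : Q} (h : a ≠ b) : wire2 h 1 = b := rfl

/-- The gate `exp (i θ Z)`. -/
noncomputable def phaseGate (a : Q) (θ : ℝ) : Gate Q :=
  diagGate le_rfl one_le_two (wire1 a) fun v => θ * sgn (v 0)

theorem phaseGate_mulVec (a : Q) (θ : ℝ) (w : Q → Fin 2) :
    (phaseGate a θ).toOp.mulVec (ket w) =
      Complex.exp ((θ * sgn (w a) : ℝ) * Complex.I) • ket w :=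
  diagGate_mulVec _ _ _ _ _

/-- The gate `exp (i θ Z ⊗ Z)`. -/
noncomputable def zzGate {a b : Q} (h : a ≠ b) (θ : ℝ) : Gate Q :=
  diagGate one_le_two le_rfl (wire2 h) fun v => θ * (sgn (v 0) * sgn (v 1))

theorem zzGate_mulVec {a b : Q} (h : a ≠ b) (θ : ℝ) (w : Q → Fin 2) :
    (zzGate h θ).toOp.mulVec (ket w) =
      Complex.exp ((θ * (sgn (w a) * sgn (w b)) : ℝ) * Complex.I) • ket w :=
  diagGate_mulVec _ _ _ _ _

/-- The permutation `(c, t) ↦ (c, t + c)`. -/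
def cnotFun (v : Fin 2 → Fin 2) : Fin 2 → Fin 2 := ![v 0, v 1 + v 0]

theorem cnot_mem_unitaryGroup :
    (Matrix.of fun v v' : Fin 2 → Fin 2 => if v = cnotFun v' then (1 : ℂ) else 0) ∈
      Matrix.unitaryGroup (Fin 2 → Fin 2) ℂ := by
  have hinv : ∀ v, cnotFun (cnotFun v) = v := by decide
  have hiff : ∀ v z, v = cnotFun z ↔ z = cnotFun v := fun v z =>
    ⟨fun h => by rw [h, hinv], fun h => by rw [h, hinv]⟩
  rw [Matrix.mem_unitaryGroup_iff]
  ext v v'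
  rw [Matrix.mul_apply]
  simp only [Matrix.star_apply, Matrix.of_apply]
  have h1 : ∀ z, (if v = cnotFun z then (1 : ℂ) else 0) * star (if v' = cnotFun z then (1 : ℂ) else 0) =
      if z = cnotFun v then star (if v' = cnotFun z then (1 : ℂ) else 0) else 0 := by
    intro z
    rw [if_congr (hiff v z) rfl rfl, ite_mul, one_mul, zero_mul]
  rw [Finset.sum_congr rfl fun z _ => h1 z, Finset.sum_ite_eq' Finset.univ,
    if_pos (Finset.mem_univ _), hinv, Matrix.one_apply, apply_ite star, star_one, star_zero]
  exact if_congr eq_comm rfl rfl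

/-- The CNOT gate with control `a` and target `b`. -/
noncomputable def cnotGate {a b : Q} (h : a ≠ b) : Gate Q :=
  mkGate one_le_two le_rfl (wire2 h) ⟨_, cnot_mem_unitaryGroup⟩

theorem cnotGate_mulVec {a b : Q} (h : a ≠ b) (w : Q → Fin 2) :
    (cnotGate h).toOp.mulVec (ket w) = ket (Function.update w b (w b + w a)) := by
  rw [mulVec_ket]
  funext x
  rw [ket_apply, cnotGate]
  have h1 : (mkGate one_le_two le_rfl (wire2 h) ⟨_, cnot_mem_unitaryGroup⟩).toOp x w =
      if (∀ q, (∀ i, wire2 h i ≠ q) → x q = w q) ∧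
        (fun i => x (wire2 h i)) = cnotFun (fun i => w (wire2 h i)) then 1 else 0 := by
    by_cases hx : ∀ q, (∀ i, wire2 h i ≠ q) → x q = w q
    · rw [mkGate_toOp_of_agree _ _ _ _ hx]
      exact if_congr ⟨fun h' => ⟨hx, h'⟩, fun h' => h'.2⟩ rfl rfl
    · rw [mkGate_toOp_of_not_agree _ _ _ _ hx, if_neg fun h' => hx h'.1]
  rw [h1]
  refine if_congr ⟨fun hx => ?_, fun hx => ?_⟩ rfl rfl
  · funext q
    by_cases hb : q = b
    · subst hb
      have := congrFun hx.2 1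
      simpa [wire2_zero, wire2_one, cnotFun] using this
    · rw [Function.update_of_ne hb]
      by_cases ha : q = a
      · subst ha
        have := congrFun hx.2 0
        simpa [wire2_zero, wire2_one, cnotFun] using this
      · refine hx.1 q fun i => ?_
        fin_cases i
        · exact fun h => ha h.symm
        · exact fun h => hb h.symm
  · subst hx
    refine ⟨fun q hq => ?_, ?_⟩
    · rw [Function.update_of_ne]
      rintro rfl
      exact hq 1 rfl
    · funext i
      fin_cases i
      · simp [wire2_zero, cnotFun, h]
      · simp [wire2_zero, wire2_one, cnotFun]

theorem hadamard_mem_unitaryGroup :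
    (Matrix.of fun v v' : Fin 1 → Fin 2 => hadamard (v 0) (v' 0)) ∈
      Matrix.unitaryGroup (Fin 1 → Fin 2) ℂ := by
  have h2 : (((Real.sqrt 2)⁻¹ : ℝ) : ℂ) * (((Real.sqrt 2)⁻¹ : ℝ) : ℂ) = 1 / 2 := by
    rw [← Complex.ofReal_mul, ← mul_inv, Real.mul_self_sqrt (by norm_num)]; norm_num
  have hH : hadamard * star hadamard = 1 := by
    rw [hadamard]
    generalize ((Real.sqrt 2)⁻¹ : ℝ) = r at *
    ext i j
    fin_cases i <;> fin_cases j <;>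
      simp [Matrix.mul_apply, Fin.sum_univ_two, Matrix.star_apply, h2] <;> norm_num
  rw [Matrix.mem_unitaryGroup_iff]
  ext v v'
  rw [Matrix.mul_apply]
  have h := congrFun (congrFun hH (v 0)) (v' 0)
  rw [Matrix.mul_apply] at h
  rw [← (Equiv.funUnique (Fin 1) (Fin 2)).symm.sum_comp]
  simp only [Matrix.star_apply, Matrix.of_apply] at h ⊢
  refine Eq.trans ?_ (h.trans ?_)
  · rfl
  · rw [Matrix.one_apply, Matrix.one_apply]
    refine if_congr ⟨fun h => ?_, fun h => by rw [h]⟩ rfl rfl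
    funext i
    rw [Subsingleton.elim i 0]; exact h

/-- The Hadamard gate. -/
noncomputable def hadamardGate (a : Q) : Gate Q :=
  mkGate le_rfl one_le_two (wire1 a) ⟨_, hadamard_mem_unitaryGroup⟩

theorem hadamardGate_mulVec (a : Q) (w : Q → Fin 2) :
    (hadamardGate a).toOp.mulVec (ket w) =
      ∑ b, hadamard b (w a) • ket (Function.update w a b) := by
  rw [mulVec_ket]
  funext x
  rw [Finset.sum_apply]
  simp only [Pi.smul_apply, ket_apply]
  rw [hadamardGate]
  by_cases hx : ∀ q, (∀ i, wire1 a i ≠ q) → x q = w q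
  · rw [mkGate_toOp_of_agree _ _ _ _ hx]
    have : ∀ b, (x = Function.update w a b) ↔ b = x a := by
      intro b
      constructor
      · rintro rfl; simp
      · rintro rfl
        funext q
        by_cases hq : q = a
        · subst hq; simp
        · rw [Function.update_of_ne hq]
          exact hx q fun i h => hq h.symm
    simp only [this, smul_eq_mul, mul_ite, mul_one, mul_zero, Finset.sum_ite_eq', Finset.mem_univ,
      if_true]
    rfl
  · rw [mkGate_toOp_of_not_agree _ _ _ _ hx]
    refine (Finset.sum_eq_zero fun b _ => ?_).symm
    rw [if_neg, smul_zero]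
    rintro rfl
    exact hx fun q hq => Function.update_of_ne (fun h => hq 0 h.symm) _ _

end Gates

/-! ### Layers of gates, fan-out and linear phases -/

section Circuits

variable {Q : Type}

/-- The total number of gates of a list of layers. -/
def gateCount (L : List (Layer Q)) : ℕ := (L.map fun l => l.gates.length).sum

theorem gateCount_append (L L' : List (Layer Q)) :
    gateCount (L ++ L') = gateCount L + gateCount L' := by
  simp [gateCount]

/-- A layer with one gate. -/
def Layer.single (G : Gate Q) : Layer Q := ⟨[G], List.pairwise_singleton _ _⟩

variable [Fintype Q] [DecidableEq Q]

/-- The operator of a list of layers. -/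
def layersOp (L : List (Layer Q)) : QOp Q := (QCircuit.mk L).toOp

theorem layersOp_nil : layersOp ([] : List (Layer Q)) = 1 := rfl

theorem layersOp_append (L L' : List (Layer Q)) :
    layersOp (L ++ L') = layersOp L' * layersOp L := by
  simp [layersOp, QCircuit.toOp, List.prod_append]

theorem layersOp_singleton (l : Layer Q) : layersOp [l] = l.toOp := by
  simp [layersOp, QCircuit.toOp]

theorem Layer.single_toOp (G : Gate Q) : (Layer.single G).toOp = G.toOp := by
  simp [Layer.single, Layer.toOp]

theorem layersOp_append_mulVec (L L' : List (Layer Q)) (v : (Q → Fin 2) → ℂ) :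
    (layersOp (L ++ L')).mulVec v = (layersOp L').mulVec ((layersOp L).mulVec v) := by
  rw [layersOp_append, Matrix.mulVec_mulVec]

/-- No control is a target, so the controls keep their initial values and the contributions to each
target simply add modulo 2. -/
theorem cnots_mulVec (l : List {p : Q × Q // p.1 ≠ p.2})
    (h : ∀ p ∈ l, ∀ q ∈ l, p.1.1 ≠ q.1.2) (w : Q → Fin 2) :
    (l.map fun p => (cnotGate p.2).toOp).prod.mulVec (ket w) =
      ket (fun q => w q + (l.map fun p => if p.1.2 = q then w p.1.1 else 0).sum) := by
  induction l with
  | nil => simp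
  | cons p l ih =>
    rw [List.map_cons, List.prod_cons, ← Matrix.mulVec_mulVec,
      ih fun a ha b hb => h a (List.mem_cons_of_mem _ ha) b (List.mem_cons_of_mem _ hb),
      cnotGate_mulVec]
    congr 1
    have hc : (l.map fun p' => if p'.1.2 = p.1.1 then w p'.1.1 else 0).sum = 0 := by
      apply List.sum_eq_zero
      intro x hx
      rw [List.mem_map] at hx
      obtain ⟨p', hp', rfl⟩ := hx
      exact if_neg (h p List.mem_cons_self p' (List.mem_cons_of_mem _ hp')).symm
    funext q
    rw [List.map_cons, List.sum_cons]
    by_cases hq : q = p.1.2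
    · subst hq
      rw [Function.update_self, if_pos rfl, hc, add_zero, add_right_comm, ← add_assoc]
    · rw [Function.update_of_ne hq, if_neg (Ne.symm hq), zero_add]

/-- The circuit applying CNOT gates one after the other. -/
noncomputable def cnotSeq (l : List {p : Q × Q // p.1 ≠ p.2}) : List (Layer Q) :=
  l.map fun p => Layer.single (cnotGate p.2)

omit [Fintype Q] [DecidableEq Q] in
theorem cnotSeq_length (l : List {p : Q × Q // p.1 ≠ p.2}) : (cnotSeq l).length = l.length := by
  simp [cnotSeq]

omit [Fintype Q] [DecidableEq Q] in
theorem gateCount_cnotSeq (l : List {p : Q × Q // p.1 ≠ p.2}) :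
    gateCount (cnotSeq l) = l.length := by
  simp [cnotSeq, gateCount, Layer.single, Function.comp_def]

theorem cnotSeq_mulVec (l : List {p : Q × Q // p.1 ≠ p.2})
    (h : ∀ p ∈ l, ∀ q ∈ l, p.1.1 ≠ q.1.2) (w : Q → Fin 2) :
    (layersOp (cnotSeq l)).mulVec (ket w) =
      ket (fun q => w q + (l.map fun p => if p.1.2 = q then w p.1.1 else 0).sum) := by
  have h1 : layersOp (cnotSeq l) = (l.reverse.map fun p => (cnotGate p.2).toOp).prod := by
    rw [layersOp, QCircuit.toOp, List.map_reverse]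
    congr 2
    simp only [cnotSeq, List.map_map]
    exact List.map_congr_left fun p _ => Layer.single_toOp _
  rw [h1, cnots_mulVec _ (by simpa using h)]
  simp only [List.map_reverse, List.sum_reverse]

omit [Fintype Q] [DecidableEq Q] in
theorem pairwise_disjoint_ofFn {m : ℕ} (a b : Fin m → Q) (ha : Function.Injective a)
    (hb : Function.Injective b) (hab : ∀ i j, a i ≠ b j) (G : Fin m → Gate Q)
    (hG : ∀ i k, (G i).wires k = a i ∨ (G i).wires k = b i) :
    (List.ofFn G).Pairwise fun G H => ∀ i j, G.wires i ≠ H.wires j := by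
  rw [List.pairwise_ofFn]
  intro i j hij k l h
  rcases hG i k with h1 | h1 <;> rcases hG j l with h2 | h2 <;> rw [h1, h2] at h
  · exact hij.ne (ha h)
  · exact hab _ _ h
  · exact hab _ _ h.symm
  · exact hij.ne (hb h)

omit [Fintype Q] [DecidableEq Q] in
theorem wire2_cases {a b : Q} (h : a ≠ b) (k : Fin 2) : wire2 h k = a ∨ wire2 h k = b := by
  fin_cases k
  · exact Or.inl rfl
  · exact Or.inr rfl

theorem exists_cnotLayer {m : ℕ} (a b : Fin m → Q) (ha : Function.Injective a)
    (hb : Function.Injective b) (hab : ∀ i j, a i ≠ b j) :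
    ∃ L : Layer Q, L.gates.length = m ∧ ∀ w, L.toOp.mulVec (ket w) =
      ket (fun q => w q + ∑ i, if b i = q then w (a i) else 0) := by
  refine ⟨⟨List.ofFn fun i => cnotGate (hab i i), pairwise_disjoint_ofFn a b ha hb hab _
    fun i k => wire2_cases (hab i i) k⟩, List.length_ofFn, fun w => ?_⟩
  have h1 := cnots_mulVec (List.ofFn fun i => (⟨(a i, b i), hab i i⟩ : {p : Q × Q // p.1 ≠ p.2}))
    (by
      intro p hp q hq
      rw [List.mem_ofFn] at hp hq
      obtain ⟨i, rfl⟩ := hp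
      obtain ⟨j, rfl⟩ := hq
      exact hab i j) w
  simp only [List.map_ofFn, Function.comp_def, List.sum_ofFn] at h1
  rw [← h1, Layer.toOp, List.map_ofFn]
  rfl

theorem exists_zzLayer {m : ℕ} (a b : Fin m → Q) (ha : Function.Injective a)
    (hb : Function.Injective b) (hab : ∀ i j, a i ≠ b j) (θ : Fin m → ℝ) :
    ∃ L : Layer Q, L.gates.length = m ∧ ∀ w, L.toOp.mulVec (ket w) =
      Complex.exp ((∑ i, θ i * (sgn (w (a i)) * sgn (w (b i))) : ℝ) * Complex.I) • ket w := by
  refine ⟨⟨List.ofFn fun i => zzGate (hab i i) (θ i), pairwise_disjoint_ofFn a b ha hb hab _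
    fun i k => wire2_cases (hab i i) k⟩, List.length_ofFn, fun w => ?_⟩
  have h1 : ∀ l : List (Fin m), (l.map fun i => (zzGate (hab i i) (θ i)).toOp).prod.mulVec (ket w) =
      Complex.exp (((l.map fun i => θ i * (sgn (w (a i)) * sgn (w (b i)))).sum : ℝ) * Complex.I) •
        ket w := by
    intro l
    induction l with
    | nil => simp
    | cons i l ih =>
      rw [List.map_cons, List.prod_cons, ← Matrix.mulVec_mulVec, ih, Matrix.mulVec_smul,
        zzGate_mulVec, smul_smul, ← Complex.exp_add, List.map_cons, List.sum_cons]
      congr 2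
      push_cast
      ring
  have h2 : ∀ f : Fin m → ℝ, ∑ i, f i = ((List.finRange m).map f).sum := fun f => by
    rw [← List.sum_ofFn, List.ofFn_eq_map]
  rw [h2]
  refine Eq.trans ?_ (h1 (List.finRange m))
  change ((List.ofFn fun i => zzGate (hab i i) (θ i)).map Gate.toOp).prod.mulVec (ket w) = _
  rw [List.ofFn_eq_map, List.map_map]
  rfl

/-- The assignment `w` with the first `2 ^ i` copies set to `b`. -/
def fan (cp : ℕ → Q) (i : ℕ) (b : Fin 2) (w : Q → Fin 2) : Q → Fin 2 :=
  fun q => if q ∈ (Finset.range (2 ^ i)).image cp then b else w q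

omit [Fintype Q] in
theorem fan_of_lt (cp : ℕ → Q) {i j : ℕ} (hj : j < 2 ^ i) (b : Fin 2) (w : Q → Fin 2) :
    fan cp i b w (cp j) = b :=
  if_pos (Finset.mem_image_of_mem _ (Finset.mem_range.2 hj))

omit [Fintype Q] in
theorem fan_of_ne (cp : ℕ → Q) {i : ℕ} {q : Q} (hq : ∀ j < 2 ^ i, cp j ≠ q) (b : Fin 2)
    (w : Q → Fin 2) : fan cp i b w q = w q := by
  refine if_neg fun h => ?_
  rw [Finset.mem_image] at h
  obtain ⟨j, hj, rfl⟩ := h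
  exact hq j (Finset.mem_range.1 hj) rfl

/-- Copy j is added to copy 2^i + j, doubling the number of copies of the bit in one layer. The same
layer undoes itself. -/
theorem exists_fanLayer {cp : ℕ → Q} {s : ℕ} (hcp : Set.InjOn cp (Set.Iio (2 ^ s))) {i : ℕ}
    (hi : i < s) : ∃ L : Layer Q, L.gates.length = 2 ^ i ∧
      ∀ (b : Fin 2) (w : Q → Fin 2), (∀ j < 2 ^ s, w (cp j) = 0) →
        L.toOp.mulVec (ket (fan cp i b w)) = ket (fan cp (i + 1) b w) ∧
        L.toOp.mulVec (ket (fan cp (i + 1) b w)) = ket (fan cp i b w) := by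
  have h2 : 2 ^ (i + 1) ≤ 2 ^ s := Nat.pow_le_pow_right (by norm_num) hi
  have hp : 2 ^ (i + 1) = 2 ^ i + 2 ^ i := by ring
  obtain ⟨L, hL, h⟩ := exists_cnotLayer (m := 2 ^ i) (fun j => cp j) (fun j => cp (2 ^ i + j))
    (fun j k hjk => Fin.ext (hcp (by simp only [Set.mem_Iio]; omega) (by simp only [Set.mem_Iio]; omega) hjk))
    (fun j k hjk => Fin.ext (by
      have := hcp (x₁ := 2 ^ i + j) (x₂ := 2 ^ i + k)
        (by simp only [Set.mem_Iio]; omega) (by simp only [Set.mem_Iio]; omega) hjk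
      omega))
    (fun j k hjk => by
      have := hcp (x₁ := (j : ℕ)) (x₂ := 2 ^ i + k)
        (by simp only [Set.mem_Iio]; omega) (by simp only [Set.mem_Iio]; omega) hjk
      omega)
  have key : ∀ (b : Fin 2) (w w' : Q → Fin 2), (∀ j < 2 ^ i, w' (cp j) = b) → ∀ q,
      (w' q + ∑ j : Fin (2 ^ i), if cp (2 ^ i + j) = q then w' (cp j) else 0) =
        if q ∈ (Finset.range (2 ^ i)).image (fun j => cp (2 ^ i + j)) then w' q + b else w' q := by
    intro b w w' hw' q
    split_ifs with hq
    · rw [Finset.mem_image] at hq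
      obtain ⟨k, hk, rfl⟩ := hq
      have hk' := Finset.mem_range.1 hk
      congr 1
      rw [Finset.sum_eq_single ⟨k, hk'⟩]
      · rw [if_pos rfl]; exact hw' k hk'
      · intro j _ hj
        refine if_neg fun h => hj (Fin.ext ?_)
        have := hcp (x₁ := 2 ^ i + j) (x₂ := 2 ^ i + k)
          (by simp only [Set.mem_Iio]; omega) (by simp only [Set.mem_Iio]; omega) h
        simp only; omega
      · intro h; exact absurd (Finset.mem_univ _) h
    · rw [Finset.sum_eq_zero, add_zero]
      intro j _
      refine if_neg fun h => hq ?_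
      rw [Finset.mem_image]
      exact ⟨j, Finset.mem_range.2 j.2, h⟩
  have hsplit : ∀ (b : Fin 2) (w : Q → Fin 2), (∀ j < 2 ^ s, w (cp j) = 0) → ∀ q,
      fan cp (i + 1) b w q = if q ∈ (Finset.range (2 ^ i)).image (fun j => cp (2 ^ i + j))
        then fan cp i b w q + b else fan cp i b w q := by
    intro b w hw q
    split_ifs with hq
    · rw [Finset.mem_image] at hq
      obtain ⟨k, hk, rfl⟩ := hq
      have hk' := Finset.mem_range.1 hk
      rw [fan_of_lt cp (by omega), fan_of_ne, hw _ (by omega), zero_add]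
      intro j hj h
      have := hcp (x₁ := j) (x₂ := 2 ^ i + k)
          (by simp only [Set.mem_Iio]; omega) (by simp only [Set.mem_Iio]; omega) h
      omega
    · by_cases h1 : ∃ j < 2 ^ i, cp j = q
      · obtain ⟨j, hj, rfl⟩ := h1
        rw [fan_of_lt cp hj, fan_of_lt cp (by omega)]
      · push Not at h1
        rw [fan_of_ne cp h1, fan_of_ne]
        intro j hj h
        by_cases hj' : j < 2 ^ i
        · exact h1 j hj' h
        · apply hq
          rw [Finset.mem_image]
          exact ⟨j - 2 ^ i, Finset.mem_range.2 (by omega), by rw [Nat.add_sub_cancel' (by omega)]; exact h⟩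
  refine ⟨L, hL, fun b w hw => ⟨?_, ?_⟩⟩
  · rw [h]
    congr 1
    funext q
    rw [key b w (fan cp i b w) (fun j hj => fan_of_lt cp hj b w), hsplit b w hw]
  · rw [h]
    congr 1
    funext q
    rw [key b w (fan cp (i + 1) b w) (fun j hj => fan_of_lt cp (by omega) b w), hsplit b w hw]
    split_ifs
    · rw [add_assoc, add_self_bit, add_zero]
    · rfl

theorem exists_fanOut {cp : ℕ → Q} {s : ℕ} (hcp : Set.InjOn cp (Set.Iio (2 ^ s))) {i : ℕ}
    (hi : i ≤ s) : ∃ L L' : List (Layer Q), L.length = i ∧ L'.length = i ∧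
      gateCount L ≤ 2 ^ i ∧ gateCount L' ≤ 2 ^ i ∧
      ∀ (b : Fin 2) (w : Q → Fin 2), (∀ j < 2 ^ s, w (cp j) = 0) →
        (layersOp L).mulVec (ket (fan cp 0 b w)) = ket (fan cp i b w) ∧
        (layersOp L').mulVec (ket (fan cp i b w)) = ket (fan cp 0 b w) := by
  induction i with
  | zero =>
    refine ⟨[], [], rfl, rfl, by simp [gateCount], by simp [gateCount], fun b w _ => ?_⟩
    rw [layersOp_nil, Matrix.one_mulVec]
    exact ⟨rfl, rfl⟩
  | succ i ih =>
    obtain ⟨L, L', h1, h2, h3, h4, h⟩ := ih (by omega)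
    obtain ⟨F, hF, hF'⟩ := exists_fanLayer hcp (i := i) (by omega)
    have hc : gateCount [F] = 2 ^ i := by simp [gateCount, hF]
    refine ⟨L ++ [F], [F] ++ L', by simp [h1], by simp [h2], ?_, ?_, fun b w hw => ⟨?_, ?_⟩⟩
    · rw [gateCount_append, hc, pow_succ]; omega
    · rw [gateCount_append, hc, pow_succ]; omega
    · rw [layersOp_append_mulVec, (h b w hw).1, layersOp_singleton, (hF' b w hw).1]
    · rw [layersOp_append_mulVec, layersOp_singleton, (hF' b w hw).2, (h b w hw).2]

/-- Each copy of the bit b meets a different register qubit in a ZZ rotation, so one layer handles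
2^s register qubits at once and ρ layers cover the register. -/
theorem exists_registerPhases {cp : ℕ → Q} {s : ℕ} (hcp : Set.InjOn cp (Set.Iio (2 ^ s)))
    {reg : ℕ → Q} {ℓ : ℕ} (hreg : Set.InjOn reg (Set.Iio ℓ))
    (hdisj : ∀ i < 2 ^ s, ∀ j < ℓ, cp i ≠ reg j) (θ : ℕ → ℝ) (ρ : ℕ) (hρ : ℓ ≤ ρ * 2 ^ s) :
    ∃ L : List (Layer Q), L.length = ρ ∧ gateCount L = ℓ ∧
      ∀ (b : Fin 2) (w : Q → Fin 2), (∀ j < 2 ^ s, w (cp j) = b) →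
        (layersOp L).mulVec (ket w) =
          Complex.exp ((sgn b * ∑ q ∈ Finset.range ℓ, θ q * sgn (w (reg q)) : ℝ) * Complex.I) •
            ket w := by
  induction ρ generalizing ℓ with
  | zero =>
    have : ℓ = 0 := by omega
    subst this
    refine ⟨[], rfl, rfl, fun b w _ => ?_⟩
    simp [layersOp_nil]
  | succ ρ ih =>
    -- The first ρ rounds take as many register qubits as they can; the m ≤ 2^s left over go into
    -- the last layer.
    set ℓ' := min ℓ (ρ * 2 ^ s) with hℓ'
    have hle : ℓ' ≤ ℓ := min_le_left _ _
    obtain ⟨m, hm⟩ := Nat.exists_eq_add_of_le hle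
    have hm2 : m ≤ 2 ^ s := by
      have : ℓ - min ℓ (ρ * 2 ^ s) ≤ 2 ^ s := by
        rw [Nat.succ_mul] at hρ
        generalize ρ * 2 ^ s = A at hρ ⊢
        rcases le_total ℓ A with hA | hA
        · rw [min_eq_left hA, Nat.sub_self]; exact Nat.zero_le _
        · rw [min_eq_right hA]; exact Nat.sub_le_iff_le_add'.2 hρ
      omega
    obtain ⟨L, h1, h2, h⟩ := ih (ℓ := ℓ') (hreg.mono (Set.Iio_subset_Iio hle))
      (fun i hi j hj => hdisj i hi j (by omega)) (by omega)
    obtain ⟨F, hF, hF'⟩ := exists_zzLayer (m := m) (fun i => cp i) (fun i => reg (ℓ' + i))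
      (fun j k hjk => Fin.ext (hcp (by simp only [Set.mem_Iio]; omega)
        (by simp only [Set.mem_Iio]; omega) hjk))
      (fun j k hjk => Fin.ext (by
        have := hreg (x₁ := ℓ' + j) (x₂ := ℓ' + k)
          (by simp only [Set.mem_Iio]; omega) (by simp only [Set.mem_Iio]; omega) hjk
        omega))
      (fun j k => hdisj _ (by omega) _ (by omega)) (fun i => θ (ℓ' + i))
    refine ⟨L ++ [F], by simp [h1], ?_, fun b w hw => ?_⟩
    · rw [gateCount_append, h2]
      simp [gateCount, hF, hm]
    · rw [layersOp_append_mulVec, h b w hw, Matrix.mulVec_smul, layersOp_singleton, hF', smul_smul,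
        ← Complex.exp_add, hm, Finset.sum_range_add]
      congr 2
      rw [← add_mul, ← Complex.ofReal_add]
      congr 2
      rw [mul_add]
      congr 1
      rw [← Fin.sum_univ_eq_sum_range (fun i => θ (ℓ' + i) * sgn (w (reg (ℓ' + i)))), Finset.mul_sum]
      refine Finset.sum_congr rfl fun i _ => ?_
      rw [hw i (by omega)]
      ring

/-! ### Circuits as data-dependent families of 2×2 matrices -/

/-- `U` acts on the basis vectors `e x 0, e x 1` as the matrix `M x`. -/
def ActsAs {X : Type*} (e : X → Fin 2 → Q → Fin 2) (U : QOp Q)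
    (M : X → Matrix (Fin 2) (Fin 2) ℂ) : Prop :=
  ∀ x b, U.mulVec (ket (e x b)) = ∑ b', M x b' b • ket (e x b')

/-- The family `M` of operators is implemented, on the basis vectors `e x b`, by a circuit of depth
at most `D` and size at most `S`. -/
def Impl {X : Type*} (e : X → Fin 2 → Q → Fin 2) (M : X → Matrix (Fin 2) (Fin 2) ℂ) (D S : ℕ) :
    Prop :=
  ∃ L : List (Layer Q), L.length ≤ D ∧ gateCount L ≤ S ∧ ActsAs e (layersOp L) M

theorem Impl.mono {X : Type*} {e : X → Fin 2 → Q → Fin 2} {M : X → Matrix (Fin 2) (Fin 2) ℂ}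
    {D S D' S' : ℕ} (h : Impl e M D S) (hD : D ≤ D') (hS : S ≤ S') : Impl e M D' S' := by
  obtain ⟨L, h1, h2, h3⟩ := h
  exact ⟨L, h1.trans hD, h2.trans hS, h3⟩

theorem Impl.mul {X : Type*} {e : X → Fin 2 → Q → Fin 2} {M N : X → Matrix (Fin 2) (Fin 2) ℂ}
    {D S D' S' : ℕ} (hM : Impl e M D S) (hN : Impl e N D' S') :
    Impl e (fun x => M x * N x) (D + D') (S + S') := by
  obtain ⟨L, h1, h2, h3⟩ := hM
  obtain ⟨L', h1', h2', h3'⟩ := hN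
  refine ⟨L' ++ L, ?_, ?_, fun x b => ?_⟩
  · rw [List.length_append]; omega
  · rw [gateCount_append]; omega
  · rw [layersOp_append_mulVec, h3' x b]
    simp only [Fin.sum_univ_two, Matrix.mulVec_add, Matrix.mulVec_smul, h3 x, Matrix.mul_apply,
      smul_add, smul_smul, add_smul]
    simp only [mul_comm (N x _ _)]
    abel

omit [Fintype Q] [DecidableEq Q] in
theorem zRot_smul_ket_sum (θ : ℝ) (b : Fin 2) (f : Fin 2 → (Q → Fin 2) → ℂ) :
    ∑ b', zRot θ b' b • f b' = Complex.exp ((sgn b * θ : ℝ) * Complex.I) • f b := by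
  fin_cases b <;> simp [zRot]

/-- Fan out, apply the linear phase through the copies, fan back in: the depth is logarithmic in the
number of copies, plus the number of rounds. -/
theorem Impl.zRot_register {X : Type*} {cp : ℕ → Q} {s : ℕ} (hcp : Set.InjOn cp (Set.Iio (2 ^ s)))
    {reg : ℕ → Q} {ℓ : ℕ} (hreg : Set.InjOn reg (Set.Iio ℓ))
    (hdisj : ∀ i < 2 ^ s, ∀ j < ℓ, cp i ≠ reg j) (θ : ℕ → ℝ) (ρ : ℕ) (hρ : ℓ ≤ ρ * 2 ^ s)
    (w : X → Q → Fin 2) (hw : ∀ x, ∀ j < 2 ^ s, w x (cp j) = 0) :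
    Impl (fun x b => fan cp 0 b (w x))
      (fun x => zRot (∑ q ∈ Finset.range ℓ, θ q * sgn (w x (reg q)))) (2 * s + ρ)
      (2 * 2 ^ s + ℓ) := by
  obtain ⟨L, L', h1, h2, h3, h4, h⟩ := exists_fanOut hcp le_rfl
  obtain ⟨P, hP1, hP2, hP⟩ := exists_registerPhases hcp hreg hdisj θ ρ hρ
  refine ⟨L ++ P ++ L', ?_, ?_, fun x b => ?_⟩
  · simp only [List.length_append]; omega
  · simp only [gateCount_append]; omega
  · rw [layersOp_append_mulVec, layersOp_append_mulVec, (h b (w x) (hw x)).1,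
      hP b _ (fun j hj => fan_of_lt cp hj b (w x)), Matrix.mulVec_smul, (h b (w x) (hw x)).2,
      zRot_smul_ket_sum]
    have hsum : ∑ q ∈ Finset.range ℓ, θ q * sgn (fan cp s b (w x) (reg q)) =
        ∑ q ∈ Finset.range ℓ, θ q * sgn (w x (reg q)) := by
      refine Finset.sum_congr rfl fun q hq => ?_
      rw [fan_of_ne cp fun j hj => hdisj j hj q (Finset.mem_range.1 hq)]
    rw [hsum]

omit [Fintype Q] in
theorem update_fan_zero (cp : ℕ → Q) (b b' : Fin 2) (w : Q → Fin 2) :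
    Function.update (fan cp 0 b w) (cp 0) b' = fan cp 0 b' w := by
  funext q
  by_cases hq : q = cp 0
  · subst hq
    rw [Function.update_self, fan_of_lt cp (by norm_num)]
  · have : ∀ j < 2 ^ 0, cp j ≠ q := by
      intro j hj
      have : j = 0 := by omega
      subst this
      exact Ne.symm hq
    rw [Function.update_of_ne hq, fan_of_ne cp this, fan_of_ne cp this]

theorem Impl.hadamard {X : Type*} (cp : ℕ → Q) (w : X → Q → Fin 2) :
    Impl (fun x b => fan cp 0 b (w x)) (fun _ => hadamard) 1 1 := by
  refine ⟨[Layer.single (hadamardGate (cp 0))], le_rfl, by simp [gateCount, Layer.single],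
    fun x b => ?_⟩
  rw [layersOp_singleton, Layer.single_toOp]
  have h := hadamardGate_mulVec (cp 0) (fan cp 0 b (w x))
  rw [fan_of_lt cp (by norm_num)] at h
  simp only [update_fan_zero] at h
  exact h

theorem Impl.zxRot {X : Type*} {cp : ℕ → Q} {w : X → Q → Fin 2} {α β : X → ℝ} {D S : ℕ}
    (hα : Impl (fun x b => fan cp 0 b (w x)) (fun x => zRot (α x)) D S)
    (hβ : Impl (fun x b => fan cp 0 b (w x)) (fun x => zRot (β x)) D S) :
    Impl (fun x b => fan cp 0 b (w x)) (fun x => zxRot (α x) (β x)) (2 * D + 2) (2 * S + 2) := by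
  have hH := Impl.hadamard cp w
  exact (hα.mul ((hH.mul hβ).mul hH)).mono (by omega) (by omega)

theorem Impl.qspProd {X : Type*} {cp : ℕ → Q} {w : X → Q → Fin 2} {α β : X → ℕ → ℝ} {θ : X → ℝ}
    {D S : ℕ} (hα : ∀ i, Impl (fun x b => fan cp 0 b (w x)) (fun x => zRot (α x i)) D S)
    (hβ : ∀ i, Impl (fun x b => fan cp 0 b (w x)) (fun x => zRot (β x i)) D S)
    (hθ : Impl (fun x b => fan cp 0 b (w x)) (fun x => zRot (θ x)) D S) (r : ℕ) :
    Impl (fun x b => fan cp 0 b (w x)) (fun x => qspProd (α x) (β x) (θ x) r)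
      ((r + 1) * (3 * D + 2)) ((r + 1) * (3 * S + 2)) := by
  induction r with
  | zero => exact ((hα 0).zxRot (hβ 0)).mono (by omega) (by omega)
  | succ r ih =>
    refine (((hα (r + 1)).zxRot (hβ (r + 1))).mul (hθ.mul ih)).mono ?_ ?_
    · rw [Nat.succ_mul (r + 1)]; omega
    · rw [Nat.succ_mul (r + 1)]; omega

end Circuits

/-! ### Walsh expansion, block encodings and the exact encoding -/

/-- Walsh expansion of a function of finitely many bits. -/
theorem exists_walsh {ι : Type*} [Fintype ι] [DecidableEq ι] (α : (ι → Fin 2) → ℝ) :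
    ∃ c : Finset ι → ℝ, ∀ x, α x = ∑ S, c S * ∏ i ∈ S, sgn (x i) := by
  refine ⟨fun S => (2 ^ Fintype.card ι)⁻¹ * ∑ y, α y * ∏ i ∈ S, sgn (y i), fun x => ?_⟩
  have h1 : ∀ y : ι → Fin 2, ∑ S : Finset ι, (∏ i ∈ S, sgn (y i)) * ∏ i ∈ S, sgn (x i) =
      if y = x then 2 ^ Fintype.card ι else 0 := by
    intro y
    have h2 := Finset.prod_one_add (s := Finset.univ) (f := fun i => sgn (y i) * sgn (x i))
    rw [Finset.powerset_univ] at h2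
    simp only [Finset.prod_mul_distrib] at h2
    rw [← h2]
    split_ifs with h
    · subst h
      simp only [sgn_mul_self]
      norm_num [Finset.prod_const]
    · obtain ⟨i, hi⟩ := Function.ne_iff.1 h
      refine Finset.prod_eq_zero (Finset.mem_univ i) ?_
      generalize y i = p at hi
      generalize x i = q at hi
      fin_cases p <;> fin_cases q <;> simp_all
  have h2 : (2 : ℝ) ^ Fintype.card ι ≠ 0 := by positivity
  calc α x = (2 ^ Fintype.card ι)⁻¹ * ∑ y, α y * (if y = x then 2 ^ Fintype.card ι else 0) := by
        simp only [mul_ite, mul_zero, Finset.sum_ite_eq', Finset.mem_univ, if_true]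
        field_simp
    _ = (2 ^ Fintype.card ι)⁻¹ * ∑ y, ∑ S : Finset ι,
          α y * ((∏ i ∈ S, sgn (y i)) * ∏ i ∈ S, sgn (x i)) := by
        congr 1
        refine Finset.sum_congr rfl fun y _ => ?_
        rw [← h1 y, Finset.mul_sum]
    _ = _ := by
        rw [Finset.sum_comm, Finset.mul_sum]
        refine Finset.sum_congr rfl fun S _ => ?_
        rw [mul_assoc, Finset.sum_mul]
        congr 1
        refine Finset.sum_congr rfl fun y _ => ?_
        ring

theorem zRot_zero : zRot 0 = 1 := by
  ext i j
  fin_cases i <;> fin_cases j <;> simp [zRot]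

section

variable {Q : Type} [Fintype Q] [DecidableEq Q] {X : Type*}

theorem Impl.one (e : X → Fin 2 → Q → Fin 2) : Impl e (fun _ => 1) 0 0 := by
  refine ⟨[], le_rfl, le_rfl, fun x b => ?_⟩
  rw [layersOp_nil, Matrix.one_mulVec]
  simp [Matrix.one_apply]

theorem Impl.zRot_sum {e : X → Fin 2 → Q → Fin 2} {ι : Type*} (s : Finset ι) (f : ι → X → ℝ)
    {D S : ℕ} (h : ∀ i ∈ s, Impl e (fun x => zRot (f i x)) D S) :
    Impl e (fun x => zRot (∑ i ∈ s, f i x)) (s.card * D) (s.card * S) := by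
  classical
  induction s using Finset.induction_on with
  | empty => simpa [zRot_zero] using Impl.one e
  | insert a s ha ih =>
    have h1 := (h a (Finset.mem_insert_self _ _)).mul
      (ih fun i hi => h i (Finset.mem_insert_of_mem hi))
    simp only [← zRot_add] at h1
    simp only [Finset.sum_insert ha]
    rw [Finset.card_insert_of_notMem ha, Nat.succ_mul, Nat.succ_mul]
    exact h1.mono (by omega) (by omega)

/-- Used with E writing the parities into ancillas: they are computed once, serve all rotations, and
are erased by the same circuit. -/
theorem Impl.conj {e e' : X → Fin 2 → Q → Fin 2} {M : X → Matrix (Fin 2) (Fin 2) ℂ} {D S : ℕ}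
    (E : List (Layer Q))
    (h : ∀ x b, (layersOp E).mulVec (ket (e x b)) = ket (e' x b))
    (h' : ∀ x b, (layersOp E).mulVec (ket (e' x b)) = ket (e x b)) (hM : Impl e' M D S) :
    Impl e M (D + 2 * E.length) (S + 2 * gateCount E) := by
  obtain ⟨L, h1, h2, h3⟩ := hM
  refine ⟨E ++ L ++ E, ?_, ?_, fun x b => ?_⟩
  · simp only [List.length_append]; omega
  · simp only [gateCount_append]; omega
  · rw [layersOp_append_mulVec, layersOp_append_mulVec, h, h3 x b]
    simp only [Fin.sum_univ_two, Matrix.mulVec_add, Matrix.mulVec_smul, h']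

/-- The shift by the bits that a list of CNOT gates adds to their targets. -/
def cnotShift (l : List {p : Q × Q // p.1 ≠ p.2}) (w : Q → Fin 2) (q : Q) : Fin 2 :=
  (l.map fun p => if p.1.2 = q then w p.1.1 else 0).sum

end

/-- The assignment with all ancillas `0` and data `x`. -/
def dataState {n : ℕ} (x : Fin n → Fin 2) : Fin n ⊕ Fin n → Fin 2 := Sum.elim (fun _ => 0) x

/-- Data and the other ancillas are preserved, so projecting on ancillas 0 discards the branch where
the rotated qubit is 1 and leaves a diagonal operator. -/
theorem ancillaBlock_of_actsAs {n : ℕ} {cp : ℕ → Fin n ⊕ Fin n} {i : Fin n} (hcp : cp 0 = Sum.inl i)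
    {U : QOp (Fin n ⊕ Fin n)} {M : (Fin n → Fin 2) → Matrix (Fin 2) (Fin 2) ℂ}
    (h : ActsAs (fun x b => fan cp 0 b (dataState x)) U M) :
    ancillaBlock U = Matrix.diagonal fun x => M x 0 0 := by
  have h0 : ∀ x : Fin n → Fin 2, fan cp 0 0 (dataState x) = dataState x := by
    intro x
    funext q
    by_cases hq : q = cp 0
    · subst hq
      rw [fan_of_lt cp (by norm_num), hcp]
      rfl
    · refine fan_of_ne cp (fun j hj => ?_) _ _
      have : j = 0 := by omega
      subst this
      exact Ne.symm hq
  ext x y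
  have h1 := h y 0
  simp only [h0] at h1
  rw [mulVec_ket] at h1
  have h2 := congrFun h1 (dataState x)
  rw [Fin.sum_univ_two, h0] at h2
  simp only [Pi.add_apply, Pi.smul_apply, ket_apply, smul_eq_mul] at h2
  have h3 : dataState x ≠ fan cp 0 1 (dataState y) := by
    intro h3
    have h4 := congrFun h3 (cp 0)
    rw [fan_of_lt cp (by norm_num), hcp] at h4
    exact absurd h4 (by simp [dataState])
  have h5 : (dataState x = dataState y) ↔ x = y := by
    refine ⟨fun h => ?_, fun h => by rw [h]⟩
    funext k
    exact congrFun h (Sum.inr k)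
  rw [if_neg h3, mul_zero, add_zero] at h2
  rw [Matrix.diagonal_apply]
  refine Eq.trans h2 ?_
  by_cases hxy : x = y
  · subst hxy
    rw [if_pos rfl, if_pos rfl, mul_one]
  · rw [if_neg hxy, if_neg (fun h => hxy (h5.1 h)), mul_zero]

theorem specNorm_diagonal_le {n : ℕ} (v : (Fin n → Fin 2) → ℂ) {c : ℝ} (hc : 0 ≤ c)
    (h : ∀ x, ‖v x‖ ≤ c) : specNorm (Matrix.diagonal v) ≤ c := by
  rw [specNorm]
  have h1 := Matrix.l2_opNorm_diagonal (𝕜 := ℂ) v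
  rw [← Matrix.l2_opNorm_toEuclideanCLM] at h1
  rw [h1, pi_norm_le_iff_of_nonneg hc]
  exact h

/-- From an implementation with the right diagonal entries to a block encoding. -/
theorem exists_blockEncoding_of_impl {n : ℕ} {cp : ℕ → Fin n ⊕ Fin n} {i : Fin n}
    (hcp : cp 0 = Sum.inl i) {M : (Fin n → Fin 2) → Matrix (Fin 2) (Fin 2) ℂ} {D S : ℕ}
    (h : Impl (fun x b => fan cp 0 b (dataState x)) M D S) {α ε : ℝ} (hε : 0 ≤ ε) {g : ℝ → ℝ}
    (hg : ∀ x : Fin n → Fin 2,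
      ‖((g (((finFunctionFinEquiv x : Fin (2 ^ n)) : ℕ) / 2 ^ n) : ℝ) : ℂ) - α * M x 0 0‖ ≤ ε) :
    ∃ c : QCircuit (Fin n ⊕ Fin n), IsBlockEncoding α n ε c.toOp (diagOp n g) ∧
      c.depth ≤ D ∧ c.size ≤ S := by
  obtain ⟨L, h1, h2, h3⟩ := h
  refine ⟨⟨L⟩, ⟨QCircuit.toOp_mem_unitaryGroup _, ?_⟩, h1, h2⟩
  have h4 : ancillaBlock (QCircuit.toOp ⟨L⟩) = Matrix.diagonal fun x => M x 0 0 :=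
    ancillaBlock_of_actsAs hcp h3
  rw [h4, diagOp, ← Matrix.diagonal_smul, Matrix.diagonal_sub]
  exact specNorm_diagonal_le _ hε fun x => by simpa using hg x

/-- The sequence neither reads nor writes the rotated qubit, and its controls are unchanged, so a
second run adds the same shift and cancels it modulo 2. -/
theorem cnotSeq_fan {Q : Type} [Fintype Q] [DecidableEq Q] {cp : ℕ → Q}
    (l : List {p : Q × Q // p.1 ≠ p.2}) (h : ∀ p ∈ l, ∀ q ∈ l, p.1.1 ≠ q.1.2)
    (h1 : ∀ p ∈ l, p.1.1 ≠ cp 0) (h2 : ∀ p ∈ l, p.1.2 ≠ cp 0) (b : Fin 2) (w : Q → Fin 2) :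
    (layersOp (cnotSeq l)).mulVec (ket (fan cp 0 b w)) =
        ket (fan cp 0 b fun q => w q + cnotShift l w q) ∧
      (layersOp (cnotSeq l)).mulVec (ket (fan cp 0 b fun q => w q + cnotShift l w q)) =
        ket (fan cp 0 b w) := by
  have hne : ∀ q, q ≠ cp 0 → ∀ j < 2 ^ 0, cp j ≠ q := by
    intro q hq j hj
    have : j = 0 := by omega
    subst this
    exact hq.symm
  have hshift0 : ∀ w', cnotShift l w' (cp 0) = 0 := by
    intro w'
    apply List.sum_eq_zero
    intro x hx
    rw [List.mem_map] at hx
    obtain ⟨p, hp, rfl⟩ := hx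
    exact if_neg (h2 p hp)
  have hcongr : ∀ w' w'' : Q → Fin 2, (∀ p ∈ l, w' p.1.1 = w'' p.1.1) →
      cnotShift l w' = cnotShift l w'' := by
    intro w' w'' hw
    funext q
    rw [cnotShift, cnotShift]
    congr 1
    refine List.map_congr_left fun p hp => ?_
    rw [hw p hp]
  have hctrl : ∀ p ∈ l, cnotShift l w p.1.1 = 0 := by
    intro p hp
    apply List.sum_eq_zero
    intro x hx
    rw [List.mem_map] at hx
    obtain ⟨p', hp', rfl⟩ := hx
    exact if_neg (h p hp p' hp').symm
  have hs1 : cnotShift l (fan cp 0 b w) = cnotShift l w :=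
    hcongr _ _ fun p hp => fan_of_ne cp (hne _ (h1 p hp)) _ _
  have hs2 : cnotShift l (fan cp 0 b fun q => w q + cnotShift l w q) = cnotShift l w :=
    hcongr _ _ fun p hp => by
      rw [fan_of_ne cp (hne _ (h1 p hp)), hctrl p hp, add_zero]
  constructor
  · rw [cnotSeq_mulVec l h]
    congr 1
    funext q
    change fan cp 0 b w q + cnotShift l (fan cp 0 b w) q = _
    rw [hs1]
    by_cases hq : q = cp 0
    · subst hq
      rw [fan_of_lt cp (by norm_num), fan_of_lt cp (by norm_num), hshift0, add_zero]
    · rw [fan_of_ne cp (hne _ hq), fan_of_ne cp (hne _ hq)]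
  · rw [cnotSeq_mulVec l h]
    congr 1
    funext q
    change fan cp 0 b _ q + cnotShift l (fan cp 0 b _) q = _
    rw [hs2]
    by_cases hq : q = cp 0
    · subst hq
      rw [fan_of_lt cp (by norm_num), fan_of_lt cp (by norm_num), hshift0, add_zero]
    · rw [fan_of_ne cp (hne _ hq), fan_of_ne cp (hne _ hq), add_assoc, add_self_bit, add_zero]

/-- A phase controlled by the parity of a set of data bits. -/
theorem Impl.zRot_parity {n : ℕ} {cp : ℕ → Fin n ⊕ Fin n} {i : Fin n} (hcp : cp 0 = Sum.inl i)
    (S : Finset (Fin n)) (θ : ℝ) :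
    Impl (fun x b => fan cp 0 b (dataState x)) (fun x => zRot (θ * ∏ k ∈ S, sgn (x k)))
      (2 * n + 1) (2 * n + 1) := by
  have hne : ∀ k : Fin n, (Sum.inr k : Fin n ⊕ Fin n) ≠ Sum.inl i := fun k => by simp
  set l : List {p : (Fin n ⊕ Fin n) × (Fin n ⊕ Fin n) // p.1 ≠ p.2} :=
    S.toList.map fun k => ⟨(Sum.inr k, Sum.inl i), hne k⟩ with hl
  have hmem : ∀ p ∈ l, p.1.2 = Sum.inl i ∧ ∃ k, p.1.1 = Sum.inr k := by
    intro p hp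
    rw [hl, List.mem_map] at hp
    obtain ⟨k, -, rfl⟩ := hp
    exact ⟨rfl, k, rfl⟩
  have hctrl : ∀ p ∈ l, ∀ q ∈ l, p.1.1 ≠ q.1.2 := by
    intro p hp q hq
    obtain ⟨k, hk⟩ := (hmem p hp).2
    rw [(hmem q hq).1, hk]
    exact hne k
  have hlen : l.length ≤ n := by
    rw [hl, List.length_map, Finset.length_toList]
    exact (Finset.card_le_univ S).trans (by simp)
  have hseq : ∀ (b : Fin 2) (x : Fin n → Fin 2),
      (layersOp (cnotSeq l)).mulVec (ket (fan cp 0 b (dataState x))) =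
        ket (fan cp 0 (b + ∑ k ∈ S, x k) (dataState x)) := by
    intro b x
    rw [cnotSeq_mulVec l hctrl]
    congr 1
    funext q
    by_cases hq : q = cp 0
    · subst hq
      rw [fan_of_lt cp (by norm_num), fan_of_lt cp (by norm_num), hl, List.map_map, hcp,
        ← Finset.sum_map_toList]
      congr 2
      refine List.map_congr_left fun k _ => ?_
      simp only [Function.comp_apply, if_true]
      refine fan_of_ne cp (fun j hj => ?_) _ _
      have : j = 0 := by omega
      subst this
      rw [hcp]
      exact (hne k).symm
    · have h1 : ∀ j < 2 ^ 0, cp j ≠ q := by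
        intro j hj
        have : j = 0 := by omega
        subst this
        exact Ne.symm hq
      rw [fan_of_ne cp h1, fan_of_ne cp h1, List.sum_eq_zero, add_zero]
      intro y hy
      rw [List.mem_map] at hy
      obtain ⟨p, hp, rfl⟩ := hy
      refine if_neg fun h => hq ?_
      rw [← h, (hmem p hp).1, hcp]
  refine ⟨cnotSeq l ++ [Layer.single (phaseGate (cp 0) θ)] ++ cnotSeq l, ?_, ?_, fun x b => ?_⟩
  · simp only [List.length_append, cnotSeq_length, List.length_singleton]; omega
  · simp only [gateCount_append, gateCount_cnotSeq]
    simp only [gateCount, Layer.single, List.map_cons, List.map_nil, List.sum_cons, List.sum_nil,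
      List.length_singleton]
    omega
  · rw [layersOp_append_mulVec, layersOp_append_mulVec, hseq, layersOp_singleton,
      Layer.single_toOp, phaseGate_mulVec, Matrix.mulVec_smul, hseq, fan_of_lt cp (by norm_num),
      add_assoc, add_self_bit, add_zero, zRot_smul_ket_sum, sgn_add, sgn_sum]
    congr 3
    push_cast
    ring

theorem Impl.zRot_bits {n : ℕ} {cp : ℕ → Fin n ⊕ Fin n} {i : Fin n} (hcp : cp 0 = Sum.inl i)
    (α : (Fin n → Fin 2) → ℝ) :
    Impl (fun x b => fan cp 0 b (dataState x)) (fun x => zRot (α x))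
      (2 ^ n * (2 * n + 1)) (2 ^ n * (2 * n + 1)) := by
  obtain ⟨c, hc⟩ := exists_walsh α
  have h1 : ∀ S ∈ (Finset.univ : Finset (Finset (Fin n))),
      Impl (fun x b => fan cp 0 b (dataState x)) (fun x => zRot (c S * ∏ k ∈ S, sgn (x k)))
        (2 * n + 1) (2 * n + 1) := fun S _ => Impl.zRot_parity hcp S (c S)
  have h := Impl.zRot_sum (e := fun x b => fan cp 0 b (dataState x)) Finset.univ
    (fun (S : Finset (Fin n)) (x : Fin n → Fin 2) => c S * ∏ k ∈ S, sgn (x k)) h1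
  simp only [← hc] at h
  rwa [Finset.card_univ, Fintype.card_finset, Fintype.card_fin] at h

/-- Exact block encoding with a depth that depends on `n` only. -/
theorem exists_exact_blockEncoding {n : ℕ} (hn : 1 ≤ n) {g : ℝ → ℝ} {G : ℝ}
    (hg : ∀ x, |g x| ≤ G) {ε : ℝ} (hε : 0 ≤ ε) :
    ∃ c : QCircuit (Fin n ⊕ Fin n), IsBlockEncoding G n ε c.toOp (diagOp n g) ∧
      c.depth ≤ 2 ^ n * (2 * n + 1) + 2 ∧ c.size ≤ 2 ^ n * (2 * n + 1) + 2 := by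
  let cp : ℕ → Fin n ⊕ Fin n := fun _ => Sum.inl ⟨0, hn⟩
  have hcp : cp 0 = Sum.inl ⟨0, hn⟩ := rfl
  have hG : 0 ≤ G := (abs_nonneg _).trans (hg 0)
  let y : (Fin n → Fin 2) → ℝ := fun x => g (((finFunctionFinEquiv x : Fin (2 ^ n)) : ℕ) / 2 ^ n)
  -- Conjugating a Z rotation by Hadamards gives an X rotation, whose (0,0) entry is the cosine of
  -- the angle; hence the arccosine.
  have h : Impl (fun x b => fan cp 0 b (dataState x))
      (fun x => hadamard * zRot (Real.arccos (y x / G)) * hadamard)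
      (2 ^ n * (2 * n + 1) + 2) (2 ^ n * (2 * n + 1) + 2) :=
    (((Impl.hadamard cp dataState).mul (Impl.zRot_bits hcp fun x =>
      Real.arccos (y x / G))).mul (Impl.hadamard cp dataState)).mono (by omega) (by omega)
  refine exists_blockEncoding_of_impl hcp h hε fun x => ?_
  have hyG : |y x| ≤ G := hg _
  obtain ⟨hy1, hy2⟩ := abs_le.1 hyG
  have h4 : G * Real.cos (Real.arccos (y x / G)) = y x := by
    rcases hG.eq_or_lt with h0 | hpos
    · rw [← h0, zero_mul]; rw [← h0] at hy1 hy2; linarith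
    · rw [Real.cos_arccos]
      · field_simp
      · rw [le_div_iff₀ hpos]; linarith
      · rw [div_le_iff₀ hpos]; linarith
  rw [hadamard_zRot_hadamard]
  change ‖((y x : ℝ) : ℂ) - G * ((Real.cos (Real.arccos (y x / G)) : ℝ) : ℂ)‖ ≤ ε
  rw [← Complex.ofReal_mul, h4, sub_self, norm_zero]
  exact hε
-- Signal-processing angles for g near a node
-- The complementary polynomial needs modulus strictly below 1, so p is first shrunk by 1 - η, which
-- costs at most η.
open Polynomial in
theorem exists_qspProd_of_polynomial {p : ℂ[X]} {r : ℕ} (hp : p.natDegree ≤ r)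
    (h1 : ∀ u : ℂ, ‖u‖ = 1 → ‖p.eval u‖ ≤ 1) {η : ℝ} (h0 : 0 < η) (hη : η ≤ 1) :
    ∃ (α β : ℕ → ℝ) (δ : ℝ), ∀ t : ℝ,
      ‖Complex.exp (δ * Complex.I) * qspProd α β (-t / 2) r 0 0 -
        Complex.exp (-(r * t / 2) * Complex.I) * p.eval (Complex.exp (t * Complex.I))‖ ≤ η := by
  have hev : ∀ u, (C ((1 - η : ℝ) : ℂ) * p).eval u = ((1 - η : ℝ) : ℂ) * p.eval u := by
    intro u; rw [eval_mul, eval_C]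
  have hdeg : (C ((1 - η : ℝ) : ℂ) * p).natDegree ≤ r := (natDegree_C_mul_le _ _).trans hp
  obtain ⟨q, hq, hpq⟩ := exists_complementary_polynomial (r := r) hdeg (by
    intro u hu
    rw [hev, norm_mul, Complex.norm_real, Real.norm_of_nonneg (by linarith)]
    nlinarith [h1 u hu, norm_nonneg (p.eval u)])
  obtain ⟨α, β, δ, h⟩ := exists_qspProd r _ q hdeg hq hpq
  refine ⟨α, β, δ, fun t => ?_⟩
  rw [(h t).1, hev, ← mul_sub, norm_mul]
  have e1 : ‖Complex.exp (-(r * t / 2) * Complex.I)‖ = 1 := by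
    have := Complex.norm_exp_ofReal_mul_I (-(r * t / 2))
    push_cast at this
    exact this
  have e2 : ((1 - η : ℝ) : ℂ) * p.eval (Complex.exp (t * Complex.I)) -
      p.eval (Complex.exp (t * Complex.I)) = (-η : ℝ) * p.eval (Complex.exp (t * Complex.I)) := by
    push_cast; ring
  rw [e1, one_mul, e2, norm_mul, Complex.norm_real, norm_neg, Real.norm_of_nonneg h0.le]
  have := h1 _ (Complex.norm_exp_ofReal_mul_I t)
  nlinarith

/-- Both terms are a-th powers, of bases at most 2^(24 - 4e) and 2^(c₁ + 6 - 2e). The lower bound on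
e makes each base at most 2^(-e), hence each term at most 2^(-ae). -/
theorem pow_error_le {c₁ e m a : ℕ} (he : c₁ + 8 ≤ e) (hm : m ≤ a * e) {x : ℝ}
    (hx : |x| ≤ 8 / 2 ^ e) :
    (8 * |x|) ^ (4 * a) + 2 ^ (c₁ * a) * |x| ^ (2 * a) ≤ 2 / 2 ^ m := by
  have hm' : (1 / 2 ^ e : ℝ) ^ a ≤ 1 / 2 ^ m := by
    rw [div_pow, one_pow, ← pow_mul, mul_comm e a]
    exact one_div_le_one_div_of_le (by positivity) (pow_le_pow_right₀ (by norm_num) hm)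
  have h1 : (8 * |x|) ^ 4 ≤ 1 / 2 ^ e := by
    calc (8 * |x|) ^ 4 ≤ (8 * (8 / 2 ^ e)) ^ 4 := by gcongr
      _ = 2 ^ 24 / 2 ^ (e * 4) := by rw [mul_pow, div_pow, ← pow_mul]; norm_num; ring
      _ ≤ 1 / 2 ^ e := by
        rw [div_le_div_iff₀ (by positivity) (by positivity), ← pow_add, one_mul]
        exact pow_le_pow_right₀ (by norm_num) (by omega)
  have h2 : 2 ^ c₁ * |x| ^ 2 ≤ 1 / 2 ^ e := by
    calc 2 ^ c₁ * |x| ^ 2 ≤ 2 ^ c₁ * (8 / 2 ^ e) ^ 2 := by gcongr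
      _ = 2 ^ (c₁ + 6) / 2 ^ (e * 2) := by rw [div_pow, ← pow_mul, pow_add]; norm_num; ring
      _ ≤ 1 / 2 ^ e := by
        rw [div_le_div_iff₀ (by positivity) (by positivity), ← pow_add, one_mul]
        exact pow_le_pow_right₀ (by norm_num) (by omega)
  calc (8 * |x|) ^ (4 * a) + 2 ^ (c₁ * a) * |x| ^ (2 * a)
      = ((8 * |x|) ^ 4) ^ a + (2 ^ c₁ * |x| ^ 2) ^ a := by
        rw [pow_mul, pow_mul, pow_mul, mul_pow (2 ^ c₁)]
    _ ≤ (1 / 2 ^ e) ^ a + (1 / 2 ^ e) ^ a := by gcongr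
    _ ≤ 1 / 2 ^ m + 1 / 2 ^ m := add_le_add hm' hm'
    _ = 2 / 2 ^ m := by ring

/-- The Fourier sum of g recentred at t has frequencies k/2^e in x, of modulus at most m/2^e ≤ a, so
a polynomial of degree O(a) represents it on the short arc. The angles depend on t only. -/
theorem exists_qsp_family {C R : ℝ} (hC : 0 < C) (hR : 1 < R) {g : ℝ → ℝ}
    (hp : Function.Periodic g 1) (hg : ContDiff ℝ ⊤ g)
    (hb : ∀ M : ℕ, supNorm01 (iteratedDeriv M g) ≤ C * (M ! : ℝ) / R ^ M) {c₁ e m a : ℕ}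
    (hc₀ : 1 ≤ c₁) (hc₁ : (1 - 1 / 2 ^ 17 : ℝ) ^ c₁ ≤ 1 / 2 ^ 17) (he : c₁ + 8 ≤ e)
    (hm : m ≤ a * e) (hea : e ≤ a) (t : ℝ) :
    ∃ (α β : ℕ → ℝ) (δ : ℝ), ∀ x : ℝ, |x| ≤ 8 / 2 ^ e →
      ‖(g (t + x / (2 * Real.pi * 2 ^ e)) : ℂ) - supNorm01 g *
        (Complex.exp (δ * Complex.I) * qspProd α β (-x / 2) (2 * (c₁ * a) + 4 * a) 0 0 *
          Complex.exp (((4 * a : ℕ) : ℝ) * x / 2 * Complex.I))‖ ≤ 5 * C / 2 ^ m := by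
  obtain ⟨c, hc, happ⟩ := exists_trig_approx hC hR hp hg hb m
  have hG0 := supNorm01_nonneg g
  have hGC : supNorm01 g ≤ C := by simpa using hb 0
  set G := supNorm01 g with hG
  set δ₀ : ℝ := C / 2 ^ m with hδ₀
  have hδ : 0 < δ₀ := by positivity
  set s := Finset.Icc (-(m : ℤ)) m with hs
  -- The truncated series exceeds the sup norm G by at most its error δ₀; dividing by B makes it
  -- bounded by 1.
  set B : ℝ := G + δ₀ with hB
  have hBpos : 0 < B := by positivity
  set c' : ℤ → ℂ := fun k => c k * Complex.exp (2 * Real.pi * k * t * Complex.I) / B with hc'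
  set μ : ℤ → ℝ := fun k => k / 2 ^ e with hμ
  set F : ℝ → ℂ := fun x => ∑ k ∈ s, c' k * Complex.exp (μ k * x * Complex.I) with hF
  have hBF : ∀ x : ℝ, ∑ k ∈ s, c k * Complex.exp (2 * Real.pi * k *
      ((t + x / (2 * Real.pi * 2 ^ e) : ℝ) : ℂ) * Complex.I) = B * F x := by
    intro x
    rw [hF, Finset.mul_sum]
    refine Finset.sum_congr rfl fun k _ => ?_
    have hBne : (B : ℂ) ≠ 0 := by exact_mod_cast hBpos.ne'
    have h2 : 2 * (Real.pi : ℂ) * k * ((t + x / (2 * Real.pi * 2 ^ e) : ℝ) : ℂ) * Complex.I =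
        2 * Real.pi * k * t * Complex.I + μ k * x * Complex.I := by
      have : (Real.pi : ℂ) ≠ 0 := by exact_mod_cast Real.pi_ne_zero
      simp only [hμ]
      push_cast
      field_simp
    rw [h2, Complex.exp_add]
    simp only [hc']
    field_simp
  have hgF : ∀ x : ℝ, ‖(g (t + x / (2 * Real.pi * 2 ^ e)) : ℂ) - B * F x‖ ≤ δ₀ := by
    intro x
    rw [← hBF x]
    exact happ _
  have hF1 : ∀ x : ℝ, ‖F x‖ ≤ 1 := by
    intro x
    have h1 := hgF x
    have h2 := le_supNorm01_of_periodic hg.continuous hp (t + x / (2 * Real.pi * 2 ^ e))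
    have h3 := norm_sub_norm_le ((B : ℂ) * F x) (g (t + x / (2 * Real.pi * 2 ^ e)))
    rw [norm_sub_rev, norm_mul, Complex.norm_real, Complex.norm_real, Real.norm_of_nonneg hBpos.le,
      Real.norm_eq_abs] at h3
    have h4 : B * ‖F x‖ ≤ B * 1 := by linarith
    exact le_of_mul_le_mul_left h4 hBpos
  have ha2 : a * e ≤ a * a := Nat.mul_le_mul_left _ hea
  have hlt : a < 2 ^ a := Nat.lt_two_pow_self
  obtain ⟨p, hpdeg, hp1, hpx⟩ := exists_circle_polynomial s c' μ (a := a) (N := c₁ * a)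
    (by
      intro k _
      have e1 : ‖Complex.exp (2 * Real.pi * k * t * Complex.I)‖ = 1 := by
        have := Complex.norm_exp_ofReal_mul_I (2 * Real.pi * k * t)
        push_cast at this
        exact this
      simp only [hc']
      rw [norm_div, norm_mul, e1, mul_one, Complex.norm_real, Real.norm_of_nonneg hBpos.le,
        div_le_one hBpos]
      linarith [hc k])
    (by
      intro k hk
      rw [hs, Finset.mem_Icc] at hk
      have h1 : |(k : ℝ)| ≤ m := by
        rw [abs_le]; exact ⟨by exact_mod_cast hk.1, by exact_mod_cast hk.2⟩
      have h2 : (m : ℝ) ≤ a * e := by exact_mod_cast hm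
      have h3 : (e : ℝ) ≤ 2 ^ e := by exact_mod_cast Nat.lt_two_pow_self.le
      simp only [hμ]
      rw [abs_div, abs_of_pos (by positivity : (0 : ℝ) < 2 ^ e), div_le_iff₀ (by positivity)]
      push_cast
      have h4 : (a : ℝ) * e ≤ a * 2 ^ e := by gcongr
      have h5 : (0 : ℝ) ≤ a * 2 ^ e := by positivity
      linarith)
    (by
      have h1 : s.card = 2 * m + 1 := by rw [hs, Int.card_Icc]; omega
      rw [h1]
      have h2 : a * a ≤ 2 ^ a * 2 ^ a := Nat.mul_le_mul hlt.le hlt.le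
      have h3 : 2 ^ 4 ≤ 2 ^ a := Nat.pow_le_pow_right (by norm_num) (by omega)
      have h4 : (2 : ℕ) ^ (4 * a) = (2 ^ a * 2 ^ a) * (2 ^ a * 2 ^ a) := by
        rw [mul_comm, pow_mul]; ring
      have h5 : 16 * 16 ≤ 2 ^ a * 2 ^ a := Nat.mul_le_mul h3 h3
      have h6 : 2 * (2 * m + 1) ≤ 2 ^ (4 * a) := by rw [h4]; nlinarith
      exact_mod_cast h6)
    (Nat.le_mul_of_pos_left _ hc₀)
    (by
      rw [pow_mul, pow_mul, ← mul_pow]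
      refine pow_le_one₀ (mul_nonneg (by positivity) (pow_nonneg (by norm_num) _)) ?_
      calc (2 : ℝ) ^ 17 * (1 - 1 / 2 ^ 17) ^ c₁ ≤ 2 ^ 17 * (1 / 2 ^ 17) := by gcongr
        _ = 1 := by norm_num)
    hF1
  obtain ⟨α, β, δ, hq⟩ := exists_qspProd_of_polynomial hpdeg hp1 (η := 1 / 2 ^ m) (by positivity)
    (by rw [div_le_one (by positivity)]; exact one_le_pow₀ (by norm_num))
  refine ⟨α, β, δ, fun x hx => ?_⟩
  have hx4 : |x| ≤ 1 / 4 := by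
    refine hx.trans ?_
    rw [div_le_div_iff₀ (by positivity) (by norm_num), one_mul]
    calc (8 : ℝ) * 4 = 2 ^ 5 := by norm_num
      _ ≤ 2 ^ e := pow_le_pow_right₀ (by norm_num) (by omega)
  have hE := (hpx x hx4).trans (pow_error_le he hm hx)
  have hq' := hq x
  set z := Complex.exp (δ * Complex.I) * qspProd α β (-x / 2) (2 * (c₁ * a) + 4 * a) 0 0 with hz
  set v := p.eval (Complex.exp (x * Complex.I)) with hv
  set w := Complex.exp (((4 * a : ℕ) : ℝ) * x / 2 * Complex.I) with hw
  have hnw : ‖w‖ = 1 := by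
    have := Complex.norm_exp_ofReal_mul_I (((4 * a : ℕ) : ℝ) * x / 2)
    push_cast at this
    rw [hw]
    push_cast
    exact this
  set w₂ := Complex.exp (-((c₁ * a : ℕ) * x) * Complex.I) with hw₂
  have hnw₂ : ‖w₂‖ = 1 := by
    have := Complex.norm_exp_ofReal_mul_I (-((c₁ * a : ℕ) * x))
    push_cast at this
    rw [hw₂]
    push_cast
    exact this
  have hinv : w₂ * Complex.exp ((c₁ * a : ℕ) * x * Complex.I) = 1 := by
    rw [hw₂, ← Complex.exp_add, ← Complex.exp_zero]
    congr 1
    ring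
  -- Signal processing contributes exp(-irx/2) with r/2 = c₁a + 2a, whereas the polynomial carries
  -- only exp(i c₁ a x); the factor w supplies the missing phase of 2ax.
  have hphase : Complex.exp (-(((2 * (c₁ * a) + 4 * a : ℕ) : ℂ) * x / 2) * Complex.I) * w = w₂ := by
    rw [hw, hw₂, ← Complex.exp_add]
    congr 1
    push_cast
    ring
  have e1 : ‖z * w - w₂ * v‖ ≤ 1 / 2 ^ m := by
    rw [← hphase]
    have : z * w - Complex.exp (-(((2 * (c₁ * a) + 4 * a : ℕ) : ℂ) * x / 2) * Complex.I) * w * v =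
        (z - Complex.exp (-(((2 * (c₁ * a) + 4 * a : ℕ) : ℂ) * x / 2) * Complex.I) * v) * w := by
      ring
    rw [this, norm_mul, hnw, mul_one]
    exact hq'
  have e2 : ‖w₂ * v - F x‖ ≤ 2 / 2 ^ m := by
    have : w₂ * v - F x = w₂ * (v - Complex.exp ((c₁ * a : ℕ) * x * Complex.I) * F x) := by
      rw [mul_sub, ← mul_assoc, hinv, one_mul]
    rw [this, norm_mul, hnw₂, one_mul]
    exact hE
  -- In units of C/2^m the errors are 1 for the Fourier truncation, 1 for replacing B by G, 1 for
  -- the shrinking by η and 2 for the circle polynomial.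
  have e3 : (g (t + x / (2 * Real.pi * 2 ^ e)) : ℂ) - G * (z * w) =
      ((g (t + x / (2 * Real.pi * 2 ^ e)) : ℂ) - B * F x) + δ₀ * F x -
        G * ((z * w - w₂ * v) + (w₂ * v - F x)) := by
    rw [hB]; push_cast; ring
  rw [e3]
  refine (norm_sub_le _ _).trans ?_
  have f1 : ‖((g (t + x / (2 * Real.pi * 2 ^ e)) : ℂ) - B * F x) + δ₀ * F x‖ ≤ δ₀ + δ₀ := by
    refine (norm_add_le _ _).trans (add_le_add (hgF x) ?_)
    rw [norm_mul, Complex.norm_real, Real.norm_of_nonneg hδ.le]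
    exact mul_le_of_le_one_right hδ.le (hF1 x)
  have f2 : ‖(G : ℂ) * ((z * w - w₂ * v) + (w₂ * v - F x))‖ ≤ C * (1 / 2 ^ m + 2 / 2 ^ m) := by
    rw [norm_mul, Complex.norm_real, Real.norm_of_nonneg hG0]
    exact mul_le_mul hGC ((norm_add_le _ _).trans (add_le_add e1 e2)) (norm_nonneg _) hC.le
  have f3 : δ₀ + δ₀ + C * (1 / 2 ^ m + 2 / 2 ^ m) = 5 * C / 2 ^ m := by rw [hδ₀]; ring
  linarith
-- The parity register
section ParityRegister

variable {Q : Type} [Fintype Q] [DecidableEq Q] {κ : ℕ}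

/-- An enumeration of the sets of `κ` bits. -/
noncomputable def subsetIndex (κ : ℕ) : Finset (Fin κ) ≃ Fin (2 ^ κ) :=
  Fintype.equivFinOfCardEq (by simp)

/-- CNOT gates computing all parities of the bits `v` into the register `par`. -/
noncomputable def parityCnots (v : Fin κ → Q) (par : ℕ → Q) (h : ∀ i j, v i ≠ par j) :
    List {p : Q × Q // p.1 ≠ p.2} :=
  ((Finset.univ : Finset (Finset (Fin κ) × Fin κ)).filter fun p => p.2 ∈ p.1).toList.map
    fun p => ⟨(v p.2, par (subsetIndex κ p.1)), h _ _⟩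

omit [Fintype Q] [DecidableEq Q] in
theorem length_parityCnots_le (v : Fin κ → Q) (par : ℕ → Q) (h : ∀ i j, v i ≠ par j) :
    (parityCnots v par h).length ≤ κ * 2 ^ κ := by
  rw [parityCnots, List.length_map, Finset.length_toList]
  refine (Finset.card_le_univ _).trans ?_
  simp [mul_comm]

omit [Fintype Q] [DecidableEq Q] in
theorem exists_of_mem_parityCnots {v : Fin κ → Q} {par : ℕ → Q} {h : ∀ i j, v i ≠ par j}
    {p : {p : Q × Q // p.1 ≠ p.2}} (hp : p ∈ parityCnots v par h) :
    ∃ i, ∃ j < 2 ^ κ, p.1 = (v i, par j) := by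
  rw [parityCnots, List.mem_map] at hp
  obtain ⟨a, _, rfl⟩ := hp
  exact ⟨a.2, _, (subsetIndex κ a.1).2, rfl⟩

omit [Fintype Q] in
theorem cnotShift_parityCnots_of_ne {v : Fin κ → Q} {par : ℕ → Q} (h : ∀ i j, v i ≠ par j)
    (w : Q → Fin 2) {q : Q} (hq : ∀ j < 2 ^ κ, par j ≠ q) :
    cnotShift (parityCnots v par h) w q = 0 := by
  apply List.sum_eq_zero
  intro x hx
  rw [List.mem_map] at hx
  obtain ⟨p, hp, rfl⟩ := hx
  obtain ⟨i, j, hj, hij⟩ := exists_of_mem_parityCnots hp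
  rw [hij]
  exact if_neg (hq j hj)

-- Since `par` is injective on the register, only the gates listed for S itself hit the qubit of
-- index S.
omit [Fintype Q] in
theorem cnotShift_parityCnots {v : Fin κ → Q} {par : ℕ → Q} (h : ∀ i j, v i ≠ par j)
    (hpar : Set.InjOn par (Set.Iio (2 ^ κ))) (w : Q → Fin 2) (S : Finset (Fin κ)) :
    cnotShift (parityCnots v par h) w (par (subsetIndex κ S)) = ∑ i ∈ S, w (v i) := by
  have h1 : ∀ S' : Finset (Fin κ), par (subsetIndex κ S') = par (subsetIndex κ S) ↔ S' = S := by
    intro S'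
    refine ⟨fun h2 => (subsetIndex κ).injective (Fin.ext ?_), fun h2 => by rw [h2]⟩
    exact hpar (subsetIndex κ S').2 (subsetIndex κ S).2 h2
  rw [cnotShift, parityCnots, List.map_map]
  simp only [Function.comp_def, h1]
  rw [Finset.sum_map_toList, Finset.sum_filter, Fintype.sum_prod_type]
  rw [Finset.sum_eq_single S]
  · simp
  · intro S' _ hS'
    simp [hS']
  · intro h2; exact absurd (Finset.mem_univ _) h2

variable {X : Type*} {s : ℕ}

/-- Rotations by an arbitrary function of `κ` bits plus a linear function of the register `dat`. -/
theorem Impl.zRot_parity_add_linear {cp par dat : ℕ → Q} {v : Fin κ → Q} {w w' : X → Q → Fin 2}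
    (hcp : Set.InjOn cp (Set.Iio (2 ^ s))) (hpar : Set.InjOn par (Set.Iio (2 ^ κ)))
    {ℓ : ℕ} (hdat : Set.InjOn dat (Set.Iio ℓ))
    (hcpar : ∀ i < 2 ^ s, ∀ j < 2 ^ κ, cp i ≠ par j) (hcdat : ∀ i < 2 ^ s, ∀ j < ℓ, cp i ≠ dat j)
    (hκ : κ ≤ s) {ρ : ℕ} (hρ : ℓ ≤ ρ * 2 ^ s) (hw : ∀ x, ∀ j < 2 ^ s, w' x (cp j) = 0)
    (hwpar : ∀ x S, w' x (par (subsetIndex κ S)) = ∑ i ∈ S, w x (v i))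
    (hwdat : ∀ x j, w' x (dat j) = w x (dat j)) (f : (Fin κ → Fin 2) → ℝ) (θ : ℕ → ℝ) :
    Impl (fun x b => fan cp 0 b (w' x))
      (fun x => zRot (f (fun i => w x (v i)) + ∑ q ∈ Finset.range ℓ, θ q * sgn (w x (dat q))))
      (4 * s + ρ + 1) (4 * 2 ^ s + ℓ + 2 ^ κ) := by
  obtain ⟨c, hc⟩ := exists_walsh f
  -- The Walsh coefficients are the angles of a linear phase on the parity register; one round
  -- suffices because 2^κ ≤ 2^s.
  have h1 := Impl.zRot_register hcp hpar hcpar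
    (fun j => if hj : j < 2 ^ κ then c ((subsetIndex κ).symm ⟨j, hj⟩) else 0) 1
    (by rw [one_mul]; exact Nat.pow_le_pow_right (by norm_num) hκ) w' hw
  have h2 := Impl.zRot_register hcp hdat hcdat θ ρ hρ w' hw
  have h3 : ∀ x, ∑ q ∈ Finset.range (2 ^ κ),
      (if hj : q < 2 ^ κ then c ((subsetIndex κ).symm ⟨q, hj⟩) else 0) * sgn (w' x (par q)) =
        f (fun i => w x (v i)) := by
    intro x
    rw [hc, Finset.sum_range, ← (subsetIndex κ).sum_comp]
    refine Finset.sum_congr rfl fun S _ => ?_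
    rw [dif_pos (subsetIndex κ S).2, hwpar, sgn_sum]
    simp
  have h4 := h1.mul h2
  simp only [h3, hwdat, ← zRot_add] at h4
  exact h4.mono (by omega) (by omega)

end ParityRegister

/-! ### Binary digits of the grid points -/

section Digits

/-- The partial binary expansion with the digits `b q` at positions `q + 1`, `q ∈ s`. -/
noncomputable def binSum (s : Finset ℕ) (b : ℕ → Fin 2) : ℝ :=
  ∑ q ∈ s, ((b q : ℕ) : ℝ) / 2 ^ (q + 1)

theorem binSum_nonneg (s : Finset ℕ) (b : ℕ → Fin 2) : 0 ≤ binSum s b :=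
  Finset.sum_nonneg fun _ _ => by positivity

theorem binSum_Ico_le {k l : ℕ} (h : k ≤ l) (b : ℕ → Fin 2) :
    binSum (Finset.Ico k l) b ≤ 1 / 2 ^ k - 1 / 2 ^ l := by
  induction l, h using Nat.le_induction with
  | base => simp [binSum]
  | succ l hl ih =>
    rw [binSum, Finset.sum_Ico_succ_top hl]
    have h1 : ((b l : ℕ) : ℝ) ≤ 1 := by exact_mod_cast (by omega : (b l : ℕ) ≤ 1)
    have h2 : ((b l : ℕ) : ℝ) / 2 ^ (l + 1) ≤ 1 / 2 ^ (l + 1) := by gcongr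
    have h3 : (1 : ℝ) / 2 ^ l = 1 / 2 ^ (l + 1) + 1 / 2 ^ (l + 1) := by
      rw [pow_succ]; field_simp; norm_num
    unfold binSum at ih
    linarith

theorem binSum_range_add {k l : ℕ} (h : k ≤ l) (b : ℕ → Fin 2) :
    binSum (Finset.range l) b = binSum (Finset.range k) b + binSum (Finset.Ico k l) b :=
  (Finset.sum_range_add_sum_Ico _ h).symm

theorem bit_eq_sgn (b : Fin 2) : ((b : ℕ) : ℝ) = (1 - sgn b) / 2 := by
  fin_cases b <;> norm_num [sgn]

/-- A bit is (1 - sign)/2, so a multiple of a binary expansion is a constant plus a linear form in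
signs, the shape that ZZ rotations realise. -/
theorem mul_binSum_Ico (c : ℝ) (k l : ℕ) (b : ℕ → Fin 2) :
    c * binSum (Finset.Ico k l) b = (∑ q ∈ Finset.Ico k l, c / 2 ^ (q + 2)) +
      ∑ q ∈ Finset.range l, (if k ≤ q then -(c / 2 ^ (q + 2)) else 0) * sgn (b q) := by
  have h1 : ∑ q ∈ Finset.range l, (if k ≤ q then -(c / 2 ^ (q + 2)) else 0) * sgn (b q) =
      ∑ q ∈ Finset.Ico k l, -(c / 2 ^ (q + 2)) * sgn (b q) := by
    simp only [ite_mul, zero_mul]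
    rw [← Finset.sum_filter]
    refine Finset.sum_congr ?_ fun _ _ => rfl
    ext q
    simp only [Finset.mem_filter, Finset.mem_range, Finset.mem_Ico]
    omega
  rw [h1, ← Finset.sum_add_distrib, binSum, Finset.mul_sum]
  refine Finset.sum_congr rfl fun q _ => ?_
  rw [bit_eq_sgn, pow_succ 2 (q + 1)]
  field_simp
  ring

/-- The bit of `x` with weight `2 ^ (-(q + 1))`. -/
def msb {n : ℕ} (hn : 1 ≤ n) (x : Fin n → Fin 2) (q : ℕ) : Fin 2 := x ⟨n - 1 - q, by omega⟩

theorem binSum_msb {n : ℕ} (hn : 1 ≤ n) (x : Fin n → Fin 2) :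
    (((finFunctionFinEquiv x : Fin (2 ^ n)) : ℕ) : ℝ) / 2 ^ n =
      binSum (Finset.range n) (msb hn x) := by
  have h1 : (((finFunctionFinEquiv x : Fin (2 ^ n)) : ℕ) : ℝ) =
      ∑ i ∈ Finset.range n, ((x ⟨i % n, Nat.mod_lt _ hn⟩ : ℕ) : ℝ) * 2 ^ i := by
    rw [finFunctionFinEquiv_apply, Finset.sum_range]
    push_cast
    refine Finset.sum_congr rfl fun i _ => ?_
    congr 4
    exact Fin.ext (Nat.mod_eq_of_lt i.2).symm
  rw [h1, ← Finset.sum_range_reflect, Finset.sum_div, binSum]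
  refine Finset.sum_congr rfl fun q hq => ?_
  rw [Finset.mem_range] at hq
  have h2 : n - 1 - q + (q + 1) = n := by omega
  have h3 : (2 : ℝ) ^ n = 2 ^ (n - 1 - q) * 2 ^ (q + 1) := by rw [← pow_add, h2]
  have h4 : x ⟨(n - 1 - q) % n, Nat.mod_lt _ hn⟩ = msb hn x q := by
    unfold msb
    congr 1
    exact Fin.ext (Nat.mod_eq_of_lt (by omega))
  rw [h4, h3]
  field_simp

end Digits
-- Assembly of the circuit
theorem mul_zRot_apply_zero (A : Matrix (Fin 2) (Fin 2) ℂ) (b : ℝ) :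
    (A * zRot b) 0 0 = A 0 0 * Complex.exp (b * Complex.I) := by
  simp [Matrix.mul_apply, zRot]

/-- One circuit serves all nodes: the node-dependent angles are functions of the top 2e bits and are
read from the parity register, and the signal angle is linear in the remaining bits. Dropping the
bits beyond n' costs C/2^n' by the Lipschitz bound. -/
theorem exists_blockEncoding_of_family {n : ℕ} (hn : 1 ≤ n) {g : ℝ → ℝ} {G C η ε : ℝ}
    {e r T n' ρ : ℕ} (hnn : n' ≤ n) (hen : 2 * e ≤ n') (hanc : 2 ^ (4 * e) + 2 ^ (2 * e) ≤ n)
    (hρ : n' ≤ ρ * 2 ^ (4 * e)) (hC : 0 ≤ C) (hlip : ∀ x y, |g x - g y| ≤ C * |x - y|)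
    (hη : 0 ≤ η) (hε : η ≤ ε) (hε' : n' < n → η + C / 2 ^ n' ≤ ε)
    (hfam : ∀ t : ℝ, ∃ (α β : ℕ → ℝ) (δ : ℝ), ∀ x : ℝ, |x| ≤ 8 / 2 ^ e →
      ‖(g (t + x / (2 * Real.pi * 2 ^ e)) : ℂ) - G *
        (Complex.exp (δ * Complex.I) * qspProd α β (-x / 2) r 0 0 *
          Complex.exp ((T : ℝ) * x / 2 * Complex.I))‖ ≤ η) :
    ∃ c : QCircuit (Fin n ⊕ Fin n), IsBlockEncoding G n ε c.toOp (diagOp n g) ∧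
      c.depth ≤ 4 * e * 4 ^ e + (r + 2) * (3 * (16 * e + ρ + 1) + 2) ∧
      c.size ≤ 4 * e * 4 ^ e + (r + 2) * (3 * (4 * 16 ^ e + n' + 4 ^ e) + 2) := by
  choose α β δ hfam using hfam
  set κ := 2 * e with hκ
  set s := 4 * e with hs
  -- The ancillas hold 2^(4e) fan-out copies followed by 2^(2e) parities. The remainders modulo n
  -- only make the indexing total; `hanc` makes them trivial on the indices used.
  let cp : ℕ → Fin n ⊕ Fin n := fun j => Sum.inl ⟨j % n, Nat.mod_lt _ hn⟩
  let par : ℕ → Fin n ⊕ Fin n := fun j => Sum.inl ⟨(2 ^ s + j) % n, Nat.mod_lt _ hn⟩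
  let dat : ℕ → Fin n ⊕ Fin n := fun q => Sum.inr ⟨n - 1 - q, by omega⟩
  let v : Fin κ → Fin n ⊕ Fin n := fun i => dat i
  have hκpos : 0 < 2 ^ κ := by positivity
  have hcp : Set.InjOn cp (Set.Iio (2 ^ s)) := by
    intro i hi j hj h
    rw [Set.mem_Iio] at hi hj
    have h1 := congrArg Fin.val (Sum.inl.inj h)
    simpa [Nat.mod_eq_of_lt (by omega : i < n), Nat.mod_eq_of_lt (by omega : j < n)] using h1
  have hpar : Set.InjOn par (Set.Iio (2 ^ κ)) := by
    intro i hi j hj h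
    rw [Set.mem_Iio] at hi hj
    have h1 := congrArg Fin.val (Sum.inl.inj h)
    simpa [Nat.mod_eq_of_lt (by omega : 2 ^ s + i < n),
      Nat.mod_eq_of_lt (by omega : 2 ^ s + j < n)] using h1
  have hcpar : ∀ i < 2 ^ s, ∀ j < 2 ^ κ, cp i ≠ par j := by
    intro i hi j hj h
    have h1 := congrArg Fin.val (Sum.inl.inj h)
    simp only [Nat.mod_eq_of_lt (by omega : i < n),
      Nat.mod_eq_of_lt (by omega : 2 ^ s + j < n)] at h1
    omega
  have hdat : Set.InjOn dat (Set.Iio n') := by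
    intro i hi j hj h
    rw [Set.mem_Iio] at hi hj
    have h1 := congrArg Fin.val (Sum.inr.inj h)
    simp only at h1
    omega
  have hvpar : ∀ i j, v i ≠ par j := fun i j h => by cases h
  set l := parityCnots v par hvpar with hl
  let w : (Fin n → Fin 2) → Fin n ⊕ Fin n → Fin 2 := dataState
  let w' : (Fin n → Fin 2) → Fin n ⊕ Fin n → Fin 2 := fun x q => w x q + cnotShift l (w x) q
  have hwdat : ∀ x j, w' x (dat j) = w x (dat j) := by
    intro x j
    simp only [w']
    rw [cnotShift_parityCnots_of_ne hvpar (w x) (q := dat j) (fun _ _ h => by cases h), add_zero]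
  have hw : ∀ x, ∀ j < 2 ^ s, w' x (cp j) = 0 := by
    intro x j hj
    simp only [w']
    rw [cnotShift_parityCnots_of_ne hvpar (w x) (q := cp j)
      (fun k hk => (hcpar j hj k hk).symm), add_zero]
    rfl
  have hwpar : ∀ x S, w' x (par (subsetIndex κ S)) = ∑ i ∈ S, w x (v i) := by
    intro x S
    simp only [w']
    rw [cnotShift_parityCnots hvpar hpar (w x) S]
    exact zero_add _
  have hbit : ∀ x q, w x (dat q) = msb hn x q := fun x q => rfl
  have key := fun f θ => Impl.zRot_parity_add_linear (X := Fin n → Fin 2) (v := v) (w := w)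
    hcp hpar hdat hcpar (fun i _ j _ h => by cases h) (by omega : κ ≤ s) hρ hw hwpar hwdat f θ
  -- the data bits split as a node `t` and an offset `y`
  let t : (Fin κ → Fin 2) → ℝ := fun z => ∑ i : Fin κ, ((z i : ℕ) : ℝ) / 2 ^ ((i : ℕ) + 1)
  have ht : ∀ x, t (fun i => w x (v i)) = binSum (Finset.range κ) (msb hn x) := by
    intro x
    rw [binSum, Finset.sum_range]
    rfl
  -- The offset is at most 2^(-2e); after stretching by 2π·2^e it is still at most 8/2^e.
  let y : (Fin n → Fin 2) → ℝ := fun x => 2 * Real.pi * 2 ^ e * binSum (Finset.Ico κ n') (msb hn x)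
  have hrot : ∀ (f : (Fin κ → Fin 2) → ℝ) (c : ℝ),
      Impl (fun x b => fan cp 0 b (w' x)) (fun x => zRot (f (fun i => w x (v i)) + c * y x))
        (4 * s + ρ + 1) (4 * 2 ^ s + n' + 2 ^ κ) := by
    intro f c
    -- The constant part of the signed expansion of the offset is absorbed into f, and the linear
    -- angles of the node bits are zero.
    have h1 := key (fun z => f z + ∑ q ∈ Finset.Ico κ n', c * (2 * Real.pi * 2 ^ e) / 2 ^ (q + 2))
      (fun q => if κ ≤ q then -(c * (2 * Real.pi * 2 ^ e) / 2 ^ (q + 2)) else 0)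
    simp only [hbit] at h1 ⊢
    have h2 : ∀ x, f (fun i => w x (v i)) + c * y x = (f (fun i => w x (v i)) +
        ∑ q ∈ Finset.Ico κ n', c * (2 * Real.pi * 2 ^ e) / 2 ^ (q + 2)) +
        ∑ q ∈ Finset.range n', (if κ ≤ q then -(c * (2 * Real.pi * 2 ^ e) / 2 ^ (q + 2)) else 0) *
          sgn (msb hn x q) := by
      intro x
      rw [add_assoc, ← mul_binSum_Ico, ← mul_assoc]
    simp only [h2]
    exact h1
  have hrot0 : ∀ f : (Fin κ → Fin 2) → ℝ,
      Impl (fun x b => fan cp 0 b (w' x)) (fun x => zRot (f (fun i => w x (v i))))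
        (4 * s + ρ + 1) (4 * 2 ^ s + n' + 2 ^ κ) := by
    intro f
    simpa using hrot f 0
  have hrot1 : Impl (fun x b => fan cp 0 b (w' x)) (fun x => zRot (-(y x) / 2))
      (4 * s + ρ + 1) (4 * 2 ^ s + n' + 2 ^ κ) := by
    have h1 := hrot (fun _ => 0) (-(1 / 2))
    have h2 : ∀ x, 0 + -(1 / 2) * y x = -(y x) / 2 := fun x => by ring
    simpa only [h2] using h1
  -- The last rotation supplies both the global phase δ of the node and the correcting phase Ty/2,
  -- as it multiplies the (0,0) entry by their exponential.
  have hqsp := (Impl.qspProd (fun i => hrot0 fun z => α (t z) i) (fun i => hrot0 fun z => β (t z) i)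
    hrot1 r).mul (hrot (fun z => δ (t z)) (T / 2))
  have hlmem : ∀ p ∈ l, ∃ i, ∃ j < 2 ^ κ, p.1 = (v i, par j) :=
    fun p hp => exists_of_mem_parityCnots hp
  have hpos : 0 < 2 ^ s := by positivity
  have hseq := cnotSeq_fan (cp := cp) l
    (by
      intro p hp q hq
      obtain ⟨i, j, -, h1⟩ := hlmem p hp
      obtain ⟨i', j', -, h2⟩ := hlmem q hq
      rw [h1, h2]
      exact hvpar i j')
    (by
      intro p hp
      obtain ⟨i, j, -, h1⟩ := hlmem p hp
      rw [h1]
      exact fun h => by cases h)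
    (by
      intro p hp
      obtain ⟨i, j, hj, h1⟩ := hlmem p hp
      rw [h1]
      exact (hcpar 0 hpos j hj).symm)
  have himpl := Impl.conj (e := fun x b => fan cp 0 b (dataState x)) (cnotSeq l)
    (fun x b => (hseq b (w x)).1) (fun x b => (hseq b (w x)).2) hqsp
  rw [cnotSeq_length, gateCount_cnotSeq] at himpl
  have hlen : l.length ≤ κ * 2 ^ κ := length_parityCnots_le v par hvpar
  have e1 : 2 ^ κ = 4 ^ e := by rw [hκ, pow_mul]; norm_num
  have e2 : 2 ^ s = 16 ^ e := by rw [hs, pow_mul]; norm_num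
  obtain ⟨c, hc, hd, hsz⟩ := exists_blockEncoding_of_impl (i := ⟨0 % n, Nat.mod_lt _ hn⟩) rfl himpl
    (g := g) (α := G) (ε := ε) (hη.trans hε) (by
      intro x
      rw [mul_zRot_apply_zero]
      simp only [ht]
      set t₀ := binSum (Finset.range κ) (msb hn x) with ht₀
      have hy0 : 0 ≤ y x := mul_nonneg (by positivity) (binSum_nonneg _ _)
      have hy1 : |y x| ≤ 8 / 2 ^ e := by
        rw [abs_of_nonneg hy0]
        have h1 : binSum (Finset.Ico κ n') (msb hn x) ≤ 1 / 2 ^ κ := by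
          have := binSum_Ico_le hen (msb hn x)
          have h2 : (0 : ℝ) < 1 / 2 ^ n' := by positivity
          linarith
        have h3 : (2 : ℝ) ^ κ = 2 ^ e * 2 ^ e := by rw [hκ, two_mul, pow_add]
        calc y x ≤ 2 * Real.pi * 2 ^ e * (1 / 2 ^ κ) := by
              exact mul_le_mul_of_nonneg_left h1 (by positivity)
          _ = 2 * Real.pi / 2 ^ e := by rw [h3]; field_simp
          _ ≤ 8 / 2 ^ e := by
            gcongr
            linarith [Real.pi_le_four]
      have hpt := hfam t₀ (y x) hy1
      have h1 : t₀ + y x / (2 * Real.pi * 2 ^ e) = binSum (Finset.range n') (msb hn x) := by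
        rw [binSum_range_add hen]
        congr 1
        exact mul_div_cancel_left₀ _ (by positivity)
      have h2 : qspProd (α t₀) (β t₀) (-(y x) / 2) r 0 0 *
          Complex.exp (((δ t₀ + (T : ℝ) / 2 * y x : ℝ) : ℂ) * Complex.I) =
          Complex.exp (δ t₀ * Complex.I) * qspProd (α t₀) (β t₀) (-(y x) / 2) r 0 0 *
            Complex.exp ((T : ℝ) * (y x) / 2 * Complex.I) := by
        have h3 : ((δ t₀ + (T : ℝ) / 2 * y x : ℝ) : ℂ) * Complex.I =
            δ t₀ * Complex.I + (T : ℝ) * (y x) / 2 * Complex.I := by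
          push_cast; ring
        rw [h3, Complex.exp_add]
        ring
      rw [h2]
      rw [h1] at hpt
      rw [binSum_msb hn]
      rcases hnn.eq_or_lt with h4 | h4
      · rw [h4] at hpt
        exact hpt.trans hε
      · refine le_trans ?_ (hε' h4)
        refine (norm_sub_le_norm_sub_add_norm_sub _
          ((g (binSum (Finset.range n') (msb hn x)) : ℝ) : ℂ) _).trans ?_
        rw [add_comm]
        refine add_le_add hpt ?_
        rw [← Complex.ofReal_sub, Complex.norm_real, Real.norm_eq_abs]
        refine (hlip _ _).trans ?_
        rw [div_eq_mul_one_div]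
        refine mul_le_mul_of_nonneg_left ?_ hC
        rw [binSum_range_add hnn, add_sub_cancel_left, abs_of_nonneg (binSum_nonneg _ _)]
        have h5 := binSum_Ico_le hnn (msb hn x)
        have h6 : (0 : ℝ) < 1 / 2 ^ n := by positivity
        linarith)
  rw [e1] at hlen
  rw [e1, e2] at hsz
  have e3 : κ * 4 ^ e = 2 * (e * 4 ^ e) := by rw [hκ, mul_assoc]
  refine ⟨c, hc, hd.trans ?_, hsz.trans ?_⟩
  · have h5 : 4 * s = 16 * e := by omega
    rw [h5, add_mul r 2, add_mul r 1, mul_assoc 4]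
    omega
  · rw [add_mul r 2, add_mul r 1, mul_assoc 4 e]
    omega
-- Choice of the parameters
theorem exists_blockEncoding_of_large {C R : ℝ} (hC : 0 < C) (hR : 1 < R) {g : ℝ → ℝ}
    (hp : Function.Periodic g 1) (hg : ContDiff ℝ ⊤ g)
    (hb : ∀ M : ℕ, supNorm01 (iteratedDeriv M g) ≤ C * (M ! : ℝ) / R ^ M) {c₁ m n : ℕ}
    (hc₀ : 1 ≤ c₁) (hc₁ : (1 - 1 / 2 ^ 17 : ℝ) ^ c₁ ≤ 1 / 2 ^ 17)
    (hm : 4 * 16 ^ (c₁ + 8) ≤ m) (hn : 4 * 16 ^ (c₁ + 8) ≤ n) :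
    ∃ c : QCircuit (Fin n ⊕ Fin n),
      IsBlockEncoding (supNorm01 g) n (6 * C / 2 ^ m) c.toOp (diagOp n g) ∧
      c.depth ≤ (4 + (2 * c₁ + 6) * 490) * m ∧ c.size ≤ (4 + (2 * c₁ + 6) * 490) * m * n := by
  have hn' : 4 * 16 ^ (c₁ + 8) ≤ min n m := le_min hn hm
  have hle : min n m ≤ n := min_le_left _ _
  have hlem : min n m ≤ m := min_le_right _ _
  have hcases : min n m = n ∨ min n m = m := min_choice n m
  generalize min n m = n' at hn' hle hlem hcases
  have hpos : 0 < 16 ^ (c₁ + 8) := by positivity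
  have hdiv : 16 ^ (c₁ + 8) ≤ n' / 4 := by omega
  -- Then 16^e ≤ n'/4 < 16^(e+1): the copies and the parities fit into the ancillas, and the kept
  -- bits number at most 64·16^e, so 64 rounds suffice. The size assumption forces e ≥ c₁ + 8.
  set e := Nat.log 16 (n' / 4) with he
  have he1 : c₁ + 8 ≤ e := Nat.le_log_of_pow_le (by norm_num) hdiv
  have he2 : 16 ^ e ≤ n' / 4 := Nat.pow_log_le_self 16 (by omega)
  have he3 : n' / 4 < 16 ^ (e + 1) := Nat.lt_pow_succ_log_self (by norm_num) _
  have he4 : e < 4 ^ e := Nat.lt_pow_self (by norm_num)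
  have he5 : 16 ^ e = 4 ^ e * 4 ^ e := by rw [← mul_pow]; norm_num
  have he6 : e * 4 ^ e ≤ 16 ^ e := by rw [he5]; exact Nat.mul_le_mul_right _ he4.le
  have he7 : e * e ≤ 16 ^ e := by rw [he5]; exact Nat.mul_le_mul he4.le he4.le
  have he8 : 4 ^ e ≤ 16 ^ e := Nat.pow_le_pow_left (by norm_num) e
  have hpe : 2 ^ (4 * e) = 16 ^ e := by rw [pow_mul]; norm_num
  have hpe' : 2 ^ (2 * e) = 4 ^ e := by rw [pow_mul]; norm_num
  rw [pow_succ] at he3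
  have hepos : 0 < e := by omega
  -- This rounds m/e up far enough for ae ≥ m, while ae ≤ 2m keeps the product of the number of
  -- rotations and the depth of each linear in m.
  set a := m / e + 1 with ha
  have ha1 : m ≤ a * e := by
    rw [mul_comm]
    exact (Nat.lt_mul_div_succ m hepos).le
  have ha2 : e ≤ a := by
    have : e ≤ m / e := (Nat.le_div_iff_mul_le hepos).2 (by omega)
    omega
  have ha3 : a * e ≤ 2 * m := by
    have h1 := Nat.div_mul_le_self m e
    have h2 : e ≤ e * e := Nat.le_mul_self e
    rw [ha, Nat.succ_mul]
    omega
  have ha4 : a ≤ 2 * m := (Nat.le_mul_of_pos_right a hepos).trans ha3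
  have hη : 5 * C / 2 ^ m ≤ 6 * C / 2 ^ m := by gcongr; norm_num
  obtain ⟨c, hc, hd, hs⟩ := exists_blockEncoding_of_family (n := n) (by omega) (n' := n') (e := e)
    (ρ := 64) (T := 4 * a) hle (by omega) (by rw [hpe, hpe']; omega) (by rw [hpe]; omega) hC.le
    (abs_sub_le_of_deriv_bound hC hR hp hg hb) (by positivity) hη (by
      intro hlt
      have h1 : n' = m := hcases.resolve_left hlt.ne
      rw [h1]
      apply le_of_eq
      ring)
    (exists_qsp_family hC hR hp hg hb hc₀ hc₁ he1 ha1 ha2)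
  refine ⟨c, hc, hd.trans ?_, hs.trans ?_⟩
  · have h1 : 2 * (c₁ * a) + 4 * a + 2 ≤ (2 * c₁ + 6) * a := by
      have : 2 * (c₁ * a) + 4 * a + 2 * a = (2 * c₁ + 6) * a := by ring
      omega
    -- The left side is 48e + 197, and e ≥ 1.
    have h2 : 3 * (16 * e + 64 + 1) + 2 ≤ 245 * e := by omega
    calc 4 * e * 4 ^ e + (2 * (c₁ * a) + 4 * a + 2) * (3 * (16 * e + 64 + 1) + 2)
        ≤ 4 * m + ((2 * c₁ + 6) * a) * (245 * e) := by
          refine add_le_add ?_ (Nat.mul_le_mul h1 h2)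
          rw [mul_assoc]
          omega
      _ = 4 * m + (2 * c₁ + 6) * 245 * (a * e) := by ring
      _ ≤ 4 * m + (2 * c₁ + 6) * 245 * (2 * m) := by gcongr
      _ = (4 + (2 * c₁ + 6) * 490) * m := by ring
  · have h1 : 2 * (c₁ * a) + 4 * a + 2 ≤ (2 * c₁ + 6) * a := by
      have : 2 * (c₁ * a) + 4 * a + 2 * a = (2 * c₁ + 6) * a := by ring
      omega
    have h2 : 3 * (4 * 16 ^ e + n' + 4 ^ e) + 2 ≤ 245 * n := by omega
    calc 4 * e * 4 ^ e + (2 * (c₁ * a) + 4 * a + 2) * (3 * (4 * 16 ^ e + n' + 4 ^ e) + 2)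
        ≤ 4 * (m * n) + ((2 * c₁ + 6) * a) * (245 * n) := by
          refine add_le_add ?_ (Nat.mul_le_mul h1 h2)
          rw [mul_assoc]
          have : m ≤ m * n := Nat.le_mul_of_pos_right m (by omega)
          omega
      _ = 4 * (m * n) + (2 * c₁ + 6) * 245 * (a * n) := by ring
      _ ≤ 4 * (m * n) + (2 * c₁ + 6) * 245 * (2 * m * n) := by gcongr
      _ = (4 + (2 * c₁ + 6) * 490) * m * n := by ring

theorem exists_precision {C A L ε : ℝ} (hC : 0 < C) (hA : 2 + 24 * C ≤ A) (hL : 1 / 2 ≤ L)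
    (hε : 0 < ε) (hLε : L = Real.log (1 / ε)) {m : ℕ} (hm : A * L ≤ m) : 6 * C / 2 ^ m ≤ ε := by
  have h1 : Real.exp (m / 2) ≤ 2 ^ m := by
    rw [← Real.rpow_natCast, Real.rpow_def_of_pos (by norm_num), Real.exp_le_exp]
    nlinarith [Real.log_two_gt_d9, (Nat.cast_nonneg m : (0 : ℝ) ≤ m)]
  -- From L ≥ 1/2 one gets 24CL ≥ 12C, which pays for the constant 6C in the error.
  have h2 : L + 6 * C ≤ m / 2 := by nlinarith
  have h3 : Real.exp L = 1 / ε := by rw [hLε, Real.exp_log (by positivity)]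
  have h4 : 1 / ε * (6 * C) ≤ 2 ^ m := by
    calc 1 / ε * (6 * C) ≤ Real.exp L * Real.exp (6 * C) := by
          rw [h3]
          gcongr
          linarith [Real.add_one_le_exp (6 * C)]
      _ = Real.exp (L + 6 * C) := (Real.exp_add _ _).symm
      _ ≤ Real.exp (m / 2) := Real.exp_le_exp.2 h2
      _ ≤ 2 ^ m := h1
  rw [div_le_iff₀ (by positivity)]
  rw [div_mul_eq_mul_div, one_mul, div_le_iff₀ hε] at h4
  linarith

theorem mainTheorem5 (C R : ℝ) (hC : 0 < C) (hR : 1 < R) :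
    ∃ K : ℝ, 0 < K ∧ ∀ (n : ℕ), 1 ≤ n → ∀ g : ℝ → ℝ,
      Function.Periodic g 1 → AnalyticOnNhd ℝ g Set.univ →
      (∀ M : ℕ, supNorm01 (iteratedDeriv M g) ≤ C * (M ! : ℝ) / R ^ M) →
      ∀ ε : ℝ, 0 < ε → ε ≤ 1 / 2 →
        ∃ c : QCircuit (Fin n ⊕ Fin n),
          IsBlockEncoding (supNorm01 g) n ε c.toOp (diagOp n g) ∧
          (c.depth : ℝ) ≤ K * Real.log (1 / ε) ∧
          (c.size : ℝ) ≤ K * n * Real.log (1 / ε) := by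
  obtain ⟨c₀, hc₀⟩ := exists_pow_lt_of_lt_one (by positivity : (0 : ℝ) < 1 / 2 ^ 17)
    (by norm_num : (1 - 1 / 2 ^ 17 : ℝ) < 1)
  have hc₁ : (1 - 1 / 2 ^ 17 : ℝ) ^ (c₀ + 1) ≤ 1 / 2 ^ 17 :=
    (pow_le_pow_of_le_one (by norm_num) (by norm_num) (Nat.le_succ c₀)).trans hc₀.le
  generalize hc : c₀ + 1 = c₁ at hc₁
  set n₀ : ℕ := 4 * 16 ^ (c₁ + 8) with hn₀
  set B : ℕ := 2 ^ n₀ * (2 * n₀ + 1) + 2 with hB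
  set D : ℕ := 4 + (2 * c₁ + 6) * 490 with hD
  -- As L ≥ 1/2, the summand 2n₀ guarantees m ≥ n₀; the rest is what `exists_precision` asks for.
  set A : ℝ := 2 * n₀ + (2 + 24 * C) with hA
  have hApos : 0 < A := by positivity
  -- The term 2B covers the exact circuits for n < n₀, since 2L ≥ 1. The other term is the linear
  -- bound in m ≤ AL + 1 ≤ (A + 2)L.
  refine ⟨2 * B + D * (A + 2), by positivity, fun n hn g hp hg hb ε hε hε2 => ?_⟩
  have hg' : ContDiff ℝ ⊤ g := hg.contDiff
  have hL : 1 / 2 ≤ Real.log (1 / ε) := by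
    have h1 : (2 : ℝ) ≤ 1 / ε := by rw [le_div_iff₀ hε]; linarith
    linarith [Real.log_le_log (by norm_num) h1, Real.log_two_gt_d9]
  set L := Real.log (1 / ε) with hLdef
  have hn1 : (1 : ℝ) ≤ n := by exact_mod_cast hn
  have hLpos : 0 < L := by linarith
  have hnL : L ≤ n * L := le_mul_of_one_le_left hLpos.le hn1
  have hBL : (B : ℝ) ≤ 2 * B * L := by
    have : (0 : ℝ) ≤ B := Nat.cast_nonneg B
    nlinarith
  by_cases hsmall : n < n₀
  · obtain ⟨c, h1, h2, h3⟩ := exists_exact_blockEncoding hn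
      (le_supNorm01_of_periodic hg'.continuous hp) hε.le
    have h4 : 2 ^ n * (2 * n + 1) + 2 ≤ B := by
      rw [hB]
      gcongr
      norm_num
    have h5 : (c.depth : ℝ) ≤ B := by exact_mod_cast h2.trans h4
    have h6 : (c.size : ℝ) ≤ B := by exact_mod_cast h3.trans h4
    have h7 : 0 ≤ D * (A + 2) * L := by positivity
    have h8 : 2 * B * L ≤ 2 * B * (n * L) := by gcongr
    have h9 : 0 ≤ D * (A + 2) * (n * L) := by positivity
    refine ⟨c, h1, ?_, ?_⟩
    · rw [add_mul]; linarith
    · rw [mul_assoc, add_mul]; linarith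
  · obtain ⟨m, hm1, hm2⟩ : ∃ m : ℕ, A * L ≤ m ∧ (m : ℝ) ≤ (A + 2) * L :=
      ⟨⌈A * L⌉₊, Nat.le_ceil _, by
        have := Nat.ceil_lt_add_one (by positivity : 0 ≤ A * L)
        linarith⟩
    have hm : n₀ ≤ m := by
      have h1 : (n₀ : ℝ) ≤ m := by
        refine le_trans ?_ hm1
        have : (n₀ : ℝ) ≤ A / 2 := by rw [hA]; linarith
        nlinarith
      exact_mod_cast h1
    obtain ⟨c, ⟨h0, h1⟩, h2, h3⟩ := exists_blockEncoding_of_large hC hR hp hg' hb (by omega) hc₁ hm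
      (not_lt.1 hsmall)
    have h5 : (c.depth : ℝ) ≤ D * m := by exact_mod_cast h2
    have h6 : (c.size : ℝ) ≤ D * m * n := by exact_mod_cast h3
    have h7 : (D : ℝ) * m ≤ D * ((A + 2) * L) := by gcongr
    have h8 : (D : ℝ) * m * n ≤ D * ((A + 2) * L) * n := by gcongr
    have h9 : (0 : ℝ) ≤ 2 * B * L := by positivity
    have h10 : (0 : ℝ) ≤ 2 * B * L * n := by positivity
    refine ⟨c, ⟨h0, h1.trans (exists_precision hC (A := A) ?_ hL hε hLdef hm1)⟩, ?_, ?_⟩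
    · rw [hA]
      have : (0 : ℝ) ≤ n₀ := Nat.cast_nonneg n₀
      linarith
    · calc (c.depth : ℝ) ≤ 2 * B * L + D * ((A + 2) * L) := by linarith
        _ = (2 * B + D * (A + 2)) * L := by ring
    · calc (c.size : ℝ) ≤ 2 * B * L * n + D * ((A + 2) * L) * n := by linarith
        _ = (2 * B + D * (A + 2)) * n * L := by ring
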